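/- **Setting.** Consider an inhomogeneous XXZ chain with $\mathsf N$ sites, spins $s_n$ with $2s_n\in\{1,2,3,\dots\}$, inhomogeneities $\xi_1,\dots,\xi_{\mathsf N}\in\mathbb C$, and $\eta\in\mathbb C$ such that $q=e^{\eta}$ is not a root of unity. The local space $V_n\simeq\mathbb C^{2s_n+1}$ has basis $|k,n\rangle$, $0\le k\le 2s_n$, with $S_n^z|k,n\rangle=(s_n-k)|k,n\rangle$, $S_n^-|k,n\rangle=x_n(k+1)|k+1,n\rangle$, $S_n^+|k,n\rangle=x_n(k)|k-1,n\rangle$, where $x_n(k)=\sqrt{[k]_q[2s_n-k+1]_q}$ and $[j]_q=\sinh(\eta j)/\sinh\eta$. Put $$\mathsf L_n(\lambda)=\begin{pmatrix}\sinh(\lambda+\eta S_n^z)& S_n^-\sinh\eta\\ S_n^+\sinh\eta&\sinh(\lambda-\eta S_n^z)\end{pmatrix},\qquad \mathsf L_{\mathsf N}(\lambda-\xi_{\mathsf N})\cdots \mathsf L_1(\lambda-\xi_1)=\begin{pmatrix}\mathsf A(\lambda)&\mathsf B(\lambda)\\ \mathsf C(\lambda)&\mathsf D(\lambda)\end{pmatrix},$$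 and, for $\kappa\in\mathbb C\setminus\{0\}$, $\bar{\mathsf T}^{(\kappa)}(\lambda)=\kappa^{-1}\mathsf B(\lambda)+\kappa\,\mathsf C(\lambda)$ on $\bigotimes_n V_n$. Let $\Sigma_{\bar{\mathsf T}}^{(\kappa)}$ be the set of its eigenvalue functions, i.e. of functions $\bar{\mathsf t}:\mathbb C\to\mathbb C$ for which there is $v\neq0$ with $\bar{\mathsf T}^{(\kappa)}(\lambda)v=\bar{\mathsf t}(\lambda)v$ for all $\lambda\in\mathbb C$. Let $\xi_n^{(h)}=\xi_n+(s_n-h)\eta$ for $0\le h\le 2s_n$, and assume that the sets $\Xi_n=\{\xi_n^{(h)}+i\pi m: 0\le h\le 2s_n,\ m\in\mathbb Z\}$, $1\le n\le\mathsf N$, are pairwise disjoint. Put $\mathsf N_s=2\sum_n s_n$, $d(\lambda)=\prod_n\sinh(\lambda-\xi_n-s_n\eta)$ and, for $\epsilon\in\{-1,1\}$, $$w_\epsilon(\lambda)=2\epsilon\Big(\frac i2\Big)^{\mathsf N_s}\prod_{n=1}^{\mathsf N}\prod_{h=1}^{2s_n-1}\sinh(\lambda-\xi_n^{(h)}).$$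 For a function $$Q(\lambda)=\prod_{a=1}^{\mathsf N_s}\sinh\Big(\frac{\lambda-\lambda_a}2\Big),\qquad \lambda_1,\dots,\lambda_{\mathsf N_s}\in\mathbb C,\tag{1}$$ let $\mathbf Q^{(n)}=\big(Q(\xi_n^{(h)})\big)_{0\le h\le 2s_n}$ and $\widetilde{\mathbf Q}^{(n)}=\big((-1)^hQ(\xi_n^{(h)}+i\pi)\big)_{0\le h\le 2s_n}$, and consider the Wronskian identity $$Q(\lambda)\,Q(\lambda+i\pi-\eta)+Q(\lambda+i\pi)\,Q(\lambda-\eta)=d(\lambda)\,w_\epsilon(\lambda)\quad\text{for all }\lambda\in\mathbb C\tag{2}$$ and the expression $$\bar{\mathsf t}(\lambda)=\frac{Q(\lambda+\eta)\,Q(\lambda+i\pi-\eta)-Q(\lambda+\eta+i\pi)\,Q(\lambda-\eta)}{w_\epsilon(\lambda)},\tag{3}$$ where (3) means that $\bar{\mathsf t}$ is an entire function given by this quotient wherever $w_\epsilon(\lambda)\ne0$. **Proposition 5.1.** Let $\kappa\in\mathbb C\setminus\{0\}$. 1. Let $Q$ be of the form (1) and such that, for each $n\in\{1,\dots,\mathsf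 N\}$, the vectors $\mathbf Q^{(n)}$ and $\widetilde{\mathbf Q}^{(n)}$ are proportional (one is a scalar multiple of the other) and not both zero. Then $Q$ satisfies (2) for some $\epsilon\in\{-1,1\}$, and for this $\epsilon$ the quotient (3) extends to an entire function $\bar{\mathsf t}$, which belongs to $\Sigma_{\bar{\mathsf T}}^{(\kappa)}$. 2. Conversely, let $\bar{\mathsf t}\in\Sigma_{\bar{\mathsf T}}^{(\kappa)}$. Then there are $\epsilon\in\{-1,1\}$ and $Q$ of the form (1) such that (2) and (3) hold and such that, for each $n\in\{1,\dots,\mathsf N\}$, the vectors $\mathbf Q^{(n)}$ and $\widetilde{\mathbf Q}^{(n)}$ are proportional and not both zero. -/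

import Mathlib

/-- The parameters of an inhomogeneous XXZ chain with `N` sites: `twoS n` is twice the spin at
site `n`, `ξ n` the inhomogeneity at site `n`, and `η` the anisotropy parameter. -/
structure XXZChain (N : ℕ) where
  twoS : Fin N → ℕ
  ξ : Fin N → ℂ
  η : ℂ

namespace XXZChain

noncomputable section

variable {N : ℕ} (X : XXZChain N)

/-- `q = exp η` is not a root of unity, i.e. `η` is not commensurate to `iπ`. -/
def Generic : Prop := ∀ k : ℕ, 0 < k → Complex.exp X.η ^ k ≠ 1

/-- The shifted inhomogeneity `ξ_n^{(h)} = ξ_n + (s_n - h) η`. -/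
def shift (n : Fin N) (h : ℕ) : ℂ := X.ξ n + ((X.twoS n : ℂ) / 2 - h) * X.η

/-- The set `Ξ_n` of all `ξ_n + k η + m i π`, with `k ∈ {-s_n, -s_n + 1, …, s_n}`
(written `k = s_n - h`, `0 ≤ h ≤ 2 s_n`) and `m ∈ ℤ`. -/
def stringSet (n : Fin N) : Set ℂ :=
  {z | ∃ h : ℕ, h ≤ X.twoS n ∧ ∃ m : ℤ, z = X.shift n h + m * (Real.pi * Complex.I)}

/-- The condition that the sets `Ξ_n` are pairwise disjoint. -/
def InhomogeneityCondition : Prop :=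
  ∀ i j : Fin N, i ≠ j → Disjoint (X.stringSet i) (X.stringSet j)

/-! ### The transfer matrix -/

/-- The `q`-integer `[j]_q = sinh (η j) / sinh η`. -/
def qInt (j : ℂ) : ℂ := Complex.sinh (X.η * j) / Complex.sinh X.η

/-- `x_n(k) = √([k]_q [2 s_n - k + 1]_q)`, with the principal square root. -/
def ladder (n : Fin N) (k : ℕ) : ℂ :=
  (X.qInt k * X.qInt ((X.twoS n : ℂ) - k + 1)) ^ (1 / 2 : ℂ)

/-- Index set of the basis `|0, n⟩, …, |2 s_n, n⟩` of the local space at site `n`. -/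
abbrev LocalIdx (n : Fin N) : Type := Fin (X.twoS n + 1)

/-- Index set of the product basis of the tensor product of the local spaces. -/
abbrev Idx : Type := (n : Fin N) → X.LocalIdx n

/-- Operators on the space of states, as matrices in the product basis
(`M h h'` is the coefficient of the basis vector `h` in the image of the basis vector `h'`). -/
abbrev Op : Type := Matrix X.Idx X.Idx ℂ

/-- A function of `S_n^z`: the diagonal matrix with entry `f (s_n - k)` at `|k, n⟩`. -/
def diagSz (n : Fin N) (f : ℂ → ℂ) : Matrix (X.LocalIdx n) (X.LocalIdx n) ℂ :=
  Matrix.diagonal fun k => f ((X.twoS n : ℂ) / 2 - (k : ℕ))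

/-- `S_n^- |k, n⟩ = x_n(k+1) |k+1, n⟩`. -/
def sMinus (n : Fin N) : Matrix (X.LocalIdx n) (X.LocalIdx n) ℂ :=
  fun i j => if (i : ℕ) = j + 1 then X.ladder n i else 0

/-- `S_n^+ |k, n⟩ = x_n(k) |k-1, n⟩`. -/
def sPlus (n : Fin N) : Matrix (X.LocalIdx n) (X.LocalIdx n) ℂ :=
  fun i j => if (j : ℕ) = i + 1 then X.ladder n j else 0

/-- The operator acting as `A` on the `n`-th tensor factor and as the identity on the others. -/
def atSite (n : Fin N) (A : Matrix (X.LocalIdx n) (X.LocalIdx n) ℂ) : X.Op :=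
  fun h h' => if ∀ m, m ≠ n → h m = h' m then A (h n) (h' n) else 0

/-- The Lax operator at site `n`, a `2 × 2` matrix in the auxiliary space with operator entries. -/
def lax (n : Fin N) (lam : ℂ) : Matrix (Fin 2) (Fin 2) X.Op :=
  !![X.atSite n (X.diagSz n fun z => Complex.sinh (lam + X.η * z)),
      X.atSite n (Complex.sinh X.η • X.sMinus n);
     X.atSite n (Complex.sinh X.η • X.sPlus n),
      X.atSite n (X.diagSz n fun z => Complex.sinh (lam - X.η * z))]

/-- The monodromy matrix `L_N(λ - ξ_N) ⋯ L_1(λ - ξ_1) = [[A, B], [C, D]]`. -/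
def monodromy (lam : ℂ) : Matrix (Fin 2) (Fin 2) X.Op :=
  (List.ofFn fun n : Fin N => X.lax n (lam - X.ξ n)).reverse.prod

/-- The `κ`-twisted antiperiodic transfer matrix `κ⁻¹ B(λ) + κ C(λ)`. -/
def transfer (κ lam : ℂ) : X.Op :=
  κ⁻¹ • X.monodromy lam 0 1 + κ • X.monodromy lam 1 0

/-- The set of eigenvalue functions of the commuting family `transfer κ λ`, `λ ∈ ℂ`. -/
def spectrumFun (κ : ℂ) : Set (ℂ → ℂ) :=
  {t | ∃ v : X.Idx → ℂ, v ≠ 0 ∧ ∀ lam : ℂ, Matrix.mulVec (X.transfer κ lam) v = t lam • v}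

/-! ### The functions `Q`, `w_ε` and `t̄` -/

/-- The number `𝖭_s = 2 ∑ s_n` of roots. -/
abbrev numRoots : ℕ := ∑ n, X.twoS n

/-- `Q(λ) = ∏_a sinh ((λ - λ_a) / 2)` for the family of roots `r`. -/
def Q (r : Fin X.numRoots → ℂ) (lam : ℂ) : ℂ := ∏ a, Complex.sinh ((lam - r a) / 2)

/-- `d(λ) = ∏_n sinh (λ - ξ_n - s_n η)`. -/
def d (lam : ℂ) : ℂ := ∏ n, Complex.sinh (lam - X.ξ n - (X.twoS n : ℂ) / 2 * X.η)

/-- `w_ε(λ) = 2 ε (i/2)^{𝖭_s} ∏_n ∏_{h=1}^{2 s_n - 1} sinh (λ - ξ_n^{(h)})`. -/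
def w (ε lam : ℂ) : ℂ :=
  2 * ε * (Complex.I / 2) ^ X.numRoots *
    ∏ n, ∏ h ∈ Finset.Ico 1 (X.twoS n), Complex.sinh (lam - X.shift n h)

/-- The Wronskian identity
`Q(λ) Q(λ + iπ - η) + Q(λ + iπ) Q(λ - η) = d(λ) w_ε(λ)`. -/
def Wronskian (ε : ℂ) (r : Fin X.numRoots → ℂ) : Prop :=
  ∀ lam : ℂ,
    X.Q r lam * X.Q r (lam + Real.pi * Complex.I - X.η)
      + X.Q r (lam + Real.pi * Complex.I) * X.Q r (lam - X.η) = X.d lam * X.w ε lam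

/-- `t` is the entire function given by
`(Q(λ + η) Q(λ + iπ - η) - Q(λ + η + iπ) Q(λ - η)) / w_ε(λ)`: the formula holds wherever the
denominator does not vanish, and `t` is entire, which determines `t` at the remaining points. -/
def IsTFunction (ε : ℂ) (r : Fin X.numRoots → ℂ) (t : ℂ → ℂ) : Prop :=
  Differentiable ℂ t ∧ ∀ lam : ℂ, X.w ε lam ≠ 0 →
    t lam =
      (X.Q r (lam + X.η) * X.Q r (lam + Real.pi * Complex.I - X.η)
        - X.Q r (lam + X.η + Real.pi * Complex.I) * X.Q r (lam - X.η)) / X.w ε lam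

/-- The vector with coordinates `Q(ξ_n^{(h)})`, `0 ≤ h ≤ 2 s_n`. -/
def vecQ (r : Fin X.numRoots → ℂ) (n : Fin N) : X.LocalIdx n → ℂ :=
  fun h => X.Q r (X.shift n h)

/-- The vector with coordinates `(-1)^h Q(ξ_n^{(h)} + iπ)`, `0 ≤ h ≤ 2 s_n`. -/
def vecQTilde (r : Fin X.numRoots → ℂ) (n : Fin N) : X.LocalIdx n → ℂ :=
  fun h => (-1) ^ (h : ℕ) * X.Q r (X.shift n h + Real.pi * Complex.I)

/-- For every site the two vectors are proportional (one of them is a scalar multiple of the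
other), and not both zero. -/
def ProportionalVectors (r : Fin X.numRoots → ℂ) : Prop :=
  ∀ n : Fin N,
    (∃ c : ℂ, X.vecQ r n = c • X.vecQTilde r n ∨ X.vecQTilde r n = c • X.vecQ r n) ∧
      ¬ (X.vecQ r n = 0 ∧ X.vecQTilde r n = 0)

end

end XXZChain

/-! Both parts pass through the homogeneous Baxter equation `t(λ) Q(λ) = d(λ) Q(λ+η) - a(λ) Q(λ-η)`.
When `t` has parity `(-1)^(N-1)` under `λ ↦ λ+iπ`, the function `Q(λ+iπ)` solves the same equation
with the right side negated. The left side of the Wronskian identity is the Wronskian of this pair,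
and the formula for `t` is Cramer's rule. Along the string `ξ_n^{(0)}, …, ξ_n^{(2s_n)}` the equation
closes, since `d` vanishes at the first point and `a` at the last. A solution on the string is then
fixed by its value at `h = 0`, which is why the two vectors are proportional.

For a proportional pair, the minors of adjacent entries make the Wronskian vanish at `𝖭_s` points
distinct modulo `iπ`. This fixes it up to a constant, and the product of its extreme coefficients
fixes the constant up to sign (`wronskianOf_const`). The minors at distance two make the numerator
vanish at the zeros of `w` on the strings, so the quotient is entire
(`ProportionalVectors.exists_quotient`) and the Baxter equation follows (`BaxterEq.of_wronskianOf`).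
Separation of variables then produces an eigenvector. Acting with the operators `C(ξ_n^{(k)})` on
the reference covector gives a basis of covectors diagonalizing all `D(λ)`, on which the transfer
matrix acts by the discrete Baxter equations (`IsSovFamily.vecMul_transfer`). The vector with
components `∏ q_n(h_n)` is therefore an eigenvector (`mem_spectrumFun_of_isStringSolution`).

For the converse, an explicit product covector `Ω(λ)` is carried by the transfer matrix to a
combination of `Ω(λ+η)` and `Ω(λ-η)` (`vecMul_transfer_prodCov`). Pairing it with an eigenvector `v`
gives a Baxter solution of order `𝖭_s`. Its lowest coefficient is `v 0`, which is nonzero because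
the separated recursion determines `v` from it. The Wronskian then forces the highest coefficient to
be nonzero as well, so there are exactly `𝖭_s` roots (`BaxterEq.exists_roots`). The two vectors
cannot both vanish, because the Wronskian would then have a double zero where `d w` has a simple
one. -/

/-! ### Exponential polynomials -/

section ExpPoly

open Complex Polynomial

/-- `f` is of the form `exp (-m z / 2) P (exp z)` with a polynomial `P` of degree at most `m`, whose
coefficients in degrees `0` and `m` are `lo` and `hi`. -/
def IsExpPoly (m : ℕ) (lo hi : ℂ) (f : ℂ → ℂ) : Prop :=
  ∃ P : ℂ[X], P.natDegree ≤ m ∧ P.coeff 0 = lo ∧ P.coeff m = hi ∧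
    ∀ z, f z = exp (-(m * z / 2)) * P.eval (exp z)

/-- `f` is an exponential polynomial of order `m`, with unspecified extreme coefficients. -/
def ExpPolyOrder (m : ℕ) (f : ℂ → ℂ) : Prop := ∃ lo hi, IsExpPoly m lo hi f

namespace IsExpPoly

variable {m k : ℕ} {lo hi lo' hi' : ℂ} {f g : ℂ → ℂ}

theorem order (hf : IsExpPoly m lo hi f) : ExpPolyOrder m f := ⟨lo, hi, hf⟩

theorem mul (hf : IsExpPoly m lo hi f) (hg : IsExpPoly k lo' hi' g) :
    IsExpPoly (m + k) (lo * lo') (hi * hi') fun z => f z * g z := by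
  obtain ⟨P, hP, rfl, rfl, hPf⟩ := hf
  obtain ⟨R, hR, rfl, rfl, hRg⟩ := hg
  refine ⟨P * R, natDegree_mul_le_of_le hP hR, mul_coeff_zero _ _,
    coeff_mul_add_eq_of_natDegree_le hP hR, fun z => ?_⟩
  have : exp (-(((m + k : ℕ) : ℂ) * z / 2)) = exp (-(m * z / 2)) * exp (-(k * z / 2)) := by
    rw [← exp_add]; push_cast; ring_nf
  simp only [this, hPf, hRg, eval_mul]; ring

theorem add (hf : IsExpPoly m lo hi f) (hg : IsExpPoly m lo' hi' g) :
    IsExpPoly m (lo + lo') (hi + hi') fun z => f z + g z := by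
  obtain ⟨P, hP, rfl, rfl, hPf⟩ := hf
  obtain ⟨R, hR, rfl, rfl, hRg⟩ := hg
  refine ⟨P + R, natDegree_add_le_of_degree_le hP hR, coeff_add _ _ _, coeff_add _ _ _,
    fun z => ?_⟩
  simp only [hPf, hRg, eval_add]; ring

theorem const_mul (c : ℂ) (hf : IsExpPoly m lo hi f) :
    IsExpPoly m (c * lo) (c * hi) fun z => c * f z := by
  obtain ⟨P, hP, rfl, rfl, hPf⟩ := hf
  refine ⟨C c * P, natDegree_C_mul_le _ _ |>.trans hP, coeff_C_mul _, coeff_C_mul _, fun z => ?_⟩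
  simp only [hPf, eval_mul, eval_C]; ring

theorem sub (hf : IsExpPoly m lo hi f) (hg : IsExpPoly m lo' hi' g) :
    IsExpPoly m (lo - lo') (hi - hi') fun z => f z - g z := by
  simpa [sub_eq_add_neg] using hf.add (hg.const_mul (-1))

theorem const (c : ℂ) : IsExpPoly 0 c c fun _ => c :=
  ⟨C c, by simp, by simp, by simp, fun z => by simp⟩

theorem comp_add (c : ℂ) (hf : IsExpPoly m lo hi f) :
    IsExpPoly m (lo * exp (-(m * c / 2))) (hi * exp (m * c / 2)) fun z => f (z + c) := by
  obtain ⟨P, hP, rfl, rfl, hPf⟩ := hf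
  refine ⟨C (exp (-(m * c / 2))) * P.comp (C (exp c) * X), ?_, ?_, ?_, fun z => ?_⟩
  · refine (natDegree_C_mul_le _ _).trans (natDegree_comp_le.trans ?_)
    exact (Nat.mul_le_mul hP (natDegree_C_mul_le _ _ |>.trans natDegree_X_le)).trans (by simp)
  · rw [coeff_C_mul, comp_C_mul_X_coeff]; ring
  · rw [coeff_C_mul, comp_C_mul_X_coeff, ← exp_nat_mul]
    have : exp (m * c / 2) = exp (-(m * c / 2)) * exp (m * c) := by
      rw [← exp_add]; ring_nf
    rw [this]; ring
  · have : exp (-(m * (z + c) / 2)) = exp (-(m * z / 2)) * exp (-(m * c / 2)) := by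
      rw [← exp_add]; ring_nf
    simp only [hPf, this, exp_add, eval_mul, eval_C, eval_comp, eval_X, mul_comm (exp z)]; ring

theorem prod {ι : Type*} (s : Finset ι) {m : ι → ℕ} {lo hi : ι → ℂ} {f : ι → ℂ → ℂ}
    (hf : ∀ i ∈ s, IsExpPoly (m i) (lo i) (hi i) (f i)) :
    IsExpPoly (∑ i ∈ s, m i) (∏ i ∈ s, lo i) (∏ i ∈ s, hi i) fun z => ∏ i ∈ s, f i z := by
  classical
  induction s using Finset.induction_on with
  | empty => simpa using const 1
  | insert i s hi ih =>
    simp only [Finset.sum_insert hi, Finset.prod_insert hi]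
    exact (hf i (by simp)).mul (ih fun j hj => hf j (by simp [hj]))

theorem sinh_sub (c : ℂ) : IsExpPoly 2 (-exp c / 2) (exp (-c) / 2) fun z => sinh (z - c) := by
  refine ⟨C (exp (-c) / 2) * X ^ 2 + C (-exp c / 2), ?_, ?_, ?_, fun z => ?_⟩
  · compute_degree
  · simp
  · simp
  · simp only [eval_add, eval_mul, eval_C, eval_pow, eval_X, Complex.sinh, ← exp_nat_mul]
    have h1 : exp (z - c) = exp (-(((2 : ℕ) : ℂ) * z / 2)) * exp ((2 : ℕ) * z) * exp (-c) := by
      rw [← exp_add, ← exp_add]; push_cast; ring_nf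
    have h2 : exp (-(z - c)) = exp (-(((2 : ℕ) : ℂ) * z / 2)) * exp c := by
      rw [← exp_add]; push_cast; ring_nf
    rw [h1, h2]; ring

theorem sinh_half (c : ℂ) :
    IsExpPoly 1 (-exp (c / 2) / 2) (exp (-(c / 2)) / 2) fun z => sinh ((z - c) / 2) := by
  refine ⟨C (exp (-(c / 2)) / 2) * X + C (-exp (c / 2) / 2), ?_, ?_, ?_, fun z => ?_⟩
  · compute_degree
  · simp
  · simp
  · simp only [eval_add, eval_mul, eval_C, eval_X, Complex.sinh]
    have h1 : exp ((z - c) / 2) = exp (-(((1 : ℕ) : ℂ) * z / 2)) * exp z * exp (-(c / 2)) := by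
      rw [← exp_add, ← exp_add]; push_cast; ring_nf
    have h2 : exp (-((z - c) / 2)) = exp (-(((1 : ℕ) : ℂ) * z / 2)) * exp (c / 2) := by
      rw [← exp_add]; push_cast; ring_nf
    rw [h1, h2]; ring

/-- Writing `c` as `exp (-z) · (c exp z)` puts the constant off-diagonal Lax entries on the same
footing as the diagonal ones of order 2. -/
theorem const_two (c : ℂ) : IsExpPoly 2 0 0 fun _ => c := by
  refine ⟨C c * X, ?_, ?_, ?_, fun z => ?_⟩
  · compute_degree!
  · simp
  · simp
  · simp [exp_neg]; field_simp

end IsExpPoly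

theorem infinite_range_cexp : (Set.range exp).Infinite := by
  rw [range_exp]; exact (Set.finite_singleton (0 : ℂ)).infinite_compl

namespace IsExpPoly

variable {m : ℕ} {lo hi lo' hi' : ℂ} {f : ℂ → ℂ}

theorem unique (hf : IsExpPoly m lo hi f) (hf' : IsExpPoly m lo' hi' f) : lo = lo' ∧ hi = hi' := by
  obtain ⟨P, hP, rfl, rfl, hPf⟩ := hf
  obtain ⟨R, hR, rfl, rfl, hRf⟩ := hf'
  have : P = R := by
    refine eq_of_infinite_eval_eq _ _ (infinite_range_cexp.mono ?_)
    rintro _ ⟨z, rfl⟩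
    have := (hPf z).symm.trans (hRf z)
    exact mul_left_cancel₀ (exp_ne_zero _) this
  subst this; exact ⟨rfl, rfl⟩

end IsExpPoly

namespace ExpPolyOrder

variable {m k : ℕ} {f g : ℂ → ℂ}

theorem mul (hf : ExpPolyOrder m f) (hg : ExpPolyOrder k g) :
    ExpPolyOrder (m + k) fun z => f z * g z := by
  obtain ⟨_, _, hf⟩ := hf; obtain ⟨_, _, hg⟩ := hg; exact (hf.mul hg).order

theorem add (hf : ExpPolyOrder m f) (hg : ExpPolyOrder m g) :
    ExpPolyOrder m fun z => f z + g z := by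
  obtain ⟨_, _, hf⟩ := hf; obtain ⟨_, _, hg⟩ := hg; exact (hf.add hg).order

theorem sub (hf : ExpPolyOrder m f) (hg : ExpPolyOrder m g) :
    ExpPolyOrder m fun z => f z - g z := by
  obtain ⟨_, _, hf⟩ := hf; obtain ⟨_, _, hg⟩ := hg; exact (hf.sub hg).order

theorem const_mul (c : ℂ) (hf : ExpPolyOrder m f) : ExpPolyOrder m fun z => c * f z := by
  obtain ⟨_, _, hf⟩ := hf; exact (hf.const_mul c).order

theorem comp_add (c : ℂ) (hf : ExpPolyOrder m f) : ExpPolyOrder m fun z => f (z + c) := by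
  obtain ⟨_, _, hf⟩ := hf; exact (hf.comp_add c).order

theorem zero : ExpPolyOrder m fun _ => 0 :=
  ⟨0, 0, 0, by simp, by simp, by simp, fun z => by simp⟩

theorem sum {ι : Type*} (s : Finset ι) {f : ι → ℂ → ℂ} (hf : ∀ i ∈ s, ExpPolyOrder m (f i)) :
    ExpPolyOrder m fun z => ∑ i ∈ s, f i z := by
  classical
  induction s using Finset.induction_on with
  | empty => simpa using zero
  | insert i s hi ih =>
    simp only [Finset.sum_insert hi]
    exact (hf i (by simp)).add (ih fun j hj => hf j (by simp [hj]))

theorem prod {ι : Type*} (s : Finset ι) {m : ι → ℕ} {f : ι → ℂ → ℂ}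
    (hf : ∀ i ∈ s, ExpPolyOrder (m i) (f i)) :
    ExpPolyOrder (∑ i ∈ s, m i) fun z => ∏ i ∈ s, f i z := by
  choose! lo hi h using hf
  exact (IsExpPoly.prod s h).order

theorem differentiable (hf : ExpPolyOrder m f) : Differentiable ℂ f := by
  obtain ⟨_, _, P, -, -, -, hPf⟩ := hf
  rw [funext hPf]
  have : Differentiable ℂ fun z => P.eval (exp z) := P.differentiable.comp differentiable_exp
  fun_prop

/-- An exponential polynomial of order `m` with more than `m` zeros modulo `2πi` vanishes. -/
theorem eq_zero {ι : Type*} [Fintype ι] (hf : ExpPolyOrder m f) (x : ι → ℂ)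
    (hx : Function.Injective fun i => exp (x i)) (hfx : ∀ i, f (x i) = 0)
    (hcard : m < Fintype.card ι) (z : ℂ) : f z = 0 := by
  obtain ⟨_, _, P, hP, -, -, hPf⟩ := hf
  have : P = 0 := by
    refine eq_zero_of_natDegree_lt_card_of_eval_eq_zero P hx (fun i => ?_) (hP.trans_lt hcard)
    have := hfx i
    rw [hPf] at this
    exact (mul_eq_zero.mp this).resolve_left (exp_ne_zero _)
  simp [hPf, this]

end ExpPolyOrder

/-! ### Zero counting for exponential polynomials of definite parity. -/

theorem injective_exp_pm {ι : Type*} {x : ι → ℂ}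
    (hx : Function.Injective fun i => exp (2 * x i)) :
    Function.Injective fun p : ι ⊕ ι => exp (p.elim x fun i => x i + Real.pi * I) := by
  have sq : ∀ z, exp (2 * z) = exp z ^ 2 := fun z => by rw [← exp_nat_mul]; norm_num
  have key : ∀ i j, exp (x i) ^ 2 = exp (x j) ^ 2 → i = j := fun i j h =>
    hx (by simpa [sq] using h)
  rintro (i | i) (j | j) h <;> simp only [Sum.elim_inl, Sum.elim_inr, exp_add_pi_mul_I] at h
  · rw [key i j (by rw [h])]
  · have hij := key i j (by rw [h]; ring)
    subst hij
    exact absurd (self_eq_neg.mp h) (exp_ne_zero _)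
  · have hij := key i j (by rw [← h]; ring)
    subst hij
    exact absurd (self_eq_neg.mp h.symm) (exp_ne_zero _)
  · rw [key i j (by rw [neg_inj.mp h])]

/-- An exponential polynomial of order `2 n` and parity opposite to `n` under `z ↦ z + iπ` is
determined by its values at `n` points that are distinct modulo `iπ`. -/
theorem ExpPolyOrder.eq_zero_of_odd {ι : Type*} [Fintype ι] {f : ℂ → ℂ}
    (hf : ExpPolyOrder (2 * Fintype.card ι) f)
    (hpar : ∀ z, f (z + Real.pi * I) = -(-1) ^ Fintype.card ι * f z) (x : ι → ℂ)
    (hx : Function.Injective fun i => exp (2 * x i)) (hfx : ∀ i, f (x i) = 0) (z : ℂ) :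
    f z = 0 := by
  obtain ⟨_, _, P, hP, -, -, hPf⟩ := hf
  set n := Fintype.card ι
  -- The prefactor `exp (-n z)` already contributes `(-1)^n`, so the opposite parity of `f` makes
  -- `P` an odd polynomial.
  have hodd : P.comp (-X) = -P := by
    refine eq_of_infinite_eval_eq _ _ (infinite_range_cexp.mono ?_)
    rintro _ ⟨z, rfl⟩
    have h := hpar z
    have he : exp (-(((2 * n : ℕ) : ℂ) * (z + Real.pi * I) / 2)) =
        exp (-(((2 * n : ℕ) : ℂ) * z / 2)) * (-1) ^ n := by
      have : (-1 : ℂ) ^ n = exp (-(n * (Real.pi * I))) := by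
        rw [exp_neg, exp_nat_mul, exp_pi_mul_I, ← inv_pow]; norm_num
      rw [this, ← exp_add]; push_cast; ring_nf
    rw [hPf, hPf, he, exp_add_pi_mul_I] at h
    have h1 : ((-1 : ℂ)) ^ n ≠ 0 := by simp
    have h2 := exp_ne_zero (-(((2 * n : ℕ) : ℂ) * z / 2))
    have h3 : exp (-(((2 * n : ℕ) : ℂ) * z / 2)) * (-1) ^ n * (eval (-exp z) P + eval (exp z) P) = 0 := by
      linear_combination h
    have h4 := (mul_eq_zero.mp h3).resolve_left (mul_ne_zero h2 h1)
    simp only [Set.mem_ofPred_eq, eval_comp, eval_neg, eval_X]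
    linear_combination h4
  have hP0 : P.eval 0 = 0 := by
    have := congrArg (eval 0) hodd
    simp only [eval_comp, eval_neg, eval_X, neg_zero] at this
    exact self_eq_neg.mp this
  have hroot : ∀ z, f z = 0 → P.eval (exp z) = 0 := fun z h => by
    rw [hPf] at h; exact (mul_eq_zero.mp h).resolve_left (exp_ne_zero _)
  have hinj := injective_exp_pm hx
  -- Oddness supplies the root `0` in addition to the `2n` roots `± exp (x i)`: one root more than
  -- the degree allows.
  have : P = 0 := by
    refine eq_zero_of_natDegree_lt_card_of_eval_eq_zero P (ι := Option (ι ⊕ ι))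
      (f := fun o => o.elim 0 fun p => exp (p.elim x fun i => x i + Real.pi * I)) ?_ ?_ ?_
    · rintro (_ | p) (_ | q) h
      · rfl
      · exact absurd h.symm (exp_ne_zero _)
      · exact absurd h (exp_ne_zero _)
      · exact congrArg some (hinj h)
    · rintro (_ | i | i)
      · exact hP0
      · exact hroot _ (hfx i)
      · exact hroot _ (by simp [hpar, hfx i])
    · simp only [Fintype.card_option, Fintype.card_sum]; omega
  simp [hPf, this]

theorem sinh_ne_zero_iff {z : ℂ} : sinh z ≠ 0 ↔ exp (2 * z) ≠ 1 := by
  have : sinh z = exp (-z) * (exp (2 * z) - 1) / 2 := by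
    rw [mul_sub, ← exp_add, Complex.sinh]; ring_nf
  rw [this]; simp [sub_eq_zero]

theorem sinh_sub_ne_zero_iff {z w : ℂ} : sinh (z - w) ≠ 0 ↔ exp (2 * z) ≠ exp (2 * w) := by
  rw [sinh_ne_zero_iff, mul_sub, exp_sub, Ne, div_eq_one_iff_eq (exp_ne_zero _)]

theorem isExpPoly_prod_sinh {ι : Type*} [Fintype ι] (x : ι → ℂ) :
    IsExpPoly (2 * Fintype.card ι) (∏ i, (-exp (x i) / 2)) (∏ i, (exp (-x i) / 2))
      fun z => ∏ i, sinh (z - x i) := by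
  have := IsExpPoly.prod Finset.univ (fun i _ => IsExpPoly.sinh_sub (x i))
  rwa [Finset.sum_const, Finset.card_univ, smul_eq_mul, mul_comm] at this

theorem prod_sinh_add_pi_mul_I {ι : Type*} [Fintype ι] (x : ι → ℂ) (z : ℂ) :
    ∏ i, sinh (z + Real.pi * I - x i) = (-1) ^ Fintype.card ι * ∏ i, sinh (z - x i) := by
  simp_rw [show ∀ i, z + Real.pi * I - x i = z - x i + Real.pi * I from fun i => by ring,
    sinh_add_pi_mul_I, Finset.prod_neg, Finset.card_univ]

theorem exists_forall_sinh_sub_ne_zero {ι : Type*} [Fintype ι] (x : ι → ℂ) :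
    ∃ z, ∀ i, sinh (z - x i) ≠ 0 := by
  classical
  obtain ⟨y, hy, hy'⟩ := infinite_range_cexp.exists_notMem_finset
    (Finset.univ.image fun i => exp (2 * x i))
  obtain ⟨z, rfl⟩ := hy
  refine ⟨z / 2, fun i => sinh_sub_ne_zero_iff.mpr fun h => hy' ?_⟩
  rw [mul_div_cancel₀ _ two_ne_zero] at h
  simp only [Finset.mem_image, Finset.mem_univ, true_and]
  exact ⟨i, h.symm⟩

/-- An exponential polynomial of order `2 n` and the parity of `n` under `z ↦ z + iπ` is determined
up to a factor by `n` zeros that are distinct modulo `iπ`. -/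
theorem ExpPolyOrder.eq_const_mul_prod_sinh {ι : Type*} [Fintype ι] {f : ℂ → ℂ}
    (hf : ExpPolyOrder (2 * Fintype.card ι) f)
    (hpar : ∀ z, f (z + Real.pi * I) = (-1) ^ Fintype.card ι * f z) (x : ι → ℂ)
    (hx : Function.Injective fun i => exp (2 * x i)) (hfx : ∀ i, f (x i) = 0) :
    ∃ c, ∀ z, f z = c * ∏ i, sinh (z - x i) := by
  obtain ⟨z₀, hz₀⟩ := exists_forall_sinh_sub_ne_zero x
  have hprod : ∏ i, sinh (z₀ - x i) ≠ 0 := Finset.prod_ne_zero_iff.mpr fun i _ => hz₀ i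
  -- Matching at `z₀` gives the difference one zero beyond the `2n` at `x i` and `x i + iπ`.
  refine ⟨f z₀ / ∏ i, sinh (z₀ - x i), fun z => ?_⟩
  set c := f z₀ / ∏ i, sinh (z₀ - x i)
  have key := (hf.sub ((isExpPoly_prod_sinh x).order.const_mul c)).eq_zero
    (fun o : Option (ι ⊕ ι) => o.elim z₀ fun p => p.elim x fun i => x i + Real.pi * I) ?_ ?_ ?_ z
  · exact sub_eq_zero.mp key
  · have hinj := injective_exp_pm hx
    have h1 : ∀ p : ι ⊕ ι, exp z₀ ≠ exp (p.elim x fun i => x i + Real.pi * I) := by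
      rintro (i | i) h
      · exact sinh_sub_ne_zero_iff.mp (hz₀ i) (by
          rw [two_mul, two_mul, exp_add, exp_add]; simp_all)
      · refine sinh_sub_ne_zero_iff.mp (hz₀ i) ?_
        simp only [Sum.elim_inr, exp_add_pi_mul_I] at h
        rw [two_mul, two_mul, exp_add, exp_add, h]; ring
    rintro (_ | p) (_ | q) h
    · rfl
    · exact absurd h (h1 q)
    · exact absurd h.symm (h1 p)
    · exact congrArg some (hinj h)
  · have h0 : ∀ i, ∏ j, sinh (x i - x j) = 0 := fun i =>
      Finset.prod_eq_zero (Finset.mem_univ i) (by simp)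
    rintro (_ | i | i)
    · simp only [Option.elim_none, c]; field_simp; simp
    · simp [hfx, h0]
    · simp only [Option.elim_some, Sum.elim_inr, hpar, prod_sinh_add_pi_mul_I, hfx, h0]; simp
  · simp only [Fintype.card_option, Fintype.card_sum]; omega

/-- Cancellation of an entire factor that does not vanish identically. -/
theorem eq_of_mul_eq_mul_of_differentiable {f g h : ℂ → ℂ} (hh : Differentiable ℂ h)
    (hf : Continuous f) (hg : Continuous g) (h0 : ∃ z, h z ≠ 0)
    (H : ∀ z, h z ≠ 0 → f z = g z) (z : ℂ) : f z = g z := by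
  have hana : AnalyticOnNhd ℂ h Set.univ := fun z _ => hh.analyticAt z
  have hev : ∀ᶠ w in nhdsWithin z {z}ᶜ, h w ≠ 0 := by
    rcases (hh.analyticAt z).eventually_eq_zero_or_eventually_ne_zero with h1 | h1
    · obtain ⟨w, hw⟩ := h0
      exact absurd (hana.eqOn_zero_of_preconnected_of_eventuallyEq_zero isPreconnected_univ
        (Set.mem_univ z) h1 (Set.mem_univ w)) hw
    · exact h1
  have h2 : Filter.Tendsto f (nhdsWithin z {z}ᶜ) (nhds (g z)) :=
    ((hg.tendsto z).mono_left nhdsWithin_le_nhds).congr' (hev.mono fun w hw => (H w hw).symm)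
  exact tendsto_nhds_unique ((hf.tendsto z).mono_left nhdsWithin_le_nhds) h2

end ExpPoly

/-! ### Strings of inhomogeneities -/

namespace XXZChain

section Strings

open Complex

variable {N : ℕ} (X : XXZChain N)

theorem shift_zero (n : Fin N) : X.shift n 0 = X.ξ n + (X.twoS n : ℂ) / 2 * X.η := by
  simp [shift]

theorem shift_add (n : Fin N) (h k : ℕ) : X.shift n (h + k) = X.shift n h - k * X.η := by
  simp only [shift]; push_cast; ring

theorem shift_succ (n : Fin N) (h : ℕ) : X.shift n (h + 1) = X.shift n h - X.η := by
  rw [shift_add]; simp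

theorem shift_succ_add (n : Fin N) (h : ℕ) : X.shift n (h + 1) + X.η = X.shift n h := by
  rw [shift_succ]; ring

variable {X}

theorem Generic.sinh_nat_mul_ne_zero (hη : X.Generic) {k : ℕ} (hk : k ≠ 0) :
    sinh (k * X.η) ≠ 0 := by
  rw [sinh_ne_zero_iff]
  have := hη (2 * k) (by omega)
  rwa [← exp_nat_mul, show ((2 * k : ℕ) : ℂ) * X.η = 2 * (k * X.η) by push_cast; ring] at this

theorem Generic.sinh_ne_zero (hη : X.Generic) : sinh X.η ≠ 0 := by
  simpa using hη.sinh_nat_mul_ne_zero one_ne_zero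

theorem Generic.sinh_shift_sub_ne_zero (hη : X.Generic) (n : Fin N) {h k : ℕ} (hk : h ≠ k) :
    sinh (X.shift n h - X.shift n k) ≠ 0 := by
  rcases hk.lt_or_gt with hlt | hlt
  · obtain ⟨j, rfl⟩ := Nat.exists_eq_add_of_lt hlt
    rw [add_assoc, shift_add, sub_sub_cancel]
    exact hη.sinh_nat_mul_ne_zero (by omega)
  · obtain ⟨j, rfl⟩ := Nat.exists_eq_add_of_lt hlt
    rw [add_assoc, shift_add, sub_sub_cancel_left, sinh_neg, neg_ne_zero]
    exact hη.sinh_nat_mul_ne_zero (by omega)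

theorem InhomogeneityCondition.sinh_shift_sub_ne_zero (hξ : X.InhomogeneityCondition)
    {n m : Fin N} (hnm : n ≠ m) {h k : ℕ} (hh : h ≤ X.twoS n) (hk : k ≤ X.twoS m) :
    sinh (X.shift n h - X.shift m k) ≠ 0 := by
  rw [sinh_sub_ne_zero_iff]
  intro he
  obtain ⟨j, hj⟩ := exp_eq_exp_iff_exists_int.mp he
  have hn : X.shift n h ∈ X.stringSet n := ⟨h, hh, 0, by simp⟩
  have hm : X.shift n h ∈ X.stringSet m := ⟨k, hk, j, by linear_combination hj / 2⟩
  exact Set.disjoint_left.mp (hξ n m hnm) hn hm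

theorem sinh_shift_sub_shift_ne_zero (hη : X.Generic) (hξ : X.InhomogeneityCondition)
    {n m : Fin N} {h k : ℕ} (hh : h ≤ X.twoS n) (hk : k ≤ X.twoS m) (hne : n ≠ m ∨ h ≠ k) :
    sinh (X.shift n h - X.shift m k) ≠ 0 := by
  rcases eq_or_ne n m with rfl | hnm
  · exact hη.sinh_shift_sub_ne_zero n (hne.resolve_left (by simp))
  · exact hξ.sinh_shift_sub_ne_zero hnm hh hk

theorem injective_exp_shift (hη : X.Generic) (hξ : X.InhomogeneityCondition) (k : Fin N → ℕ)
    (hk : ∀ n, k n ≤ X.twoS n) :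
    Function.Injective fun n => exp (2 * X.shift n (k n)) := by
  intro n m h
  by_contra hnm
  exact sinh_sub_ne_zero_iff.mp
    (sinh_shift_sub_shift_ne_zero hη hξ (hk n) (hk m) (Or.inl hnm)) h

variable (X)

/-- Index set of the points `ξ_n^{(h)}`, `0 ≤ h < 2 s_n`. -/
abbrev StringIdx : Type := Σ n : Fin N, Fin (X.twoS n)

theorem card_stringIdx : Fintype.card X.StringIdx = X.numRoots := by
  simp [StringIdx, numRoots]

/-- The product of all `sinh (λ - ξ_n^{(h)})` with `0 ≤ h < 2 s_n`. -/
noncomputable def stringProd (lam : ℂ) : ℂ := ∏ p : X.StringIdx, sinh (lam - X.shift p.1 p.2)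

theorem stringProd_eq (lam : ℂ) :
    X.stringProd lam = ∏ n, ∏ h ∈ Finset.range (X.twoS n), sinh (lam - X.shift n h) := by
  rw [stringProd, Fintype.prod_sigma]
  exact Finset.prod_congr rfl fun n _ =>
    Fin.prod_univ_eq_prod_range (fun h => sinh (lam - X.shift n h)) _

theorem injective_exp_string (hη : X.Generic) (hξ : X.InhomogeneityCondition) :
    Function.Injective fun p : X.StringIdx => exp (2 * X.shift p.1 p.2) := by
  rintro ⟨n, h⟩ ⟨m, k⟩ he
  by_contra hne
  refine sinh_sub_ne_zero_iff.mp (sinh_shift_sub_shift_ne_zero hη hξ h.2.le k.2.le ?_) he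
  by_contra! hcon
  obtain ⟨rfl, hcon⟩ := hcon
  exact hne (by rw [Fin.ext hcon])

/-- `a(λ) = ∏_n sinh (λ - ξ_n + s_n η)`, written in terms of `ξ_n^{(2 s_n)}`. -/
noncomputable def a (lam : ℂ) : ℂ := ∏ n, sinh (lam - X.shift n (X.twoS n))

theorem d_eq (lam : ℂ) : X.d lam = ∏ n, sinh (lam - X.shift n 0) := by
  simp only [d, shift_zero, sub_sub]

theorem d_mul_w (hspin : ∀ n, 1 ≤ X.twoS n) (ε lam : ℂ) :
    X.d lam * X.w ε lam = 2 * ε * (I / 2) ^ X.numRoots * X.stringProd lam := by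
  have : X.stringProd lam = X.d lam *
      ∏ n, ∏ h ∈ Finset.Ico 1 (X.twoS n), sinh (lam - X.shift n h) := by
    rw [stringProd_eq, d_eq, ← Finset.prod_mul_distrib]
    refine Finset.prod_congr rfl fun n _ => ?_
    rw [Finset.range_eq_Ico, Finset.prod_eq_prod_Ico_succ_bot (hspin n)]
  rw [this, w]; ring

/-- Shifting `λ` by `η` moves the string factors from `0 ≤ h < 2s_n` to `1 ≤ h ≤ 2s_n`, which trades
`d` for `a` around the same `w`. Together with `d_mul_w` this gives `d(λ+η) w(λ+η) = a(λ) w(λ)`. -/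
theorem a_mul_w (hspin : ∀ n, 1 ≤ X.twoS n) (ε lam : ℂ) :
    X.a lam * X.w ε lam = 2 * ε * (I / 2) ^ X.numRoots * X.stringProd (lam + X.η) := by
  have : X.stringProd (lam + X.η) = X.a lam *
      ∏ n, ∏ h ∈ Finset.Ico 1 (X.twoS n), sinh (lam - X.shift n h) := by
    rw [stringProd_eq, a, ← Finset.prod_mul_distrib]
    refine Finset.prod_congr rfl fun n _ => ?_
    have : ∀ h, sinh (lam + X.η - X.shift n h) = sinh (lam - X.shift n (h + 1)) := fun h => by
      rw [shift_succ]; ring_nf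
    simp_rw [this]
    rw [Finset.range_eq_Ico, Finset.prod_Ico_add' (fun h => sinh (lam - X.shift n h)) 0 _ 1,
      zero_add, Finset.prod_Ico_succ_top (hspin n), mul_comm]
  rw [this, w]; ring

theorem d_shift_zero (n : Fin N) : X.d (X.shift n 0) = 0 := by
  rw [d_eq]; exact Finset.prod_eq_zero (Finset.mem_univ n) (by simp)

theorem a_shift_last (n : Fin N) : X.a (X.shift n (X.twoS n)) = 0 :=
  Finset.prod_eq_zero (Finset.mem_univ n) (by simp)

theorem d_shift_ne_zero (hη : X.Generic) (hξ : X.InhomogeneityCondition) {n : Fin N} {h : ℕ}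
    (h0 : h ≠ 0) (hh : h ≤ X.twoS n) : X.d (X.shift n h) ≠ 0 := by
  rw [d_eq]
  exact Finset.prod_ne_zero_iff.mpr fun m _ =>
    sinh_shift_sub_shift_ne_zero hη hξ hh (Nat.zero_le _) (Or.inr h0)

theorem a_shift_ne_zero (hη : X.Generic) (hξ : X.InhomogeneityCondition) {n : Fin N} {h : ℕ}
    (hh : h < X.twoS n) : X.a (X.shift n h) ≠ 0 := by
  refine Finset.prod_ne_zero_iff.mpr fun m _ =>
    sinh_shift_sub_shift_ne_zero hη hξ hh.le le_rfl ?_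
  by_contra! hcon
  obtain ⟨rfl, hcon⟩ := hcon
  exact hh.ne hcon

theorem d_add_pi_mul_I (z : ℂ) : X.d (z + Real.pi * I) = (-1) ^ N * X.d z := by
  simp only [d_eq, prod_sinh_add_pi_mul_I, Fintype.card_fin]

theorem a_add_pi_mul_I (z : ℂ) : X.a (z + Real.pi * I) = (-1) ^ N * X.a z := by
  simp only [a, prod_sinh_add_pi_mul_I, Fintype.card_fin]

theorem exists_d_mul_w_ne_zero (hspin : ∀ n, 1 ≤ X.twoS n) {ε : ℂ} (hε : ε ≠ 0) :
    ∃ z, X.d z * X.w ε z ≠ 0 := by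
  obtain ⟨z, hz⟩ := exists_forall_sinh_sub_ne_zero fun p : X.StringIdx => X.shift p.1 p.2
  refine ⟨z, ?_⟩
  rw [d_mul_w X hspin]
  have : X.stringProd z ≠ 0 := Finset.prod_ne_zero_iff.mpr fun p _ => hz p
  simp [hε, this]

theorem differentiable_d : Differentiable ℂ X.d := by
  rw [funext X.d_eq]
  exact (isExpPoly_prod_sinh fun n => X.shift n 0).order.differentiable

theorem differentiable_w (ε : ℂ) : Differentiable ℂ (X.w ε) := by
  unfold w
  refine Differentiable.const_mul ?_ _
  exact (ExpPolyOrder.prod _ fun n _ => ExpPolyOrder.prod _ fun h _ =>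
    (IsExpPoly.sinh_sub (X.shift n h)).order).differentiable

theorem w_order (ε : ℂ) :
    ExpPolyOrder (∑ n, ∑ _h ∈ Finset.Ico 1 (X.twoS n), 2) (X.w ε) := by
  unfold w
  exact (ExpPolyOrder.prod _ fun n _ => ExpPolyOrder.prod _ fun h _ =>
    (IsExpPoly.sinh_sub (X.shift n h)).order).const_mul _

end Strings

end XXZChain

/-! ### The Wronskian and the Baxter equation -/

namespace XXZChain

section Baxter

open Complex

variable {N : ℕ} (X : XXZChain N)

/-- The Wronskian combination `Q(λ) Q(λ + iπ - η) + Q(λ + iπ) Q(λ - η)`. -/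
noncomputable def wronskianOf (Q : ℂ → ℂ) (z : ℂ) : ℂ :=
  Q z * Q (z + Real.pi * I - X.η) + Q (z + Real.pi * I) * Q (z - X.η)

/-- The numerator `Q(λ + η) Q(λ + iπ - η) - Q(λ + η + iπ) Q(λ - η)`. -/
noncomputable def numeratorOf (Q : ℂ → ℂ) (z : ℂ) : ℂ :=
  Q (z + X.η) * Q (z + Real.pi * I - X.η) - Q (z + X.η + Real.pi * I) * Q (z - X.η)

/-- The homogeneous Baxter equation `t(λ) Q(λ) = d(λ) Q(λ + η) - a(λ) Q(λ - η)`. -/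
def BaxterEq (t Q : ℂ → ℂ) : Prop :=
  ∀ z, t z * Q z = X.d z * Q (z + X.η) - X.a z * Q (z - X.η)

/-- The parity `t(λ + iπ) = (-1)^{N-1} t(λ)`. -/
def OddParity (N : ℕ) (t : ℂ → ℂ) : Prop := ∀ z, t (z + Real.pi * I) = -(-1) ^ N * t z

variable {X}

/-- Only the prefactor `exp (-m z / 2)` can fail to be `2πi`-periodic. -/
theorem _root_.ExpPolyOrder.add_two_pi {m : ℕ} {f : ℂ → ℂ} (hf : ExpPolyOrder m f) (z : ℂ) :
    f (z + Real.pi * I + Real.pi * I) = (-1) ^ m * f z := by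
  obtain ⟨_, _, P, -, -, -, hPf⟩ := hf
  rw [hPf, hPf, exp_add_pi_mul_I, exp_add_pi_mul_I, neg_neg]
  have : exp (-((m : ℂ) * (z + Real.pi * I + Real.pi * I) / 2)) =
      (-1) ^ m * exp (-((m : ℂ) * z / 2)) := by
    have h : ((-1 : ℂ)) ^ m = exp (-(m * (Real.pi * I))) := by
      rw [exp_neg, exp_nat_mul, exp_pi_mul_I, ← inv_pow]; norm_num
    rw [h, ← exp_add]; ring_nf
  rw [this]; ring

section

variable {m : ℕ} {lo hi : ℂ} {Q : ℂ → ℂ}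

/-- In both products the arguments are shifted by `iπ - η` in total, so the extreme coefficients of
the two terms agree and add up to twice one of them. -/
theorem wronskianOf_isExpPoly (hQ : IsExpPoly m lo hi Q) :
    ∃ E : ℂ, E ≠ 0 ∧ IsExpPoly (2 * m) (2 * lo ^ 2 * E⁻¹) (2 * hi ^ 2 * E) (X.wronskianOf Q) := by
  refine ⟨exp (m * (Real.pi * I - X.η) / 2), exp_ne_zero _, ?_⟩
  have h := (hQ.mul (hQ.comp_add (Real.pi * I - X.η))).add
    ((hQ.comp_add (Real.pi * I)).mul (hQ.comp_add (-X.η)))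
  rw [← two_mul] at h
  have e1 : exp (-(m * (Real.pi * I) / 2)) * exp (-(m * -X.η / 2)) =
      exp (-(m * (Real.pi * I - X.η) / 2)) := by rw [← exp_add]; ring_nf
  have e2 : exp (m * (Real.pi * I) / 2) * exp (m * -X.η / 2) =
      exp (m * (Real.pi * I - X.η) / 2) := by rw [← exp_add]; ring_nf
  have e3 := exp_neg (m * (Real.pi * I - X.η) / 2)
  convert h using 1
  · linear_combination -2 * lo ^ 2 * e3 - lo ^ 2 * e1
  · linear_combination -hi ^ 2 * e2
  · funext z; simp only [wronskianOf]; ring_nf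

theorem wronskianOf_add_pi (hQ : ExpPolyOrder m Q) (z : ℂ) :
    X.wronskianOf Q (z + Real.pi * I) = (-1) ^ m * X.wronskianOf Q z := by
  have h1 := hQ.add_two_pi z
  have h2 := hQ.add_two_pi (z - X.η)
  simp only [wronskianOf]
  rw [h1, show z + Real.pi * I + Real.pi * I - X.η = z - X.η + Real.pi * I + Real.pi * I by ring, h2]
  ring

theorem numeratorOf_order (hQ : ExpPolyOrder m Q) : ExpPolyOrder (2 * m) (X.numeratorOf Q) := by
  have h := ((hQ.comp_add X.η).mul (hQ.comp_add (Real.pi * I - X.η))).sub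
    ((hQ.comp_add (X.η + Real.pi * I)).mul (hQ.comp_add (-X.η)))
  rw [← two_mul] at h
  convert h using 1
  funext z; simp only [numeratorOf]; ring_nf

theorem numeratorOf_add_pi (hQ : ExpPolyOrder m Q) (z : ℂ) :
    X.numeratorOf Q (z + Real.pi * I) = -(-1) ^ m * X.numeratorOf Q z := by
  have h1 := hQ.add_two_pi (z + X.η)
  have h2 := hQ.add_two_pi (z - X.η)
  simp only [numeratorOf]
  rw [show z + Real.pi * I + Real.pi * I - X.η = z - X.η + Real.pi * I + Real.pi * I by ring, h2,
    show z + Real.pi * I + X.η + Real.pi * I = z + X.η + Real.pi * I + Real.pi * I by ring, h1]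
  ring_nf

theorem stringProd_isExpPoly : ∃ E : ℂ, E ≠ 0 ∧
    IsExpPoly (2 * X.numRoots) ((-1 / 2) ^ X.numRoots * E⁻¹) ((1 / 2) ^ X.numRoots * E)
      X.stringProd := by
  have h := isExpPoly_prod_sinh fun p : X.StringIdx => X.shift p.1 p.2
  rw [card_stringIdx] at h
  refine ⟨∏ p : X.StringIdx, exp (-X.shift p.1 p.2),
    Finset.prod_ne_zero_iff.mpr fun _ _ => exp_ne_zero _, ?_⟩
  have e1 : ∀ z : ℂ, -exp z / 2 = (-1 / 2) * (exp (-z))⁻¹ := fun z => by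
    rw [exp_neg, inv_inv]; ring
  have e2 : ∀ z : ℂ, exp (-z) / 2 = (1 / 2) * exp (-z) := fun z => by ring
  simp only [e1, e2, Finset.prod_mul_distrib, Finset.prod_const, Finset.card_univ,
    card_stringIdx, Finset.prod_inv_distrib] at h
  exact h

/-- The Wronskian vanishes on the strings only if it is a multiple of the product over strings. -/
theorem wronskianOf_eq_of_vanish (hη : X.Generic) (hξ : X.InhomogeneityCondition)
    (hQ : ExpPolyOrder X.numRoots Q)
    (hv : ∀ (n : Fin N) (h : ℕ), h < X.twoS n → X.wronskianOf Q (X.shift n h) = 0) :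
    ∃ c, ∀ z, X.wronskianOf Q z = c * X.stringProd z := by
  obtain ⟨lo, hi, hQ'⟩ := hQ
  obtain ⟨E, -, hW⟩ := wronskianOf_isExpPoly (X := X) hQ'
  refine ExpPolyOrder.eq_const_mul_prod_sinh (ι := X.StringIdx) (x := fun p => X.shift p.1 p.2)
    ?_ ?_ (X.injective_exp_string hη hξ) fun p => hv p.1 p.2 p.2.2
  · rw [card_stringIdx]; exact hW.order
  · rw [card_stringIdx]; exact wronskianOf_add_pi hQ'.order

/-- The normalization of the Wronskian, from the extreme coefficients. -/
theorem wronskianOf_const (hQ : IsExpPoly X.numRoots lo hi Q)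
    (hlohi : lo * hi = (-1 / 4) ^ X.numRoots) {c : ℂ}
    (hc : ∀ z, X.wronskianOf Q z = c * X.stringProd z) :
    ∃ ε : ℂ, (ε = 1 ∨ ε = -1) ∧ c = 2 * ε * (I / 2) ^ X.numRoots := by
  obtain ⟨E, hE, hW⟩ := wronskianOf_isExpPoly (X := X) hQ
  obtain ⟨F, hF, hS⟩ := stringProd_isExpPoly (X := X)
  obtain ⟨h1, h2⟩ := (funext hc ▸ hW : IsExpPoly _ _ _ fun z => c * X.stringProd z).unique
    (hS.const_mul c)
  -- Multiplying the lowest coefficient by the highest eliminates the unknown exponentials `E` and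
  -- `F`, leaving an equation for `c ^ 2`.
  have h3 : 4 * (lo * hi) ^ 2 = c ^ 2 * (-1 / 4) ^ X.numRoots := by
    have h4 : (-1 / 4 : ℂ) ^ X.numRoots = (-1 / 2) ^ X.numRoots * (1 / 2) ^ X.numRoots := by
      rw [← mul_pow]; norm_num
    calc 4 * (lo * hi) ^ 2 = (2 * lo ^ 2 * E⁻¹) * (2 * hi ^ 2 * E) := by field_simp; ring
      _ = _ := by rw [h1, h2, h4]; field_simp
  have h5 : (-1 / 4 : ℂ) ^ X.numRoots ≠ 0 := by simp
  have h6 : (2 * (I / 2) ^ X.numRoots) ^ 2 = 4 * (-1 / 4 : ℂ) ^ X.numRoots := by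
    rw [mul_pow, ← pow_mul, mul_comm X.numRoots, pow_mul, div_pow, I_sq]; norm_num
  have h7 : c ^ 2 = (2 * (I / 2) ^ X.numRoots) ^ 2 := by
    rw [hlohi] at h3
    rw [h6]
    refine mul_right_cancel₀ h5 ?_
    linear_combination -h3
  rcases sq_eq_sq_iff_eq_or_eq_neg.mp h7 with h | h
  · exact ⟨1, Or.inl rfl, by rw [h]; ring⟩
  · exact ⟨-1, Or.inr rfl, by rw [h]; ring⟩

end

variable (X)

theorem Q_isExpPoly (r : Fin X.numRoots → ℂ) :
    ∃ lo hi, IsExpPoly X.numRoots lo hi (X.Q r) ∧ lo * hi = (-1 / 4) ^ X.numRoots := by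
  have h := IsExpPoly.prod Finset.univ fun i _ => IsExpPoly.sinh_half (r i)
  rw [Finset.sum_const, Finset.card_univ, smul_eq_mul, mul_one, Fintype.card_fin] at h
  refine ⟨_, _, h, ?_⟩
  have : ∀ z : ℂ, -exp (z / 2) / 2 * (exp (-(z / 2)) / 2) = -1 / 4 := fun z => by
    rw [exp_neg]; field_simp; norm_num
  rw [← Finset.prod_mul_distrib, Finset.prod_congr rfl fun i _ => this (r i)]
  simp [div_pow]

theorem Q_order (r : Fin X.numRoots → ℂ) : ExpPolyOrder X.numRoots (X.Q r) := by
  obtain ⟨_, _, h, -⟩ := X.Q_isExpPoly r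
  exact h.order

theorem wronskian_iff (hspin : ∀ n, 1 ≤ X.twoS n) (ε : ℂ) (r : Fin X.numRoots → ℂ) :
    X.Wronskian ε r ↔
      ∀ z, X.wronskianOf (X.Q r) z = 2 * ε * (I / 2) ^ X.numRoots * X.stringProd z := by
  simp only [Wronskian, d_mul_w X hspin]; rfl

variable {X}

theorem cross_mul_of_proportional {ι : Type*} {u v : ι → ℂ} (h : ∃ c : ℂ, u = c • v ∨ v = c • u)
    (i j : ι) : u i * v j = u j * v i := by
  obtain ⟨c, rfl | rfl⟩ := h <;> simp only [Pi.smul_apply, smul_eq_mul] <;> ring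

theorem ProportionalVectors.cross_mul {r : Fin X.numRoots → ℂ} (hr : X.ProportionalVectors r)
    (n : Fin N) {h k : ℕ} (hh : h ≤ X.twoS n) (hk : k ≤ X.twoS n) :
    X.Q r (X.shift n h) * ((-1) ^ k * X.Q r (X.shift n k + Real.pi * I)) =
      X.Q r (X.shift n k) * ((-1) ^ h * X.Q r (X.shift n h + Real.pi * I)) :=
  cross_mul_of_proportional (hr n).1 ⟨h, Nat.lt_succ_of_le hh⟩ ⟨k, Nat.lt_succ_of_le hk⟩

theorem ProportionalVectors.exists_wronskian (hspin : ∀ n, 1 ≤ X.twoS n) (hη : X.Generic)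
    (hξ : X.InhomogeneityCondition) {r : Fin X.numRoots → ℂ} (hr : X.ProportionalVectors r) :
    ∃ ε : ℂ, (ε = 1 ∨ ε = -1) ∧ X.Wronskian ε r := by
  obtain ⟨lo, hi, hQ, hlohi⟩ := X.Q_isExpPoly r
  obtain ⟨c, hc⟩ := wronskianOf_eq_of_vanish hη hξ hQ.order fun n h hh => by
    -- The minor of the adjacent entries `h` and `h + 1` is the Wronskian at `ξ_n^{(h)}`, up to
    -- sign.
    have := hr.cross_mul n hh.le (k := h + 1) hh
    rw [shift_succ, pow_succ] at this
    simp only [wronskianOf, add_sub_right_comm]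
    have h1 : ((-1 : ℂ)) ^ h ≠ 0 := by simp
    refine mul_left_cancel₀ h1 ?_
    linear_combination -this
  obtain ⟨ε, hε, rfl⟩ := wronskianOf_const hQ hlohi hc
  exact ⟨ε, hε, (X.wronskian_iff hspin ε r).mpr hc⟩

theorem w_shift_zero_ne_zero (hη : X.Generic) (hξ : X.InhomogeneityCondition) {ε : ℂ} (hε : ε ≠ 0)
    (n : Fin N) : X.w ε (X.shift n 0) ≠ 0 := by
  have : ∏ m, ∏ h ∈ Finset.Ico 1 (X.twoS m), sinh (X.shift n 0 - X.shift m h) ≠ 0 := by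
    refine Finset.prod_ne_zero_iff.mpr fun m _ => Finset.prod_ne_zero_iff.mpr fun h hh => ?_
    rw [Finset.mem_Ico] at hh
    exact sinh_shift_sub_shift_ne_zero hη hξ (Nat.zero_le _) hh.2.le (Or.inr (by omega))
  simp [w, hε, this]

theorem w_shift_eq_zero (ε : ℂ) (n : Fin N) {h : ℕ} (h1 : 1 ≤ h) (hh : h < X.twoS n) :
    X.w ε (X.shift n h) = 0 := by
  have : ∏ m, ∏ k ∈ Finset.Ico 1 (X.twoS m), sinh (X.shift n h - X.shift m k) = 0 :=
    Finset.prod_eq_zero (Finset.mem_univ n)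
      (Finset.prod_eq_zero (Finset.mem_Ico.mpr ⟨h1, hh⟩) (by simp))
  simp [w, this]

theorem w_add_pi_mul_I (hspin : ∀ n, 1 ≤ X.twoS n) (ε z : ℂ) :
    X.w ε (z + Real.pi * I) = (-1) ^ (X.numRoots + N) * X.w ε z := by
  have h1 : ∀ n, ∏ h ∈ Finset.Ico 1 (X.twoS n), sinh (z + Real.pi * I - X.shift n h) =
      (-1) ^ (X.twoS n + 1) * ∏ h ∈ Finset.Ico 1 (X.twoS n), sinh (z - X.shift n h) := fun n => by
    have h2 : ∀ h, sinh (z + Real.pi * I - X.shift n h) = -sinh (z - X.shift n h) := fun h => by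
      rw [← sinh_add_pi_mul_I]; ring_nf
    simp_rw [h2, Finset.prod_neg, Nat.card_Ico]
    congr 1
    obtain ⟨k, hk⟩ := Nat.exists_eq_add_of_le (hspin n)
    rw [hk, Nat.add_sub_cancel_left, show 1 + k + 1 = k + 2 by ring, pow_add]; simp
  simp only [w, h1, Finset.prod_mul_distrib, Finset.prod_pow_eq_pow_sum, Finset.sum_add_distrib,
    Finset.sum_const, Finset.card_univ, Fintype.card_fin, smul_eq_mul, mul_one, numRoots]
  ring

/-- The interpolation polynomial through prescribed values at the points `ξ_n^{(0)}`. -/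
theorem exists_interpolation (hη : X.Generic) (hξ : X.InhomogeneityCondition) (y : Fin N → ℂ) :
    ∃ t, ExpPolyOrder (2 * N) t ∧ OddParity N t ∧ ∀ n, t (X.shift n 0) = y n := by
  have hne : ∀ n, ∏ m ∈ Finset.univ.erase n, sinh (X.shift n 0 - X.shift m 0) ≠ 0 := fun n =>
    Finset.prod_ne_zero_iff.mpr fun m hm =>
      sinh_shift_sub_shift_ne_zero hη hξ (Nat.zero_le _) (Nat.zero_le _)
        (Or.inl (Finset.ne_of_mem_erase hm).symm)
  set c : Fin N → ℂ := fun n =>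
    y n / ∏ m ∈ Finset.univ.erase n, sinh (X.shift n 0 - X.shift m 0)
  refine ⟨fun z => ∑ n, c n * ∏ m ∈ Finset.univ.erase n, sinh (z - X.shift m 0), ?_, ?_, ?_⟩
  · refine ExpPolyOrder.sum _ fun n _ => ?_
    -- The product over the other sites has order `2(N-1)`; counting the constant as order 2 brings
    -- the total to `2N`.
    have h := (IsExpPoly.const_two (c n)).order.mul
      (ExpPolyOrder.prod (Finset.univ.erase n) fun m _ => (IsExpPoly.sinh_sub (X.shift m 0)).order)
    convert h using 1
    have : 1 ≤ N := n.pos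
    simp [Finset.card_erase_of_mem]; omega
  · intro z
    rw [Finset.mul_sum]
    refine Finset.sum_congr rfl fun n _ => ?_
    have h2 : ∀ m, sinh (z + Real.pi * I - X.shift m 0) = -sinh (z - X.shift m 0) := fun h => by
      rw [← sinh_add_pi_mul_I]; ring_nf
    simp_rw [h2, Finset.prod_neg, Finset.card_erase_of_mem (Finset.mem_univ n), Finset.card_univ,
      Fintype.card_fin]
    obtain ⟨k, hk⟩ := Nat.exists_eq_add_of_le n.pos
    have : ((-1 : ℂ)) ^ N = -(-1) ^ (N - 1) := by
      have : N = N - 1 + 1 := by omega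
      nth_rewrite 1 [this]; rw [pow_succ]; ring
    rw [this]; ring
  · intro n
    beta_reduce
    rw [Finset.sum_eq_single n]
    · exact div_mul_cancel₀ _ (hne n)
    · intro m _ hm
      rw [Finset.prod_eq_zero (Finset.mem_erase.mpr ⟨hm.symm, Finset.mem_univ n⟩) (by simp),
        mul_zero]
    · simp

theorem ProportionalVectors.exists_quotient (hspin : ∀ n, 1 ≤ X.twoS n) (hη : X.Generic)
    (hξ : X.InhomogeneityCondition) {r : Fin X.numRoots → ℂ} (hr : X.ProportionalVectors r)
    {ε : ℂ} (hε : ε ≠ 0) :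
    ∃ t, ExpPolyOrder (2 * N) t ∧ OddParity N t ∧
      ∀ z, t z * X.w ε z = X.numeratorOf (X.Q r) z := by
  obtain ⟨t, ht, htp, hty⟩ := exists_interpolation hη hξ fun n =>
    X.numeratorOf (X.Q r) (X.shift n 0) / X.w ε (X.shift n 0)
  refine ⟨t, ht, htp, fun z => ?_⟩
  -- Site `n` contributes 2 to the order of `t` and `2(2s_n - 1)` to that of `w`, hence `2 · 2s_n`
  -- in all.
  have hord : ExpPolyOrder (2 * X.numRoots) fun z => t z * X.w ε z := by
    convert ht.mul (X.w_order ε) using 1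
    have : ∀ n, 2 * X.twoS n = 2 + ∑ _h ∈ Finset.Ico 1 (X.twoS n), 2 := fun n => by
      have := hspin n
      simp; omega
    rw [numRoots, Finset.mul_sum, Finset.sum_congr rfl fun n _ => this n, Finset.sum_add_distrib]
    simp [mul_comm]
  have hQ := X.Q_order r
  refine sub_eq_zero.mp (ExpPolyOrder.eq_zero_of_odd (ι := X.StringIdx)
    (f := fun z => t z * X.w ε z - X.numeratorOf (X.Q r) z)
    (x := fun p => X.shift p.1 p.2) ?_ ?_ (X.injective_exp_string hη hξ) ?_ z)
  · rw [card_stringIdx]; exact hord.sub (numeratorOf_order hQ)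
  · intro z
    rw [card_stringIdx, htp, w_add_pi_mul_I hspin, numeratorOf_add_pi hQ, pow_add]
    have : ((-1 : ℂ)) ^ N * (-1) ^ N = 1 := by rw [← mul_pow]; simp
    linear_combination (-t z * (-1) ^ X.numRoots * X.w ε z) * this
  · rintro ⟨n, h, hh⟩
    simp only
    rcases Nat.eq_zero_or_pos h with rfl | hpos
    · rw [hty, div_mul_cancel₀ _ (w_shift_zero_ne_zero hη hξ hε n), sub_self]
    · rw [w_shift_eq_zero ε n hpos hh, mul_zero, zero_sub, neg_eq_zero]
      obtain ⟨k, rfl⟩ := Nat.exists_eq_succ_of_ne_zero hpos.ne'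
      -- At a zero `ξ_n^{(k+1)}` of `w` the numerator is the minor of the two neighbouring entries
      -- `k` and `k + 2`.
      have := hr.cross_mul n (h := k) (k := k + 1 + 1) (by omega) hh
      rw [shift_succ X n (k + 1), pow_succ, pow_succ] at this
      have h1 : ((-1 : ℂ)) ^ k ≠ 0 := by simp
      refine mul_left_cancel₀ h1 ?_
      simp only [Nat.succ_eq_add_one, numeratorOf, shift_succ_add, add_sub_right_comm]
      linear_combination this

/-! ### The Baxter equation and its restriction to strings. -/

theorem BaxterEq.of_wronskianOf (hspin : ∀ n, 1 ≤ X.twoS n) {Q t : ℂ → ℂ} {ε : ℂ} (hε : ε ≠ 0)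
    (hQ : Continuous Q) (ht : Continuous t)
    (hW : ∀ z, X.wronskianOf Q z = X.d z * X.w ε z)
    (hnum : ∀ z, t z * X.w ε z = X.numeratorOf Q z) : X.BaxterEq t Q := by
  have ha : Continuous X.a :=
    (isExpPoly_prod_sinh fun n => X.shift n (X.twoS n)).order.differentiable.continuous
  obtain ⟨z₀, hz₀⟩ := X.exists_d_mul_w_ne_zero hspin hε
  refine eq_of_mul_eq_mul_of_differentiable (X.differentiable_w ε) (by fun_prop)
    (by have := X.differentiable_d.continuous; fun_prop) ⟨z₀, right_ne_zero_of_mul hz₀⟩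
    fun z hz => mul_left_cancel₀ hz ?_
  -- With `W` the Wronskian, numerator times `Q(z)` equals `Q(z+η) W(z) - Q(z-η) W(z+η)`. Here `W(z)
  -- = d(z) w(z)` and `W(z+η) = a(z) w(z)`, so `w` cancels.
  have h1 := hW z
  have h2 := hW (z + X.η)
  have h3 := hnum z
  have h4 := X.d_mul_w hspin ε (z + X.η)
  have h5 := X.a_mul_w hspin ε z
  simp only [wronskianOf, numeratorOf] at h1 h2 h3
  rw [show z + X.η + Real.pi * I - X.η = z + Real.pi * I by ring, add_sub_cancel_right] at h2
  linear_combination Q z * h3 + Q (z + X.η) * h1 - Q (z - X.η) * (h2 + h4 - h5)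

/-- The parity of `t` is opposite to that of `a` and `d`, whence the overall sign. The factor
`(-1)^h` in the second vector absorbs it. -/
theorem BaxterEq.add_pi {t Q : ℂ → ℂ} (h : X.BaxterEq t Q) (ht : OddParity N t) (z : ℂ) :
    t z * Q (z + Real.pi * I) =
      -(X.d z * Q (z + X.η + Real.pi * I) - X.a z * Q (z - X.η + Real.pi * I)) := by
  have := h (z + Real.pi * I)
  rw [ht, d_add_pi_mul_I, a_add_pi_mul_I, add_right_comm, add_sub_right_comm] at this
  have h1 : ((-1 : ℂ)) ^ N ≠ 0 := by simp
  refine mul_left_cancel₀ h1 ?_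
  linear_combination -this

/-- A solution of the discrete Baxter equation along a string. -/
def IsStringSolution (X : XXZChain N) (t : ℂ → ℂ) (n : Fin N) (q : ℕ → ℂ) : Prop :=
  -- Neither end needs a boundary condition: at `h = 0` the truncated `h - 1` is multiplied by `d =
  -- 0`, and at `h = 2s_n` the value `q (h + 1)` is multiplied by `a = 0`.
  ∀ h ≤ X.twoS n, t (X.shift n h) * q h =
    X.d (X.shift n h) * q (h - 1) - X.a (X.shift n h) * q (h + 1)

theorem BaxterEq.isStringSolution {t Q : ℂ → ℂ} (h : X.BaxterEq t Q) (n : Fin N) :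
    X.IsStringSolution t n fun k => Q (X.shift n k) := by
  intro k _
  simp only [h (X.shift n k), shift_succ]
  rcases k with _ | k
  · simp [d_shift_zero]
  · rw [shift_succ_add]; rfl

theorem BaxterEq.isStringSolution_add_pi {t Q : ℂ → ℂ} (h : X.BaxterEq t Q) (ht : OddParity N t)
    (n : Fin N) :
    X.IsStringSolution t n fun k => (-1) ^ k * Q (X.shift n k + Real.pi * I) := by
  intro k _
  have := h.add_pi ht (X.shift n k)
  simp only [shift_succ, pow_succ]
  rcases k with _ | k
  · rw [d_shift_zero] at *
    linear_combination this
  · rw [shift_succ_add] at this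
    rw [Nat.add_sub_cancel, pow_succ]
    linear_combination (-1) ^ k * (-1) * this

/-- Since `a` is nonzero at `ξ_n^{(h)}` for `h < 2s_n`, the recursion can be solved forward for `q
(h + 1)`. -/
theorem IsStringSolution.eq_zero (hη : X.Generic) (hξ : X.InhomogeneityCondition) {t : ℂ → ℂ}
    {n : Fin N} {q : ℕ → ℂ} (hq : X.IsStringSolution t n q) (h0 : q 0 = 0) :
    ∀ h ≤ X.twoS n, q h = 0 := by
  intro h
  induction h using Nat.strong_induction_on with
  | _ h ih =>
    intro hh
    rcases h with _ | h
    · exact h0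
    · have h1 := hq h (by omega)
      rw [ih h (by omega) (by omega), ih (h - 1) (by omega) (by omega)] at h1
      have h2 : X.a (X.shift n h) * q (h + 1) = 0 := by linear_combination h1
      exact (mul_eq_zero.mp h2).resolve_left (X.a_shift_ne_zero hη hξ (by omega))

theorem IsStringSolution.combination {t : ℂ → ℂ} {n : Fin N} {q q' : ℕ → ℂ}
    (hq : X.IsStringSolution t n q) (hq' : X.IsStringSolution t n q') (c c' : ℂ) :
    X.IsStringSolution t n fun h => c * q h - c' * q' h := by
  intro h hh
  linear_combination c * hq h hh - c' * hq' h hh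

theorem IsStringSolution.proportional (hη : X.Generic) (hξ : X.InhomogeneityCondition) {t : ℂ → ℂ}
    {n : Fin N} {q q' : ℕ → ℂ} (hq : X.IsStringSolution t n q) (hq' : X.IsStringSolution t n q') :
    ∃ c : ℂ, (∀ h ≤ X.twoS n, q h = c * q' h) ∨ ∀ h ≤ X.twoS n, q' h = c * q h := by
  by_cases h0 : q 0 = 0
  · exact ⟨0, Or.inl fun h hh => by rw [hq.eq_zero hη hξ h0 h hh, zero_mul]⟩
  · refine ⟨q' 0 / q 0, Or.inr fun h hh => ?_⟩
    -- The combination is chosen to vanish at `h = 0`, hence on the whole string.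
    have := (hq.combination hq' (q' 0) (q 0)).eq_zero hη hξ (by ring) h hh
    field_simp
    linear_combination -this

theorem BaxterEq.wronskianOf_eq (hη : X.Generic) (hξ : X.InhomogeneityCondition) {t Q : ℂ → ℂ}
    (hQ : ExpPolyOrder X.numRoots Q) (ht : OddParity N t) (h : X.BaxterEq t Q) :
    ∃ c, ∀ z, X.wronskianOf Q z = c * X.stringProd z := by
  refine wronskianOf_eq_of_vanish hη hξ hQ fun n k hk => ?_
  -- Eliminating `t` between the equations for `Q(z)` and `Q(z+iπ)` gives a first-order recursion.
  -- At `ξ_n^{(0)}` it starts the vanishing because `d` is zero there.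
  have key : ∀ z, X.d z * X.wronskianOf Q (z + X.η) = X.a z * X.wronskianOf Q z := fun z => by
    have h1 := h z
    have h2 := h.add_pi ht z
    simp only [wronskianOf, 
      show z + X.η - X.η = z by ring,
      show z + X.η + Real.pi * I - X.η = z + Real.pi * I by ring]
    rw [show z + Real.pi * I - X.η = z - X.η + Real.pi * I by ring]
    linear_combination Q z * h2 - Q (z + Real.pi * I) * h1
  induction k with
  | zero =>
    have := key (X.shift n 0)
    rw [d_shift_zero, zero_mul, eq_comm] at this
    exact (mul_eq_zero.mp this).resolve_left (X.a_shift_ne_zero hη hξ hk)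
  | succ k ih =>
    have := key (X.shift n (k + 1))
    rw [shift_succ_add, ih (by omega), mul_zero, eq_comm] at this
    exact (mul_eq_zero.mp this).resolve_left (X.a_shift_ne_zero hη hξ hk)

/-! ### Recovering roots, sign and proportionality from a Baxter solution. -/

open Polynomial in
theorem _root_.IsExpPoly.exists_roots {m : ℕ} {lo hi : ℂ} {f : ℂ → ℂ} (hf : IsExpPoly m lo hi f)
    (hlo : lo ≠ 0) (hhi : hi ≠ 0) :
    ∃ (c : ℂ) (r : Fin m → ℂ), c ≠ 0 ∧ ∀ z, f z = c * ∏ i, sinh ((z - r i) / 2) := by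
  obtain ⟨P, hP, rfl, rfl, hPf⟩ := hf
  -- The nonzero top coefficient gives exactly `m` roots; the nonzero bottom one keeps them away
  -- from `0`, so that logarithms may serve as the `r i`.
  have hdeg : P.natDegree = m := le_antisymm hP (le_natDegree_of_ne_zero hhi)
  have hsplit := IsAlgClosed.splits P
  have hcard : P.roots.card = m := by rw [← hdeg]; exact hsplit.natDegree_eq_card_roots.symm
  obtain ⟨ρ, hρ⟩ : ∃ ρ : Fin m → ℂ, P.roots = Finset.univ.val.map ρ := by
    obtain ⟨l, hl⟩ := Quot.exists_rep P.roots
    have hlen : l.length = m := by rw [← hcard, ← hl]; rfl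
    subst hlen
    refine ⟨l.get, ?_⟩
    rw [← hl, Fin.univ_val_map, List.ofFn_get]; rfl
  have hP0 : P ≠ 0 := fun h => hlo (by simp [h])
  have hroot : ∀ i, ρ i ≠ 0 := fun i h => by
    have : ρ i ∈ P.roots := by rw [hρ]; exact Multiset.mem_map_of_mem _ (Finset.mem_univ i)
    rw [h, mem_roots hP0, IsRoot, ← coeff_zero_eq_eval_zero] at this
    exact hlo this
  have heval : ∀ x, P.eval x = P.leadingCoeff * ∏ i, (x - ρ i) := fun x => by
    have : ((Finset.univ.val.map ρ).map fun a => X - C a).prod = ∏ i, (X - C (ρ i)) := by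
      rw [Multiset.map_map]; rfl
    conv_lhs => rw [hsplit.eq_prod_roots, hρ, this]
    simp [eval_prod]
  refine ⟨P.leadingCoeff * ∏ i, (2 * exp (log (ρ i) / 2)), fun i => log (ρ i), ?_, fun z => ?_⟩
  · refine mul_ne_zero (leadingCoeff_ne_zero.mpr hP0) (Finset.prod_ne_zero_iff.mpr fun i _ => ?_)
    simp
  · have h1 : ∀ i, exp z - ρ i =
        exp (z / 2) * (2 * exp (log (ρ i) / 2) * sinh ((z - log (ρ i)) / 2)) := fun i => by
      have e1 : exp z = exp (z / 2) * exp (log (ρ i) / 2) * exp ((z - log (ρ i)) / 2) := by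
        rw [← exp_add, ← exp_add]; ring_nf
      have e2 : ρ i = exp (z / 2) * exp (log (ρ i) / 2) * exp (-((z - log (ρ i)) / 2)) := by
        rw [← exp_add, ← exp_add]; ring_nf; exact (exp_log (hroot i)).symm
      rw [Complex.sinh]
      linear_combination e1 - e2
    have h2 : exp (-(m * z / 2)) * exp (z / 2) ^ m = 1 := by
      rw [← exp_nat_mul, ← exp_add]; ring_nf; exact exp_zero
    rw [hPf, heval, Finset.prod_congr rfl fun i _ => h1 i, Finset.prod_mul_distrib,
      Finset.prod_mul_distrib]
    simp only [Finset.prod_const, Finset.card_univ, Fintype.card_fin]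
    linear_combination (P.leadingCoeff * ((∏ i, (2 * exp (log (ρ i) / 2))) *
      ∏ i, sinh ((z - log (ρ i)) / 2))) * h2

theorem BaxterEq.const_mul_iff {t Q : ℂ → ℂ} {c : ℂ} (hc : c ≠ 0) :
    X.BaxterEq t (fun z => c * Q z) ↔ X.BaxterEq t Q := by
  refine forall_congr' fun z => ?_
  constructor <;> intro h
  · refine mul_left_cancel₀ hc ?_
    linear_combination h
  · linear_combination c * h

theorem hasDerivAt_mul_zero {u v : ℂ → ℂ} {z : ℂ} (hu : DifferentiableAt ℂ u z)
    (hv : DifferentiableAt ℂ v z) (hu0 : u z = 0) (hv0 : v z = 0) :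
    HasDerivAt (fun x => u x * v x) 0 z := by
  have := hu.hasDerivAt.mul hv.hasDerivAt
  rw [hu0, hv0, mul_zero, zero_mul, add_zero] at this
  exact this

theorem exists_hasDerivAt_stringProd (hη : X.Generic) (hξ : X.InhomogeneityCondition)
    (p : X.StringIdx) :
    ∃ y, y ≠ 0 ∧ HasDerivAt X.stringProd y (X.shift p.1 p.2) := by
  classical
  set z₀ := X.shift p.1 p.2
  have hrest : DifferentiableAt ℂ
      (fun z => ∏ p' ∈ Finset.univ.erase p, sinh (z - X.shift p'.1 p'.2)) z₀ := by
    exact (ExpPolyOrder.prod _ fun (p' : X.StringIdx) _ =>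
      (IsExpPoly.sinh_sub (X.shift p'.1 p'.2)).order).differentiable z₀
  have h1 : HasDerivAt (fun z => sinh (z - z₀)) 1 z₀ := by
    simpa using ((hasDerivAt_id z₀).sub_const z₀).csinh
  have h2 := h1.mul hrest.hasDerivAt
  refine ⟨_, ?_, (h2.congr_of_eventuallyEq (Filter.Eventually.of_forall fun z => ?_))⟩
  · rw [sub_self, sinh_zero, zero_mul, add_zero, one_mul]
    refine Finset.prod_ne_zero_iff.mpr fun p' hp' => ?_
    refine sinh_sub_ne_zero_iff.mpr fun h => ?_
    exact Finset.ne_of_mem_erase hp' (X.injective_exp_string hη hξ h).symm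
  · exact (Finset.mul_prod_erase _ _ (Finset.mem_univ p)).symm

/-- The quotient formula determines an entire function, so results for the interpolated `t'` apply
to every admissible `t`. -/
theorem IsTFunction.eq_of_mul_w (hspin : ∀ n, 1 ≤ X.twoS n) {ε : ℂ} (hε : ε ≠ 0)
    {r : Fin X.numRoots → ℂ} {t t' : ℂ → ℂ} (ht : X.IsTFunction ε r t) (ht' : Continuous t')
    (h : ∀ z, t' z * X.w ε z = X.numeratorOf (X.Q r) z) : t = t' := by
  obtain ⟨z₀, hz₀⟩ := X.exists_d_mul_w_ne_zero hspin hε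
  refine funext (eq_of_mul_eq_mul_of_differentiable (X.differentiable_w ε) ht.1.continuous ht'
    ⟨z₀, right_ne_zero_of_mul hz₀⟩ fun z hz => ?_)
  rw [ht.2 z hz, eq_comm, eq_div_iff hz]
  exact h z

theorem isTFunction_of_mul_w {ε : ℂ} {r : Fin X.numRoots → ℂ} {t : ℂ → ℂ}
    (ht : Differentiable ℂ t) (h : ∀ z, t z * X.w ε z = X.numeratorOf (X.Q r) z) :
    X.IsTFunction ε r t :=
  ⟨ht, fun z hz => (eq_div_iff hz).mpr (h z)⟩

theorem BaxterEq.mul_w (hspin : ∀ n, 1 ≤ X.twoS n) {Q t : ℂ → ℂ} {ε : ℂ} (hε : ε ≠ 0)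
    (hQ : Continuous Q) (ht : Continuous t) (htp : OddParity N t) (h : X.BaxterEq t Q)
    (hW : ∀ z, X.wronskianOf Q z = X.d z * X.w ε z) (z : ℂ) :
    t z * X.w ε z = X.numeratorOf Q z := by
  obtain ⟨z₀, hz₀⟩ := X.exists_d_mul_w_ne_zero hspin hε
  refine eq_of_mul_eq_mul_of_differentiable (f := fun z => t z * X.w ε z) X.differentiable_d
    (by have := (X.differentiable_w ε).continuous; fun_prop)
    (by unfold numeratorOf; fun_prop) ⟨z₀, left_ne_zero_of_mul hz₀⟩
    (fun z hz => mul_left_cancel₀ hz ?_) z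
  -- Cramer's rule: eliminating `a` from the equations for `Q(z)` and `Q(z+iπ)` leaves `t` times the
  -- Wronskian equal to `d` times the numerator, and `d` is cancelled.
  have h1 := h z
  have h2 := h.add_pi htp z
  have h3 := hW z
  simp only [wronskianOf, numeratorOf] at h3 ⊢
  rw [show z + Real.pi * I - X.η = z - X.η + Real.pi * I by ring] at *
  linear_combination -t z * h3 + Q (z - X.η + Real.pi * I) * h1 + Q (z - X.η) * h2

/-- A solution of the Baxter equation with non-vanishing lowest coefficient factorizes and gives all
the data of an eigenvalue. -/
theorem BaxterEq.exists_roots (hspin : ∀ n, 1 ≤ X.twoS n) (hη : X.Generic)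
    (hξ : X.InhomogeneityCondition) {t Q : ℂ → ℂ} {lo hi : ℂ}
    (ht : Differentiable ℂ t) (htp : OddParity N t) (hQ : IsExpPoly X.numRoots lo hi Q)
    (hlo : lo ≠ 0) (h : X.BaxterEq t Q) :
    ∃ (ε : ℂ) (r : Fin X.numRoots → ℂ), (ε = 1 ∨ ε = -1) ∧ X.Wronskian ε r ∧
      X.IsTFunction ε r t ∧ X.ProportionalVectors r := by
  -- If `hi = 0`, comparing highest coefficients gives `c = 0`; the lowest coefficient `2 lo² E⁻¹`
  -- of the Wronskian would then vanish.
  have hhi : hi ≠ 0 := by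
    rintro rfl
    obtain ⟨c, hc⟩ := h.wronskianOf_eq hη hξ hQ.order htp
    obtain ⟨E, hE, hW⟩ := wronskianOf_isExpPoly (X := X) hQ
    obtain ⟨F, hF, hS⟩ := stringProd_isExpPoly (X := X)
    obtain ⟨h1, h2⟩ := (funext hc ▸ hW : IsExpPoly _ _ _ fun z => c * X.stringProd z).unique
      (hS.const_mul c)
    have hc0 : c = 0 := by simpa [hF] using h2
    rw [hc0, zero_mul] at h1
    simp [hlo, hE] at h1
  obtain ⟨c, r, hc, hr⟩ := hQ.exists_roots hlo hhi
  have hB : X.BaxterEq t (X.Q r) := (BaxterEq.const_mul_iff hc).mp (by rwa [funext hr] at h)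
  obtain ⟨lo', hi', hQ', hlohi⟩ := X.Q_isExpPoly r
  obtain ⟨c', hc'⟩ := hB.wronskianOf_eq hη hξ hQ'.order htp
  obtain ⟨ε, hε, rfl⟩ := wronskianOf_const hQ' hlohi hc'
  have hε0 : ε ≠ 0 := by rcases hε with rfl | rfl <;> simp
  have hWr := (X.wronskian_iff hspin ε r).mpr hc'
  have hd := hQ'.order.differentiable
  refine ⟨ε, r, hε, hWr, isTFunction_of_mul_w ht
    (hB.mul_w hspin hε0 hd.continuous ht.continuous htp hWr), fun n => ⟨?_, ?_⟩⟩
  · obtain ⟨c, hc⟩ := (hB.isStringSolution n).proportional hη hξ (hB.isStringSolution_add_pi htp n)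
    exact ⟨c, hc.imp (fun h => funext fun k => h k (Nat.le_of_lt_succ k.2))
      fun h => funext fun k => h k (Nat.le_of_lt_succ k.2)⟩
  · rintro ⟨h1, h2⟩
    have e1 : ∀ k ≤ X.twoS n, X.Q r (X.shift n k) = 0 := fun k hk =>
      congrFun h1 ⟨k, Nat.lt_succ_of_le hk⟩
    have e2 : ∀ k ≤ X.twoS n, X.Q r (X.shift n k + Real.pi * I) = 0 := fun k hk => by
      have := congrFun h2 ⟨k, Nat.lt_succ_of_le hk⟩
      simpa [vecQTilde] using this
    have s1 : X.shift n 0 - X.η = X.shift n 1 := (X.shift_succ n 0).symm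
    -- If both vectors vanish, all four factors of the Wronskian are zero at `ξ_n^{(0)}`, so its
    -- derivative is zero there, whereas `stringProd` has a simple zero.
    obtain ⟨y, hy, hder⟩ := exists_hasDerivAt_stringProd hη hξ (⟨n, 0, hspin n⟩ : X.StringIdx)
    have hder' := hder.const_mul (2 * ε * (I / 2) ^ X.numRoots)
    rw [← funext hc'] at hder'
    have hder0 : HasDerivAt (X.wronskianOf (X.Q r)) (0 + 0) (X.shift n 0) :=
      (hasDerivAt_mul_zero (by fun_prop) (by fun_prop) (e1 0 (Nat.zero_le _))
        (by rw [add_sub_right_comm, s1]; exact e2 1 (hspin n))).add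
      (hasDerivAt_mul_zero (by fun_prop) (by fun_prop) (e2 0 (Nat.zero_le _))
        (by rw [s1]; exact e1 1 (hspin n)))
    have := hder'.unique hder0
    simp [hε0, hy] at this

end Baxter

end XXZChain

/-! ### Operators on the chain -/

namespace XXZChain

section Operators

open Complex Matrix

variable {N : ℕ} (X : XXZChain N)

/-- The product covector with the given local components. -/
noncomputable def prodCov (φ : ∀ n, X.LocalIdx n → ℂ) : X.Idx → ℂ := fun h => ∏ n, φ n (h n)

theorem prodCov_vecMul_atSite (φ : ∀ n, X.LocalIdx n → ℂ) (n : Fin N)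
    (A : Matrix (X.LocalIdx n) (X.LocalIdx n) ℂ) :
    X.prodCov φ ᵥ* X.atSite n A = X.prodCov (Function.update φ n (φ n ᵥ* A)) := by
  funext h'
  have hR : X.prodCov (Function.update φ n (φ n ᵥ* A)) h' =
      (∏ m ∈ Finset.univ.erase n, φ m (h' m)) * ∑ k, φ n k * A k (h' n) := by
    rw [prodCov, ← Finset.prod_erase_mul _ _ (Finset.mem_univ n)]
    congr 1
    · refine Finset.prod_congr rfl fun m hm => ?_
      rw [Function.update_of_ne (Finset.ne_of_mem_erase hm)]
    · rw [Function.update_self]; rfl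
  rw [hR, Finset.mul_sum]
  refine (Finset.sum_of_injOn (fun k => Function.update h' n k)
    (Function.update_injective h' n).injOn (fun _ _ => Finset.mem_univ _) ?_ ?_).symm
  · intro h _ hh
    have : ¬ ∀ m, m ≠ n → h m = h' m := fun hm => hh ⟨h n, Finset.mem_coe.mpr (Finset.mem_univ _), by
      funext m
      rcases eq_or_ne m n with rfl | hmn
      · simp
      · simp [Function.update_of_ne hmn, hm m hmn]⟩
    simp only [atSite, if_neg this, mul_zero]
  · intro k _
    have : ∀ m, m ≠ n → Function.update h' n k m = h' m := fun m hm => Function.update_of_ne hm _ _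
    simp only [atSite, if_pos this, Function.update_self]
    rw [prodCov, ← Finset.prod_erase_mul _ _ (Finset.mem_univ n), Function.update_self, mul_assoc]
    congr 1
    refine Finset.prod_congr rfl fun m hm => ?_
    rw [this m (Finset.ne_of_mem_erase hm)]

/-- The basis covectors are themselves product covectors; operator identities thereby reduce to
updates of local factors. -/
theorem op_ext {A B : X.Op} (h : ∀ φ, X.prodCov φ ᵥ* A = X.prodCov φ ᵥ* B) : A = B := by
  ext i j
  have hi : X.prodCov (fun n => Pi.single (i n) 1) = Pi.single i 1 := by
    funext k
    rcases eq_or_ne k i with rfl | hk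
    · simp [prodCov]
    · obtain ⟨n, hn⟩ := Function.ne_iff.mp hk
      rw [Pi.single_eq_of_ne hk]
      exact Finset.prod_eq_zero (Finset.mem_univ n) (Pi.single_eq_of_ne hn _)
  have := congrFun (h fun n => Pi.single (i n) 1) j
  rw [hi, single_one_vecMul, single_one_vecMul] at this
  exact this

theorem atSite_mul (n : Fin N) (A B : Matrix (X.LocalIdx n) (X.LocalIdx n) ℂ) :
    X.atSite n (A * B) = X.atSite n A * X.atSite n B := by
  refine X.op_ext fun φ => ?_
  simp [← vecMul_vecMul, prodCov_vecMul_atSite]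

theorem atSite_add (n : Fin N) (A B : Matrix (X.LocalIdx n) (X.LocalIdx n) ℂ) :
    X.atSite n (A + B) = X.atSite n A + X.atSite n B := by
  ext h h'; simp only [atSite, Matrix.add_apply]; split_ifs <;> simp

theorem atSite_smul (n : Fin N) (c : ℂ) (A : Matrix (X.LocalIdx n) (X.LocalIdx n) ℂ) :
    X.atSite n (c • A) = c • X.atSite n A := by
  ext h h'; simp only [atSite, Matrix.smul_apply]; split_ifs <;> simp

theorem atSite_one (n : Fin N) : X.atSite n 1 = 1 := by
  refine X.op_ext fun φ => ?_
  simp [prodCov_vecMul_atSite]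

/-- `atSite` as an algebra homomorphism. -/
noncomputable def atSiteHom (n : Fin N) : Matrix (X.LocalIdx n) (X.LocalIdx n) ℂ →ₐ[ℂ] X.Op :=
  AlgHom.ofLinearMap ⟨⟨X.atSite n, X.atSite_add n⟩, X.atSite_smul n⟩ (X.atSite_one n)
    (X.atSite_mul n)

theorem commute_atSite {m n : Fin N} (h : m ≠ n) (A : Matrix (X.LocalIdx m) (X.LocalIdx m) ℂ)
    (B : Matrix (X.LocalIdx n) (X.LocalIdx n) ℂ) : Commute (X.atSite m A) (X.atSite n B) := by
  refine X.op_ext fun φ => ?_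
  simp only [← vecMul_vecMul, prodCov_vecMul_atSite, Function.update_of_ne h,
    Function.update_of_ne h.symm]
  rw [Function.update_comm h]

/-- The Lax matrix with entries acting on the local space. -/
noncomputable def localLax (n : Fin N) (lam : ℂ) :
    Matrix (Fin 2) (Fin 2) (Matrix (X.LocalIdx n) (X.LocalIdx n) ℂ) :=
  !![X.diagSz n fun z => sinh (lam + X.η * z), sinh X.η • X.sMinus n;
     sinh X.η • X.sPlus n, X.diagSz n fun z => sinh (lam - X.η * z)]

theorem lax_apply (n : Fin N) (lam : ℂ) (i j : Fin 2) :
    X.lax n lam i j = X.atSite n (X.localLax n lam i j) := by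
  fin_cases i <;> fin_cases j <;> rfl

/-- The product of the Lax operators at the first `k` sites. -/
noncomputable def partialMonodromy (k : ℕ) (lam : ℂ) : Matrix (Fin 2) (Fin 2) X.Op :=
  ((List.ofFn fun n : Fin N => X.lax n (lam - X.ξ n)).take k).reverse.prod

theorem partialMonodromy_zero (lam : ℂ) : X.partialMonodromy 0 lam = 1 := by
  simp [partialMonodromy]

theorem partialMonodromy_succ {k : ℕ} (hk : k < N) (lam : ℂ) :
    X.partialMonodromy (k + 1) lam =
      X.lax ⟨k, hk⟩ (lam - X.ξ ⟨k, hk⟩) * X.partialMonodromy k lam := by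
  have : k < (List.ofFn fun n : Fin N => X.lax n (lam - X.ξ n)).length := by simpa
  rw [partialMonodromy, ← List.take_concat_get' _ _ this]
  simp [partialMonodromy]

theorem partialMonodromy_self (lam : ℂ) : X.partialMonodromy N lam = X.monodromy lam := by
  rw [partialMonodromy, List.take_of_length_le (by simp), monodromy]

theorem commute_partialMonodromy {k : ℕ} (hk : k ≤ N) (lam : ℂ) (i j : Fin 2) {n : Fin N}
    (hn : k ≤ n) (A : Matrix (X.LocalIdx n) (X.LocalIdx n) ℂ) :
    Commute (X.partialMonodromy k lam i j) (X.atSite n A) := by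
  induction k generalizing i j with
  | zero =>
    rw [partialMonodromy_zero]
    rcases eq_or_ne i j with rfl | hij
    · rw [one_apply_eq]; exact Commute.one_left _
    · rw [one_apply_ne hij]; exact Commute.zero_left _
  | succ k ih =>
    rw [partialMonodromy_succ X hk, mul_apply]
    refine Commute.sum_left _ _ _ fun l _ => ?_
    refine Commute.mul_left ?_ (ih (by omega) l j (by omega))
    rw [lax_apply]
    refine X.commute_atSite (fun h => ?_) _ _
    have := congrArg Fin.val h
    simp only at this
    omega

theorem lax_add_pi (n : Fin N) (lam : ℂ) (i j : Fin 2) :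
    X.lax n (lam + Real.pi * I) i j = -((-1 : ℂ) ^ (i + j : ℕ)) • X.lax n lam i j := by
  have h1 : ∀ z : ℂ, sinh (lam + Real.pi * I + z) = -sinh (lam + z) := fun z => by
    rw [← sinh_add_pi_mul_I]; ring_nf
  have h2 : ∀ z : ℂ, sinh (lam + Real.pi * I - z) = -sinh (lam - z) := fun z => by
    rw [← sinh_add_pi_mul_I]; ring_nf
  rw [lax_apply, lax_apply, ← atSite_smul]
  congr 1
  fin_cases i <;> fin_cases j <;> ext k l <;>
    simp [localLax, diagSz, h1, h2, Matrix.diagonal_apply]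

/-- Diagonal Lax entries change sign under `iπ` and off-diagonal ones do not. This grading by `i +
j` is multiplicative. -/
theorem partialMonodromy_add_pi {k : ℕ} (hk : k ≤ N) (lam : ℂ) (i j : Fin 2) :
    X.partialMonodromy k (lam + Real.pi * I) i j =
      ((-1 : ℂ) ^ (k + i + j : ℕ)) • X.partialMonodromy k lam i j := by
  induction k generalizing i j with
  | zero =>
    rw [partialMonodromy_zero, partialMonodromy_zero]
    rcases eq_or_ne i j with rfl | hij
    · rw [zero_add, ← two_mul, pow_mul]; simp
    · rw [one_apply_ne hij, smul_zero]
  | succ k ih =>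
    simp only [partialMonodromy_succ X hk, mul_apply, Fin.sum_univ_two, ih (by omega),
      add_sub_right_comm lam, lax_add_pi]
    rw [smul_add]
    simp only [smul_mul_smul_comm]
    congr 2 <;> simp [pow_add] <;> ring

theorem lax_order (n : Fin N) (c : ℂ) (i j : Fin 2) (h h' : X.Idx) :
    ExpPolyOrder 2 fun lam => X.lax n (lam - c) i j h h' := by
  simp only [lax_apply, atSite]
  split_ifs
  · generalize h n = k, h' n = l
    have hs : ∀ z : ℂ, ExpPolyOrder 2 fun lam => sinh (lam - z) := fun z =>
      (IsExpPoly.sinh_sub z).order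
    fin_cases i <;> fin_cases j
    · simp only [localLax, diagSz, Fin.zero_eta, of_apply, cons_val_zero,
        Matrix.diagonal_apply]
      split_ifs
      · convert hs (c - X.η * ((X.twoS n : ℂ) / 2 - (k : ℕ))) using 3; ring
      · exact ExpPolyOrder.zero
    · exact (IsExpPoly.const_two _).order
    · exact (IsExpPoly.const_two _).order
    · simp only [localLax, diagSz, Fin.mk_one, of_apply, cons_val_one, cons_val_fin_one,
        Matrix.diagonal_apply]
      split_ifs
      · convert hs (c + X.η * ((X.twoS n : ℂ) / 2 - (k : ℕ))) using 3; ring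
      · exact ExpPolyOrder.zero
  · exact ExpPolyOrder.zero

theorem partialMonodromy_order {k : ℕ} (hk : k ≤ N) (i j : Fin 2) (h h' : X.Idx) :
    ExpPolyOrder (2 * k) fun lam => X.partialMonodromy k lam i j h h' := by
  induction k generalizing i j h h' with
  | zero =>
    simp only [partialMonodromy_zero]
    exact (IsExpPoly.const _).order
  | succ k ih =>
    have : 2 * (k + 1) = 2 + 2 * k := by ring
    simp only [partialMonodromy_succ X hk, mul_apply, Matrix.sum_apply, this]
    exact ExpPolyOrder.sum _ fun l _ => ExpPolyOrder.sum _ fun h'' _ =>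
      (X.lax_order _ _ _ _ _ _).mul (ih (by omega) _ _ _ _)

theorem monodromy_order (i j : Fin 2) (h h' : X.Idx) :
    ExpPolyOrder (2 * N) fun lam => X.monodromy lam i j h h' := by
  simp only [← partialMonodromy_self]; exact X.partialMonodromy_order le_rfl _ _ _ _

theorem transfer_order (κ : ℂ) (h h' : X.Idx) :
    ExpPolyOrder (2 * N) fun lam => X.transfer κ lam h h' :=
  ((X.monodromy_order 0 1 h h').const_mul κ⁻¹).add ((X.monodromy_order 1 0 h h').const_mul κ)

theorem transfer_add_pi (κ lam : ℂ) :
    X.transfer κ (lam + Real.pi * I) = (-(-1 : ℂ) ^ N) • X.transfer κ lam := by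
  simp only [transfer, ← partialMonodromy_self, partialMonodromy_add_pi X le_rfl, smul_add,
    smul_smul]
  congr 2 <;> simp [pow_add, mul_comm]

variable {X}

theorem mem_spectrumFun_order {κ : ℂ} {t : ℂ → ℂ} (ht : t ∈ X.spectrumFun κ) :
    ExpPolyOrder (2 * N) t ∧ OddParity N t := by
  obtain ⟨v, hv, H⟩ := ht
  obtain ⟨i, hi⟩ := Function.ne_iff.mp hv
  have hi' : v i ≠ 0 := hi
  have key : ∀ lam, t lam = (v i)⁻¹ * ∑ j, v j * X.transfer κ lam i j := fun lam => by
    have := congrFun (H lam) i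
    simp only [mulVec, dotProduct, Pi.smul_apply, smul_eq_mul] at this
    rw [eq_inv_mul_iff_mul_eq₀ hi', mul_comm, ← this]
    exact Finset.sum_congr rfl fun _ _ => mul_comm _ _
  constructor
  · rw [funext key]
    exact (ExpPolyOrder.sum _ fun j _ => (X.transfer_order κ i j).const_mul (v j)).const_mul _
  · intro z
    have h1 := congrFun (H (z + Real.pi * I)) i
    have h2 := congrFun (H z) i
    rw [transfer_add_pi, smul_mulVec] at h1
    simp only [Pi.smul_apply, smul_eq_mul] at h1 h2
    rw [h2] at h1
    exact mul_right_cancel₀ hi' (by linear_combination -h1)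

end Operators

end XXZChain

/-! ### The Yang–Baxter algebra -/

section YangBaxter

open Complex Matrix

section

variable {R : Type*} [Ring R]

/-- `A ⊗ 1` for a matrix `A` with non-commuting entries. -/
def auxLeft (A : Matrix (Fin 2) (Fin 2) R) : Matrix (Fin 2 × Fin 2) (Fin 2 × Fin 2) R :=
  fun p q => if p.2 = q.2 then A p.1 q.1 else 0

/-- `1 ⊗ A` for a matrix `A` with non-commuting entries. -/
def auxRight (A : Matrix (Fin 2) (Fin 2) R) : Matrix (Fin 2 × Fin 2) (Fin 2 × Fin 2) R :=
  fun p q => if p.1 = q.1 then A p.2 q.2 else 0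

/-- All entries of one matrix commute with all entries of the other. -/
def EntriesCommute (A B : Matrix (Fin 2) (Fin 2) R) : Prop :=
  ∀ i j k l, Commute (A i j) (B k l)

theorem auxLeft_mul (A B : Matrix (Fin 2) (Fin 2) R) :
    auxLeft (A * B) = auxLeft A * auxLeft B := by
  ext ⟨i, j⟩ ⟨k, l⟩
  fin_cases j <;> fin_cases l <;>
    simp [auxLeft, mul_apply, Fintype.sum_prod_type, Fin.sum_univ_two]

theorem auxRight_mul (A B : Matrix (Fin 2) (Fin 2) R) :
    auxRight (A * B) = auxRight A * auxRight B := by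
  ext ⟨i, j⟩ ⟨k, l⟩
  fin_cases i <;> fin_cases k <;>
    simp [auxRight, mul_apply, Fintype.sum_prod_type, Fin.sum_univ_two]

theorem EntriesCommute.auxLeft_mul_auxRight {A B : Matrix (Fin 2) (Fin 2) R}
    (h : EntriesCommute A B) : auxLeft A * auxRight B = auxRight B * auxLeft A := by
  ext ⟨i, j⟩ ⟨k, l⟩
  have := (h i k j l).eq
  fin_cases i <;> fin_cases j <;> fin_cases k <;> fin_cases l <;>
    simpa [auxLeft, auxRight, mul_apply, Fintype.sum_prod_type, Fin.sum_univ_two] using this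

end

variable {R S : Type*} [Ring R] [Algebra ℂ R] [Ring S] [Algebra ℂ S]

/-- The six-vertex `R`-matrix. -/
noncomputable def sixVertex (η u : ℂ) (p q : Fin 2 × Fin 2) : ℂ :=
  if p.1 = p.2 then if p = q then sinh (u + η) else 0
  else if p = q then sinh u else if p = q.swap then sinh η else 0

/-- The six-vertex `R`-matrix with entries in a `ℂ`-algebra. -/
noncomputable def sixVertexMatrix (R : Type*) [Ring R] [Algebra ℂ R] (η u : ℂ) :
    Matrix (Fin 2 × Fin 2) (Fin 2 × Fin 2) R :=
  fun p q => algebraMap ℂ R (sixVertex η u p q)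

/-- The exchange relation for a monodromy matrix at spectral parameters with difference `u`. -/
def ExchangeRel (η u : ℂ) (A B : Matrix (Fin 2) (Fin 2) R) : Prop :=
  sixVertexMatrix R η u * (auxLeft A * auxRight B) =
    auxRight B * auxLeft A * sixVertexMatrix R η u

/-- The `R`-matrix is carried through one pair of factors and then the other; commuting entries
allow the pairs to be separated first. -/
theorem ExchangeRel.mul {η u : ℂ} {A B A' B' : Matrix (Fin 2) (Fin 2) R}
    (h : ExchangeRel η u A B) (h' : ExchangeRel η u A' B')
    (hc : EntriesCommute A' B) (hc' : EntriesCommute A B') :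
    ExchangeRel η u (A * A') (B * B') := by
  have e1 := hc.auxLeft_mul_auxRight
  have e2 := hc'.auxLeft_mul_auxRight
  unfold ExchangeRel at *
  calc sixVertexMatrix R η u * (auxLeft (A * A') * auxRight (B * B'))
      = sixVertexMatrix R η u * (auxLeft A * (auxLeft A' * auxRight B) * auxRight B') := by
        rw [auxLeft_mul, auxRight_mul]; noncomm_ring
    _ = sixVertexMatrix R η u * (auxLeft A * auxRight B) * (auxLeft A' * auxRight B') := by
        rw [e1]; noncomm_ring
    _ = auxRight B * auxLeft A * (sixVertexMatrix R η u * (auxLeft A' * auxRight B')) := by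
        rw [h]; noncomm_ring
    _ = auxRight B * (auxLeft A * auxRight B') * auxLeft A' * sixVertexMatrix R η u := by
        rw [h']; noncomm_ring
    _ = _ := by rw [e2, auxLeft_mul, auxRight_mul]; noncomm_ring

theorem ExchangeRel.map {η u : ℂ} {A B : Matrix (Fin 2) (Fin 2) R} (h : ExchangeRel η u A B)
    (f : R →ₐ[ℂ] S) : ExchangeRel η u (A.map f) (B.map f) := by
  have h1 : ∀ C : Matrix (Fin 2) (Fin 2) R, auxLeft (C.map f) = (auxLeft C).map f := fun C => by
    ext p q; simp only [auxLeft, map_apply]; split_ifs <;> simp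
  have h2 : ∀ C : Matrix (Fin 2) (Fin 2) R, auxRight (C.map f) = (auxRight C).map f := fun C => by
    ext p q; simp only [auxRight, map_apply]; split_ifs <;> simp
  have h3 : sixVertexMatrix S η u = (sixVertexMatrix R η u).map f := by
    ext p q; simp [sixVertexMatrix]
  unfold ExchangeRel at *
  rw [h1, h2, h3, ← Matrix.map_mul, ← Matrix.map_mul, ← Matrix.map_mul, ← Matrix.map_mul, h]

theorem ExchangeRel.one (η u : ℂ) : ExchangeRel η u (1 : Matrix (Fin 2) (Fin 2) R) 1 := by
  have h1 : auxLeft (1 : Matrix (Fin 2) (Fin 2) R) = 1 := by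
    ext ⟨i, j⟩ ⟨k, l⟩; simp only [auxLeft, one_apply, Prod.mk.injEq]; split_ifs <;> simp_all
  have h2 : auxRight (1 : Matrix (Fin 2) (Fin 2) R) = 1 := by
    ext ⟨i, j⟩ ⟨k, l⟩; simp only [auxRight, one_apply, Prod.mk.injEq]; split_ifs <;> simp_all
  rw [ExchangeRel, h1, h2]; simp

section Relations

variable {η u : ℂ} {A B : Matrix (Fin 2) (Fin 2) R}

theorem ExchangeRel.lower_comm (h : ExchangeRel η u A B) (hu : sinh (u + η) ≠ 0) :
    A 1 0 * B 1 0 = B 1 0 * A 1 0 := by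
  have := congrFun (congrFun h (1, 1)) (0, 0)
  simp [sixVertexMatrix, sixVertex, auxLeft, auxRight, mul_apply, Fintype.sum_prod_type,
    Fin.sum_univ_two, Algebra.algebraMap_eq_smul_one] at this
  exact smul_right_injective R hu this

theorem ExchangeRel.lower_diag (h : ExchangeRel η u A B) :
    sinh u • (B 1 0 * A 1 1) = sinh (u + η) • (A 1 1 * B 1 0) - sinh η • (B 1 1 * A 1 0) := by
  have := congrFun (congrFun h (1, 1)) (1, 0)
  simp [sixVertexMatrix, sixVertex, auxLeft, auxRight, mul_apply, Fintype.sum_prod_type,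
    Fin.sum_univ_two, Algebra.algebraMap_eq_smul_one] at this
  rw [this]; abel

theorem ExchangeRel.upper_diag (h : ExchangeRel η u A B) :
    sinh u • (A 0 1 * B 1 1) = sinh (u + η) • (B 1 1 * A 0 1) - sinh η • (A 1 1 * B 0 1) := by
  have := congrFun (congrFun h (0, 1)) (1, 1)
  simp [sixVertexMatrix, sixVertex, auxLeft, auxRight, mul_apply, Fintype.sum_prod_type,
    Fin.sum_univ_two, Algebra.algebraMap_eq_smul_one] at this
  rw [← this]; abel

end Relations

/-- The quantum determinant relation: `A` and `B` are the values of a monodromy matrix at `λ` and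
`λ - η`, and `δ` is the quantum determinant. -/
def QuantumDet (δ : ℂ) (A B : Matrix (Fin 2) (Fin 2) R) : Prop :=
  ∀ i j, A i 0 * B j 1 - A i 1 * B j 0 =
    algebraMap ℂ R (!![0, δ; -δ, 0] i j)

/-- With `J` the antisymmetric `2 × 2` matrix, the relation reads `A J Bᵀ = δ J`. In a product the
inner pair collapses to the scalar `δ'` and leaves the outer relation. -/
theorem QuantumDet.mul {δ δ' : ℂ} {A B A' B' : Matrix (Fin 2) (Fin 2) R}
    (h : QuantumDet δ A B) (h' : QuantumDet δ' A' B') (hc : EntriesCommute A' B) :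
    QuantumDet (δ * δ') (A * A') (B * B') := by
  intro i j
  have h1 : ∀ k l m n, A i k * A' k m * (B j l * B' l n) = A i k * B j l * (A' k m * B' l n) := by
    intro k l m n
    rw [mul_assoc, ← mul_assoc (A' k m), (hc k m j l).eq]; noncomm_ring
  have h00 := h' 0 0
  have h01 := h' 0 1
  have h10 := h' 1 0
  have h11 := h' 1 1
  have hij := h i j
  simp only [mul_apply, Fin.sum_univ_two, add_mul, mul_add, h1]
  simp at h00 h01 h10 h11
  calc _ = A i 0 * B j 0 * (A' 0 0 * B' 0 1 - A' 0 1 * B' 0 0)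
        + A i 0 * B j 1 * (A' 0 0 * B' 1 1 - A' 0 1 * B' 1 0)
        + A i 1 * B j 0 * (A' 1 0 * B' 0 1 - A' 1 1 * B' 0 0)
        + A i 1 * B j 1 * (A' 1 0 * B' 1 1 - A' 1 1 * B' 1 0) := by noncomm_ring
    _ = (A i 0 * B j 1 - A i 1 * B j 0) * algebraMap ℂ R δ' := by
        rw [h00, h01, h10, h11]; noncomm_ring
    _ = _ := by
        rw [hij, ← map_mul]
        congr 1
        fin_cases i <;> fin_cases j <;> simp

theorem QuantumDet.map {δ : ℂ} {A B : Matrix (Fin 2) (Fin 2) R} (h : QuantumDet δ A B)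
    (f : R →ₐ[ℂ] S) : QuantumDet δ (A.map f) (B.map f) := by
  intro i j
  simp only [map_apply, ← map_mul, ← map_sub, h i j, AlgHom.commutes]

theorem QuantumDet.one : QuantumDet 1 (1 : Matrix (Fin 2) (Fin 2) R) 1 := by
  intro i j
  fin_cases i <;> fin_cases j <;> simp [one_apply]

end YangBaxter

/-! ### Local exchange relations -/

section Identities

open Complex

theorem sinh_exchange (u e x : ℂ) :
    sinh (u + e) * sinh x = sinh u * sinh (x + e) + sinh e * sinh (x - u) := by
  simp only [Complex.sinh, exp_add, exp_sub, exp_neg, neg_sub]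
  field_simp
  ring

theorem sinh_exchange' (u e x : ℂ) :
    sinh (u + e) * sinh x = sinh u * sinh (x - e) + sinh e * sinh (x + u) := by
  simp only [Complex.sinh, exp_add, exp_sub, exp_neg, neg_sub]
  field_simp
  ring

theorem sinh_casimir (u e p y m : ℂ) :
    sinh u * (sinh (p - y) * sinh (p + y + e) - sinh (p - y + e) * sinh (p + y)) =
      sinh e * (sinh (m - y) * sinh (m + u + y) - sinh (m + u - y) * sinh (m + y)) := by
  simp only [Complex.sinh, exp_add, exp_sub, exp_neg, neg_sub]
  field_simp
  ring

theorem sinh_qdet (e p y l : ℂ) :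
    sinh (l + y) * sinh (l - e - y) - sinh (p - y) * sinh (p + y + e) =
      sinh (l + p) * sinh (l - e - p) := by
  simp only [Complex.sinh, exp_add, exp_sub, exp_neg, neg_sub]
  field_simp
  ring

end Identities

namespace XXZChain

section LocalRelations

open Complex Matrix

variable {N : ℕ} (X : XXZChain N) (n : Fin N)

/-- The relations use only the square of a ladder coefficient, so the branch of the root is
immaterial. -/
theorem ladder_sq (k : ℕ) :
    X.ladder n k * X.ladder n k = X.qInt k * X.qInt ((X.twoS n : ℂ) - k + 1) := by
  rw [← sq, ladder, one_div, cpow_ofNat_inv_pow]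

theorem diagSz_mul_apply (f : ℂ → ℂ) (M : Matrix (X.LocalIdx n) (X.LocalIdx n) ℂ)
    (i j : X.LocalIdx n) :
    (X.diagSz n f * M) i j = f ((X.twoS n : ℂ) / 2 - (i : ℕ)) * M i j := by
  rw [diagSz, diagonal_mul]

theorem mul_diagSz_apply (f : ℂ → ℂ) (M : Matrix (X.LocalIdx n) (X.LocalIdx n) ℂ)
    (i j : X.LocalIdx n) :
    (M * X.diagSz n f) i j = M i j * f ((X.twoS n : ℂ) / 2 - (j : ℕ)) := by
  rw [diagSz, mul_diagonal]

theorem diagSz_mul (f g : ℂ → ℂ) : X.diagSz n f * X.diagSz n g = X.diagSz n fun z => f z * g z := by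
  simp [diagSz, diagonal_mul_diagonal]

theorem qInt_zero : X.qInt 0 = 0 := by simp [qInt]

theorem sMinus_mul_sPlus : X.sMinus n * X.sPlus n = X.diagSz n fun z =>
    X.qInt ((X.twoS n : ℂ) / 2 - z) * X.qInt ((X.twoS n : ℂ) / 2 + z + 1) := by
  ext i j
  rw [mul_apply, diagSz, diagonal_apply]
  have e1 : (X.twoS n : ℂ) / 2 - ((X.twoS n : ℂ) / 2 - (i : ℕ)) = (i : ℕ) := by ring
  have e2 : (X.twoS n : ℂ) / 2 + ((X.twoS n : ℂ) / 2 - (i : ℕ)) + 1 =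
      (X.twoS n : ℂ) - (i : ℕ) + 1 := by ring
  rw [e1, e2]
  rcases i with ⟨_ | i, hi⟩
  · have : ∀ k, X.sMinus n ⟨0, hi⟩ k = 0 := fun k => if_neg (by simp)
    simp only [this, zero_mul, Finset.sum_const_zero]
    simp [qInt_zero]
  · rw [Finset.sum_eq_single ⟨i, by omega⟩]
    · split_ifs with hij
      · subst hij
        simp only [sMinus, sPlus, if_true]
        exact X.ladder_sq n _
      · have : (j : ℕ) ≠ i + 1 := fun h => hij (Fin.ext h.symm)
        simp [sPlus, this]
    · intro k _ hk
      have : i + 1 ≠ (k : ℕ) + 1 := fun h => hk (Fin.ext (by simpa using h.symm))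
      simp only [sMinus, if_neg this, zero_mul]
    · simp

theorem sPlus_mul_sMinus : X.sPlus n * X.sMinus n = X.diagSz n fun z =>
    X.qInt ((X.twoS n : ℂ) / 2 - z + 1) * X.qInt ((X.twoS n : ℂ) / 2 + z) := by
  ext i j
  rw [mul_apply, diagSz, diagonal_apply]
  have e1 : (X.twoS n : ℂ) / 2 - ((X.twoS n : ℂ) / 2 - (i : ℕ)) + 1 = ((i + 1 : ℕ) : ℂ) := by
    push_cast; ring
  have e2 : (X.twoS n : ℂ) / 2 + ((X.twoS n : ℂ) / 2 - (i : ℕ)) =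
      (X.twoS n : ℂ) - ((i + 1 : ℕ) : ℂ) + 1 := by push_cast; ring
  rw [e1, e2]
  rcases Nat.lt_or_ge i (X.twoS n) with hi | hi
  · rw [Finset.sum_eq_single ⟨i + 1, by omega⟩]
    · split_ifs with hij
      · subst hij
        simp only [sMinus, sPlus, if_true]
        exact X.ladder_sq n _
      · have : (i : ℕ) + 1 ≠ j + 1 := fun h => hij (Fin.ext (by simpa using h))
        simp only [sMinus, if_neg this, mul_zero]
    · intro k _ hk
      have : (k : ℕ) ≠ i + 1 := fun h => hk (Fin.ext h)
      simp only [sPlus, if_neg this, zero_mul]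
    · simp
  · have hi' : (i : ℕ) = X.twoS n := by have := i.2; omega
    have h1 : ∀ k, X.sPlus n i k = 0 := fun k => if_neg (by have := k.2; omega)
    have h2 : (X.twoS n : ℂ) - ((i + 1 : ℕ) : ℂ) + 1 = 0 := by rw [hi']; push_cast; ring
    rw [h2]
    simp [h1, qInt_zero]

theorem sinh_mul_qInt (hη : sinh X.η ≠ 0) (z : ℂ) : sinh X.η * X.qInt z = sinh (X.η * z) := by
  rw [qInt, mul_div_cancel₀ _ hη]

theorem sMinus_relation (f g : ℂ → ℂ) (h : ∀ z, f (z - 1) = g z) :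
    X.diagSz n f * X.sMinus n = X.sMinus n * X.diagSz n g := by
  ext i j
  rw [diagSz_mul_apply, mul_diagSz_apply, sMinus]
  split_ifs with hij
  · rw [← h, hij, mul_comm]; push_cast; congr 2; ring
  · simp

theorem sPlus_relation (f g : ℂ → ℂ) (h : ∀ z, f z = g (z - 1)) :
    X.diagSz n f * X.sPlus n = X.sPlus n * X.diagSz n g := by
  ext i j
  rw [diagSz_mul_apply, mul_diagSz_apply, sPlus]
  split_ifs with hij
  · rw [h, hij, mul_comm]; push_cast; congr 2; ring
  · simp

theorem diagSz_congr {f g : ℂ → ℂ} (h : ∀ z, f z = g z) : X.diagSz n f = X.diagSz n g := by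
  rw [funext h]

theorem smul_diagSz (c : ℂ) (f : ℂ → ℂ) : c • X.diagSz n f = X.diagSz n fun z => c * f z := by
  ext i j; simp [diagSz, diagonal_apply]

theorem diagSz_add (f g : ℂ → ℂ) : X.diagSz n f + X.diagSz n g = X.diagSz n fun z => f z + g z := by
  simp [diagSz]

theorem diagSz_sub (f g : ℂ → ℂ) : X.diagSz n f - X.diagSz n g = X.diagSz n fun z => f z - g z := by
  simp [diagSz]

theorem diagSz_const (c : ℂ) : X.diagSz n (fun _ => c) = algebraMap ℂ _ c := by
  ext i j; simp [diagSz, diagonal_apply, algebraMap_matrix_apply]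

/-- The lowering block of the Lax matrix. -/
theorem diagSz_mul_sMinus (f : ℂ → ℂ) :
    X.diagSz n f * (sinh X.η • X.sMinus n) =
      sinh X.η • X.sMinus n * X.diagSz n fun z => f (z - 1) := by
  rw [mul_smul_comm, smul_mul_assoc, X.sMinus_relation n f _ fun z => rfl]

theorem sPlus_mul_diagSz (f : ℂ → ℂ) :
    sinh X.η • X.sPlus n * X.diagSz n f =
      X.diagSz n (fun z => f (z - 1)) * (sinh X.η • X.sPlus n) := by
  rw [mul_smul_comm, smul_mul_assoc, X.sPlus_relation n _ f fun z => rfl]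

theorem smul_sMinus_mul_sPlus (hη : sinh X.η ≠ 0) :
    sinh X.η • X.sMinus n * (sinh X.η • X.sPlus n) = X.diagSz n fun z =>
      sinh (X.η * ((X.twoS n : ℂ) / 2) - X.η * z) *
        sinh (X.η * ((X.twoS n : ℂ) / 2) + X.η * z + X.η) := by
  rw [smul_mul_smul_comm, sMinus_mul_sPlus, smul_diagSz]
  refine X.diagSz_congr n fun z => ?_
  rw [mul_mul_mul_comm, X.sinh_mul_qInt hη, X.sinh_mul_qInt hη]
  ring_nf

theorem smul_sPlus_mul_sMinus (hη : sinh X.η ≠ 0) :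
    sinh X.η • X.sPlus n * (sinh X.η • X.sMinus n) = X.diagSz n fun z =>
      sinh (X.η * ((X.twoS n : ℂ) / 2) - X.η * z + X.η) *
        sinh (X.η * ((X.twoS n : ℂ) / 2) + X.η * z) := by
  rw [smul_mul_smul_comm, sPlus_mul_sMinus, smul_diagSz]
  refine X.diagSz_congr n fun z => ?_
  rw [mul_mul_mul_comm, X.sinh_mul_qInt hη, X.sinh_mul_qInt hη]
  ring_nf

/-- Off-diagonal Lax entries do not depend on the spectral parameter, so both matrices share `b` and
`c`, and the sixteen components reduce to these relations. -/
theorem _root_.ExchangeRel.of_relations {R : Type*} [Ring R] [Algebra ℂ R] {η u : ℂ}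
    {a b c d a' d' : R} (haa : a * a' = a' * a) (hdd : d * d' = d' * d) (had : a * d' = d' * a)
    (hda : d * a' = a' * d)
    (hab : sinh (u + η) • (a * b) = sinh u • (b * a) + sinh η • (a' * b))
    (hba : sinh (u + η) • (b * a') = sinh η • (b * a) + sinh u • (a' * b))
    (hac : sinh u • (a * c) + sinh η • (c * a') = sinh (u + η) • (c * a))
    (hca : sinh η • (a * c) + sinh u • (c * a') = sinh (u + η) • (a' * c))
    (hbd : sinh u • (b * d') + sinh η • (d * b) = sinh (u + η) • (d' * b))
    (hdb : sinh η • (b * d') + sinh u • (d * b) = sinh (u + η) • (b * d))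
    (hcd : sinh (u + η) • (c * d') = sinh u • (d' * c) + sinh η • (c * d))
    (hdc : sinh (u + η) • (d * c) = sinh η • (d' * c) + sinh u • (c * d))
    (hbc : sinh u • (b * c - c * b) = sinh η • (d' * a - d * a')) :
    ExchangeRel η u !![a, b; c, d] !![a', b; c, d'] := by
  rw [smul_sub, smul_sub] at hbc
  have h1 : sinh u • (b * c) + sinh η • (d * a') = sinh η • (d' * a) + sinh u • (c * b) := by
    rw [← sub_eq_zero] at hbc ⊢
    rw [← hbc]; abel
  have h2 : sinh η • (a * d') + sinh u • (c * b) = sinh u • (b * c) + sinh η • (a' * d) := by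
    rw [had, ← hda, h1]
  refine Matrix.ext fun ⟨p, p'⟩ ⟨q, q'⟩ => ?_
  fin_cases p <;> fin_cases p' <;> fin_cases q <;> fin_cases q' <;>
    simp [sixVertexMatrix, sixVertex, auxLeft, auxRight, mul_apply, Fintype.sum_prod_type,
      Fin.sum_univ_two, Algebra.algebraMap_eq_smul_one] <;>
    first | assumption | simp only [haa, hdd, had, hda]

/-- Moving every function of `S^z` to one side of `S^±`, with its argument shifted by one, turns
each relation into a scalar `sinh` identity. -/
theorem exchangeRel_localLax (hη : sinh X.η ≠ 0) (lam mu : ℂ) :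
    ExchangeRel X.η (lam - mu) (X.localLax n lam) (X.localLax n mu) := by
  have comm : ∀ f g, X.diagSz n f * X.diagSz n g = X.diagSz n g * X.diagSz n f := fun f g => by
    rw [diagSz_mul, diagSz_mul]; exact X.diagSz_congr n fun z => mul_comm _ _
  have e := fun x => sinh_exchange (lam - mu) X.η x
  have e' := fun x => sinh_exchange' (lam - mu) X.η x
  refine ExchangeRel.of_relations (comm _ _) (comm _ _) (comm _ _) (comm _ _)
    ?_ ?_ ?_ ?_ ?_ ?_ ?_ ?_ ?_
  · simp only [diagSz_mul_sMinus, ← mul_smul_comm, ← mul_add, smul_diagSz, diagSz_add]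
    refine congrArg _ (X.diagSz_congr n fun z => ?_)
    linear_combination (norm := ring_nf) e (lam + X.η * (z - 1))
  · simp only [diagSz_mul_sMinus, ← mul_smul_comm, ← mul_add, smul_diagSz, diagSz_add]
    refine congrArg _ (X.diagSz_congr n fun z => ?_)
    linear_combination (norm := ring_nf) e' (mu + X.η * z)
  · simp only [sPlus_mul_diagSz, ← smul_mul_assoc, ← add_mul, smul_diagSz, diagSz_add]
    refine congrArg (· * _) (X.diagSz_congr n fun z => ?_)
    linear_combination (norm := ring_nf) -e (lam + X.η * (z - 1))
  · simp only [sPlus_mul_diagSz, ← smul_mul_assoc, ← add_mul, smul_diagSz, diagSz_add]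
    refine congrArg (· * _) (X.diagSz_congr n fun z => ?_)
    linear_combination (norm := ring_nf) -e' (mu + X.η * z)
  · simp only [diagSz_mul_sMinus, ← mul_smul_comm, ← mul_add, smul_diagSz, diagSz_add]
    refine congrArg _ (X.diagSz_congr n fun z => ?_)
    linear_combination (norm := ring_nf) -e' (mu - X.η * (z - 1))
  · simp only [diagSz_mul_sMinus, ← mul_smul_comm, ← mul_add, smul_diagSz, diagSz_add]
    refine congrArg _ (X.diagSz_congr n fun z => ?_)
    linear_combination (norm := ring_nf) -e (lam - X.η * z)
  · simp only [sPlus_mul_diagSz, ← smul_mul_assoc, ← add_mul, smul_diagSz, diagSz_add]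
    refine congrArg (· * _) (X.diagSz_congr n fun z => ?_)
    linear_combination (norm := ring_nf) e' (mu - X.η * (z - 1))
  · simp only [sPlus_mul_diagSz, ← smul_mul_assoc, ← add_mul, smul_diagSz, diagSz_add]
    refine congrArg (· * _) (X.diagSz_congr n fun z => ?_)
    linear_combination (norm := ring_nf) e (lam - X.η * z)
  · rw [smul_sMinus_mul_sPlus X n hη, smul_sPlus_mul_sMinus X n hη]
    simp only [diagSz_mul, diagSz_sub, smul_diagSz]
    refine X.diagSz_congr n fun z => ?_
    linear_combination (norm := ring_nf)
      sinh_casimir (lam - mu) X.η (X.η * ((X.twoS n : ℂ) / 2)) (X.η * z) mu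

theorem quantumDet_localLax (hη : sinh X.η ≠ 0) (lam : ℂ) :
    QuantumDet (sinh (lam + (X.twoS n : ℂ) / 2 * X.η) *
      sinh (lam - X.η - (X.twoS n : ℂ) / 2 * X.η))
      (X.localLax n lam) (X.localLax n (lam - X.η)) := by
  intro i j
  fin_cases i <;> fin_cases j <;> simp only [localLax, Fin.zero_eta, Fin.mk_one, of_apply,
    cons_val_zero, cons_val_one, cons_val_fin_one, Fin.isValue]
  · rw [diagSz_mul_sMinus, map_zero, sub_eq_zero]
    exact congrArg _ (X.diagSz_congr n fun z => by ring_nf)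
  · rw [smul_sMinus_mul_sPlus X n hη, diagSz_mul, diagSz_sub, ← diagSz_const]
    refine X.diagSz_congr n fun z => ?_
    linear_combination (norm := ring_nf)
      sinh_qdet X.η (X.η * ((X.twoS n : ℂ) / 2)) (X.η * z) lam
  · rw [smul_sPlus_mul_sMinus X n hη, diagSz_mul, diagSz_sub, ← diagSz_const]
    refine X.diagSz_congr n fun z => ?_
    linear_combination (norm := ring_nf)
      -sinh_qdet X.η (X.η * ((X.twoS n : ℂ) / 2)) (X.η * (-z)) lam
  · rw [sPlus_mul_diagSz, map_zero, sub_eq_zero]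
    exact congrArg (· * _) (X.diagSz_congr n fun z => by ring_nf)

end LocalRelations

end XXZChain

/-! ### Relations in the Yang–Baxter algebra of the chain -/

namespace XXZChain

section Relations

open Complex Matrix

variable {N : ℕ} (X : XXZChain N)

theorem lax_eq_map (n : Fin N) (lam : ℂ) :
    X.lax n lam = (X.localLax n lam).map (X.atSiteHom n) := by
  exact Matrix.ext fun i j => X.lax_apply n lam i j

theorem entriesCommute_partialMonodromy {k : ℕ} (hk : k < N) (lam mu : ℂ) :
    EntriesCommute (X.partialMonodromy k lam) (X.lax ⟨k, hk⟩ mu) := fun i j _ _ => by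
  rw [lax_apply]; exact X.commute_partialMonodromy hk.le lam i j le_rfl _

theorem exchangeRel_monodromy (hη : X.Generic) (lam mu : ℂ) :
    ExchangeRel X.η (lam - mu) (X.monodromy lam) (X.monodromy mu) := by
  have : ∀ k ≤ N, ExchangeRel X.η (lam - mu) (X.partialMonodromy k lam)
      (X.partialMonodromy k mu) := by
    intro k hk
    induction k with
    | zero => rw [partialMonodromy_zero, partialMonodromy_zero]; exact ExchangeRel.one _ _
    | succ k ih =>
      rw [partialMonodromy_succ X hk, partialMonodromy_succ X hk]
      refine ExchangeRel.mul ?_ (ih (by omega)) (X.entriesCommute_partialMonodromy hk _ _)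
        fun i j l m => (X.entriesCommute_partialMonodromy hk _ _ l m i j).symm
      rw [lax_eq_map, lax_eq_map]
      have := (X.exchangeRel_localLax ⟨k, hk⟩ hη.sinh_ne_zero (lam - X.ξ ⟨k, hk⟩)
        (mu - X.ξ ⟨k, hk⟩)).map (X.atSiteHom ⟨k, hk⟩)
      rwa [sub_sub_sub_cancel_right] at this
  rw [← partialMonodromy_self, ← partialMonodromy_self]
  exact this N le_rfl

theorem quantumDet_monodromy (hη : X.Generic) (lam : ℂ) :
    QuantumDet (X.a lam * X.d (lam - X.η)) (X.monodromy lam) (X.monodromy (lam - X.η)) := by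
  set δ : ℕ → ℂ := fun k => if hk : k < N then
    sinh (lam - X.shift ⟨k, hk⟩ (X.twoS ⟨k, hk⟩)) * sinh (lam - X.η - X.shift ⟨k, hk⟩ 0) else 1
    with hδ
  have : ∀ k ≤ N, QuantumDet (∏ i ∈ Finset.range k, δ i) (X.partialMonodromy k lam)
      (X.partialMonodromy k (lam - X.η)) := by
    intro k hk
    induction k with
    | zero => rw [partialMonodromy_zero, partialMonodromy_zero]; exact QuantumDet.one
    | succ k ih =>
      rw [partialMonodromy_succ X hk, partialMonodromy_succ X hk, Finset.prod_range_succ, mul_comm]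
      refine QuantumDet.mul ?_ (ih (by omega)) (X.entriesCommute_partialMonodromy hk _ _)
      rw [lax_eq_map, lax_eq_map]
      have := (X.quantumDet_localLax ⟨k, hk⟩ hη.sinh_ne_zero (lam - X.ξ ⟨k, hk⟩)).map
        (X.atSiteHom ⟨k, hk⟩)
      simp only [hδ, dif_pos (Nat.lt_of_succ_le hk)]
      convert this using 2
      · simp only [shift]; ring_nf
      · simp only [shift]; push_cast; ring_nf
      · rw [sub_right_comm]
  have h := this N le_rfl
  rw [partialMonodromy_self, partialMonodromy_self, Finset.prod_range] at h
  simpa [hδ, a, d_eq, Finset.prod_mul_distrib] using h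

theorem commute_C (hη : X.Generic) (lam mu : ℂ) :
    Commute (X.monodromy lam 1 0) (X.monodromy mu 1 0) := by
  by_cases h : sinh (lam - mu + X.η) = 0
  · by_cases h' : sinh (mu - lam + X.η) = 0
    · exfalso
      -- The exchange relation is usable in at least one order of the two parameters: failure in
      -- both would force `sinh (2η) = 0`.
      have h2 := hη.sinh_nat_mul_ne_zero two_ne_zero
      refine h2 ?_
      have : ((2 : ℕ) : ℂ) * X.η = (lam - mu + X.η) + (mu - lam + X.η) := by push_cast; ring
      rw [this, sinh_add, h, h']; ring
    · exact ((X.exchangeRel_monodromy hη mu lam).lower_comm h').symm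
  · exact (X.exchangeRel_monodromy hη lam mu).lower_comm h

/-! ### Simultaneous eigencovectors of the operators `D` -/

/-- `ψ` is an eigencovector of all `D(λ)`, with eigenvalues `χ λ`. -/
def IsEigenD (χ : ℂ → ℂ) (ψ : X.Idx → ℂ) : Prop :=
  ∀ lam, ψ ᵥ* X.monodromy lam 1 1 = χ lam • ψ

variable {X}

theorem continuous_vecMul_monodromy (ψ : X.Idx → ℂ) (i j : Fin 2) (h : X.Idx) :
    Continuous fun lam => (ψ ᵥ* X.monodromy lam i j) h := by
  simp only [vecMul, dotProduct]
  exact continuous_finsetSum _ fun k _ =>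
    continuous_const.mul (X.monodromy_order i j k h).differentiable.continuous

theorem eq_of_sinh_smul_eq {f g : ℂ → X.Idx → ℂ} {x : ℂ} (hf : ∀ h, Continuous fun z => f z h)
    (hg : ∀ h, Continuous fun z => g z h)
    (H : ∀ z, sinh (z - x) • f z = sinh (z - x) • g z) (z : ℂ) : f z = g z := by
  have hd : Differentiable ℂ fun z => sinh (z - x) := (IsExpPoly.sinh_sub x).order.differentiable
  funext h
  refine eq_of_mul_eq_mul_of_differentiable hd (hf h) (hg h) ?_ (fun w hw => ?_) z
  · obtain ⟨z, hz⟩ := exists_forall_sinh_sub_ne_zero fun _ : Unit => x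
    exact ⟨z, hz ()⟩
  · exact mul_left_cancel₀ hw (congrFun (H w) h)

/-- At a zero `x` of the eigenvalue the unwanted exchange term contains `ψ D(x) = 0`. The action of
`C(x)` then only moves that zero to `x - η`. -/
theorem IsEigenD.raise (hη : X.Generic) {ψ : X.Idx → ℂ} {ρ : ℂ → ℂ} {x : ℂ} (hρ : Continuous ρ)
    (h : X.IsEigenD (fun z => sinh (z - x) * ρ z) ψ) :
    X.IsEigenD (fun z => sinh (z - x + X.η) * ρ z) (ψ ᵥ* X.monodromy x 1 0) := by
  refine eq_of_sinh_smul_eq (x := x) (fun i => continuous_vecMul_monodromy _ _ _ _)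
    (fun i => ?_) fun z => ?_
  · simp only [Pi.smul_apply, smul_eq_mul]
    exact ((continuous_sinh.comp (by fun_prop)).mul hρ).mul continuous_const
  · have h1 := congrArg (ψ ᵥ* ·) (X.exchangeRel_monodromy hη z x).lower_diag
    have hx := h x
    simp only [sub_self, sinh_zero, zero_mul, zero_smul] at hx
    simp only [vecMul_smul, vecMul_sub, ← vecMul_vecMul, h z, hx, zero_vecMul, smul_zero, sub_zero,
      smul_vecMul] at h1
    rw [h1, smul_smul, smul_smul]
    congr 1; ring

theorem IsEigenD.lower (hη : X.Generic) {ψ : X.Idx → ℂ} {ρ : ℂ → ℂ} {x : ℂ} (hρ : Continuous ρ)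
    (h : X.IsEigenD (fun z => sinh (z - x) * ρ z) ψ) :
    X.IsEigenD (fun z => sinh (z - x - X.η) * ρ z) (ψ ᵥ* X.monodromy x 0 1) := by
  refine eq_of_sinh_smul_eq (x := x) (fun i => continuous_vecMul_monodromy _ _ _ _)
    (fun i => ?_) fun z => ?_
  · simp only [Pi.smul_apply, smul_eq_mul]
    exact ((continuous_sinh.comp (by fun_prop)).mul hρ).mul continuous_const
  · have h1 := congrArg (ψ ᵥ* ·) (X.exchangeRel_monodromy hη x z).upper_diag
    have hx := h x
    simp only [sub_self, sinh_zero, zero_mul, zero_smul] at hx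
    simp only [vecMul_smul, vecMul_sub, ← vecMul_vecMul, h z, hx, zero_vecMul, smul_zero, sub_zero,
      smul_vecMul] at h1
    have e1 : sinh (z - x) = -sinh (x - z) := by rw [← sinh_neg, neg_sub]
    have e2 : sinh (z - x - X.η) = -sinh (x - z + X.η) := by rw [← sinh_neg]; ring_nf
    rw [e1] at h1
    simp only [e1, e2]
    rw [neg_smul, h1, smul_smul, smul_smul, ← neg_smul]
    congr 1; ring

/-- The quantum determinant contains `C(x) B(x-η)` and `D(x) A(x-η)`; the second product annihilates
`ψ`. -/
theorem IsEigenD.raise_lower (hη : X.Generic) {ψ : X.Idx → ℂ} {χ : ℂ → ℂ} {x : ℂ} (hx : χ x = 0)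
    (h : X.IsEigenD χ ψ) :
    ψ ᵥ* X.monodromy x 1 0 ᵥ* X.monodromy (x - X.η) 0 1 = -(X.a x * X.d (x - X.η)) • ψ := by
  have h1 := congrArg (ψ ᵥ* ·) (X.quantumDet_monodromy hη x 1 0)
  have h2 := h x
  rw [hx, zero_smul] at h2
  simp only [vecMul_sub, ← vecMul_vecMul, h2, zero_vecMul, sub_zero] at h1
  rw [h1]
  simp [Algebra.algebraMap_eq_smul_one, vecMul_neg, vecMul_smul]

theorem linearIndependent_of_simultaneous {V ι κ : Type*} [AddCommGroup V] [Module ℂ V]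
    (T : κ → V →ₗ[ℂ] V) {e : ι → V} {χ : ι → κ → ℂ} (he : ∀ i k, T k (e i) = χ i k • e i)
    (hχ : Function.Injective χ) (h0 : ∀ i, e i ≠ 0) : LinearIndependent ℂ e := by
  classical
  rw [linearIndependent_iff']
  intro s
  induction s using Finset.induction_on with
  | empty => simp
  | insert j s hj ih =>
    intro c hc
    have hs : ∀ i ∈ s, c i = 0 := by
      intro i hi
      obtain ⟨k, hk⟩ := Function.ne_iff.mp (hχ.ne (a₁ := i) (a₂ := j) fun h => hj (h ▸ hi))
      have h1 : ∑ l ∈ insert j s, (c l * (χ l k - χ j k)) • e l = 0 := by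
        calc _ = T k (∑ l ∈ insert j s, c l • e l) - χ j k • ∑ l ∈ insert j s, c l • e l := by
              rw [map_sum, Finset.smul_sum, ← Finset.sum_sub_distrib]
              refine Finset.sum_congr rfl fun l _ => ?_
              rw [map_smul, he]; module
          _ = 0 := by rw [hc, map_zero, smul_zero, sub_zero]
      rw [Finset.sum_insert hj, sub_self, mul_zero, zero_smul, zero_add] at h1
      exact (mul_eq_zero.mp (ih _ h1 i hi)).resolve_right (sub_ne_zero.mpr hk)
    rw [Finset.sum_insert hj, Finset.sum_eq_zero fun i hi => by rw [hs i hi, zero_smul],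
      add_zero] at hc
    intro i hi
    rcases Finset.mem_insert.mp hi with rfl | hi
    · exact (smul_eq_zero.mp hc).resolve_right (h0 _)
    · exact hs i hi

theorem IsEigenD.linearIndependent {ι : Type*} {e : ι → X.Idx → ℂ} {χ : ι → ℂ → ℂ}
    (he : ∀ i, X.IsEigenD (χ i) (e i)) (hχ : Function.Injective χ) (h0 : ∀ i, e i ≠ 0) :
    LinearIndependent ℂ e :=
  linearIndependent_of_simultaneous (fun lam => (X.monodromy lam 1 1).vecMulLinear)
    (fun i lam => he i lam) hχ h0

-- A product over all sites is independent of the order only because the factors commute. It is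
-- formed in the commutative subalgebra they generate.
open scoped IsMulCommutative in
theorem exists_prod_of_commute {R ι : Type*} [Ring R] [Algebra ℂ R] [Fintype ι] [DecidableEq ι]
    (c : ι → ℕ → R) (hc : ∀ i k j l, Commute (c i k) (c j l)) :
    ∃ F : (ι → ℕ) → R, F 0 = 1 ∧ ∀ h i, F (h + Pi.single i 1) = F h * c i (h i) := by
  have hcomm : ∀ x ∈ Set.range (Function.uncurry c), ∀ y ∈ Set.range (Function.uncurry c),
      x * y = y * x := by
    rintro _ ⟨⟨i, k⟩, rfl⟩ _ ⟨⟨j, l⟩, rfl⟩; exact hc i k j l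
  have := Algebra.isMulCommutative_adjoin ℂ hcomm
  let c' : ι → ℕ → Algebra.adjoin ℂ (Set.range (Function.uncurry c)) := fun i k =>
    ⟨c i k, Algebra.subset_adjoin ⟨(i, k), rfl⟩⟩
  refine ⟨fun h => ((∏ i, ∏ k ∈ Finset.range (h i), c' i k :
    Algebra.adjoin ℂ (Set.range (Function.uncurry c))) : R), by simp, fun h i => ?_⟩
  have key : ∏ j, ∏ k ∈ Finset.range ((h + Pi.single i 1 : ι → ℕ) j), c' j k =
      (∏ j, ∏ k ∈ Finset.range (h j), c' j k) * c' i (h i) := by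
    rw [← Finset.prod_erase_mul _ _ (Finset.mem_univ i),
      ← Finset.prod_erase_mul (a := i) _ (fun j => ∏ k ∈ Finset.range (h j), c' j k)
        (Finset.mem_univ i), mul_assoc]
    congr 1
    · refine Finset.prod_congr rfl fun j hj => ?_
      simp [Finset.ne_of_mem_erase hj]
    · simp [Finset.prod_range_succ]
  exact congrArg Subtype.val key

end Relations

end XXZChain

/-! ### Separation of variables -/

namespace XXZChain

section Sov

open Complex Matrix

variable {N : ℕ} {X : XXZChain N}

theorem prodCov_update_smul (φ : ∀ n, X.LocalIdx n → ℂ) (n : Fin N) (c : ℂ) (ψ : X.LocalIdx n → ℂ) :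
    X.prodCov (Function.update φ n (c • ψ)) = c • X.prodCov (Function.update φ n ψ) := by
  funext h
  simp only [prodCov, Pi.smul_apply, smul_eq_mul]
  rw [← Finset.mul_prod_erase _ _ (Finset.mem_univ n),
    ← Finset.mul_prod_erase _ (fun m => Function.update φ n ψ m (h m)) (Finset.mem_univ n),
    Function.update_self, Function.update_self, Pi.smul_apply, smul_eq_mul, mul_assoc]
  congr 2
  refine Finset.prod_congr rfl fun m hm => ?_
  rw [Function.update_of_ne (Finset.ne_of_mem_erase hm),
    Function.update_of_ne (Finset.ne_of_mem_erase hm)]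

variable (X) in
/-- The reference covector `⟨0, …, 0|`. -/
noncomputable def refCov : X.Idx → ℂ := X.prodCov fun _ => Pi.single 0 1

theorem refCov_eq : X.refCov = Pi.single 0 1 := by
  funext k
  rcases eq_or_ne k 0 with rfl | hk
  · simp [refCov, prodCov]
  · obtain ⟨n, hn⟩ := Function.ne_iff.mp hk
    rw [Pi.single_eq_of_ne hk]
    exact Finset.prod_eq_zero (Finset.mem_univ n) (Pi.single_eq_of_ne hn _)

theorem refCov_vecMul_atSite {n : Fin N} {A : Matrix (X.LocalIdx n) (X.LocalIdx n) ℂ} {c : ℂ}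
    (h : A 0 = c • Pi.single 0 1) : X.refCov ᵥ* X.atSite n A = c • X.refCov := by
  have h' : (Pi.single 0 1 : X.LocalIdx n → ℂ) ᵥ* A = c • Pi.single 0 1 := by
    rw [single_one_vecMul]; exact h
  rw [refCov, prodCov_vecMul_atSite, h', prodCov_update_smul, Function.update_eq_self]

theorem refCov_vecMul_lax (n : Fin N) (lam : ℂ) :
    X.refCov ᵥ* X.lax n lam 0 1 = 0 ∧
      X.refCov ᵥ* X.lax n lam 1 1 = sinh (lam - (X.twoS n : ℂ) / 2 * X.η) • X.refCov := by
  rw [lax_apply, lax_apply]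
  constructor
  · rw [← zero_smul ℂ X.refCov]
    refine refCov_vecMul_atSite ?_
    funext k
    simp [localLax, sMinus]
  · refine refCov_vecMul_atSite ?_
    funext k
    simp only [localLax, diagSz, of_apply, cons_val_one, cons_val_fin_one, diagonal_apply,
      Pi.smul_apply, smul_eq_mul, Pi.single_apply, eq_comm (a := (0 : X.LocalIdx n)) (b := k)]
    split_ifs
    · simp [mul_comm]
    · simp

/-- The reference covector annihilates the upper right Lax entry at each site, so the monodromy acts
triangularly and the local eigenvalues of `D` multiply. -/
theorem isEigenD_refCov : X.IsEigenD (fun z => ∏ n, sinh (z - X.shift n 0)) X.refCov := by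
  intro lam
  set δ : ℕ → ℂ := fun k => if hk : k < N then sinh (lam - X.shift ⟨k, hk⟩ 0) else 1 with hδ
  have : ∀ k ≤ N, X.refCov ᵥ* X.partialMonodromy k lam 0 1 = 0 ∧
      X.refCov ᵥ* X.partialMonodromy k lam 1 1 = (∏ i ∈ Finset.range k, δ i) • X.refCov := by
    intro k hk
    induction k with
    | zero => simp [partialMonodromy_zero]
    | succ k ih =>
      obtain ⟨ih1, ih2⟩ := ih (by omega)
      have hc := X.entriesCommute_partialMonodromy (Nat.lt_of_succ_le hk) lam
        (lam - X.ξ ⟨k, hk⟩)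
      obtain ⟨h1, h2⟩ := refCov_vecMul_lax (X := X) ⟨k, hk⟩ (lam - X.ξ ⟨k, hk⟩)
      rw [partialMonodromy_succ X hk, mul_apply, mul_apply, Fin.sum_univ_two, Fin.sum_univ_two]
      constructor
      · rw [vecMul_add, ← (hc 0 1 0 0).eq, ← vecMul_vecMul, ← vecMul_vecMul, ih1, h1, zero_vecMul,
          zero_vecMul, add_zero]
      · rw [vecMul_add, ← (hc 0 1 1 0).eq, ← vecMul_vecMul, ← vecMul_vecMul, ih1, h2, zero_vecMul,
          zero_add, smul_vecMul, ih2, smul_smul, Finset.prod_range_succ, mul_comm]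
        simp only [hδ, dif_pos (Nat.lt_of_succ_le hk), shift_zero, sub_sub]
  have h := (this N le_rfl).2
  rw [partialMonodromy_self, Finset.prod_range] at h
  simpa [hδ] using h

variable (X) in
/-- A family of covectors `⟨h|` that is built from the reference covector by acting with the
operators `C(ξ_n^{(k)})`. -/
structure IsSovFamily (κ : ℂ) (S : (Fin N → ℕ) → X.Idx → ℂ) : Prop where
  zero : S 0 = X.refCov
  -- Where `h n = 2s_n` the denominator is zero, and division by zero makes the covector beyond the
  -- end of the string vanish.
  succ : ∀ h n, S (h + Pi.single n 1) =
    (-κ / X.a (X.shift n (h n))) • S h ᵥ* X.monodromy (X.shift n (h n)) 1 0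

theorem exists_isSovFamily (hη : X.Generic) (κ : ℂ) : ∃ S, X.IsSovFamily κ S := by
  obtain ⟨F, hF0, hF⟩ := exists_prod_of_commute
    (fun n k => (-κ / X.a (X.shift n k)) • X.monodromy (X.shift n k) 1 0)
    fun n k m l => ((X.commute_C hη _ _).smul_left _).smul_right _
  refine ⟨fun h => X.refCov ᵥ* F h, by simp [hF0], fun h n => ?_⟩
  simp only [hF]
  rw [← vecMul_vecMul, vecMul_smul]

variable (X) in
/-- The eigenvalue of `D(λ)` on `⟨h|`. -/
noncomputable def eigD (h : Fin N → ℕ) (z : ℂ) : ℂ := ∏ n, sinh (z - X.shift n (h n))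

theorem eigD_eq (h : Fin N → ℕ) (n : Fin N) (z : ℂ) : X.eigD h z =
    sinh (z - X.shift n (h n)) * ∏ m ∈ Finset.univ.erase n, sinh (z - X.shift m (h m)) :=
  (Finset.mul_prod_erase _ _ (Finset.mem_univ n)).symm

theorem eigD_shift (h : Fin N → ℕ) (n : Fin N) : X.eigD h (X.shift n (h n)) = 0 := by
  rw [eigD_eq h n]; simp

theorem continuous_prod_erase (h : Fin N → ℕ) (n : Fin N) :
    Continuous fun z => ∏ m ∈ Finset.univ.erase n, sinh (z - X.shift m (h m)) :=
  (ExpPolyOrder.prod _ fun m _ => (IsExpPoly.sinh_sub (X.shift m (h m))).order).differentiable.continuous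

theorem pi_induction {ι : Type*} [Fintype ι] [DecidableEq ι] {P : (ι → ℕ) → Prop} (h0 : P 0)
    (hs : ∀ h i, P h → P (h + Pi.single i 1)) (h : ι → ℕ) : P h := by
  have : ∀ k, ∀ h : ι → ℕ, ∑ i, h i = k → P h := by
    intro k
    induction k with
    | zero =>
      intro h hh
      have : h = 0 := funext fun i => by
        simpa using (Finset.sum_eq_zero_iff.mp hh) i (Finset.mem_univ i)
      rwa [this]
    | succ k ih =>
      intro h hh
      obtain ⟨i, -, hi⟩ : ∃ i ∈ Finset.univ, h i ≠ 0 :=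
        Finset.exists_ne_zero_of_sum_ne_zero (by omega)
      have e : h = (h - Pi.single i 1) + Pi.single i 1 := by
        funext j
        rcases eq_or_ne j i with rfl | hj
        · simp; omega
        · simp [hj]
      rw [e]
      refine hs _ _ (ih _ ?_)
      have h2 := hh
      rw [e] at h2
      simp only [Pi.add_apply, Finset.sum_add_distrib, Finset.sum_pi_single', Finset.mem_univ,
        if_true] at h2
      simpa using h2
  exact this _ h rfl

variable {κ : ℂ} {S : (Fin N → ℕ) → X.Idx → ℂ}

theorem IsSovFamily.isEigenD (hS : X.IsSovFamily κ S) (hη : X.Generic) (h : Fin N → ℕ) :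
    X.IsEigenD (X.eigD h) (S h) := by
  induction h using pi_induction with
  | h0 => rw [hS.zero]; exact isEigenD_refCov
  | hs h n ih =>
    rw [funext (eigD_eq h n)] at ih
    have h1 := IsEigenD.raise hη (continuous_prod_erase h n) ih
    intro lam
    rw [hS.succ, smul_vecMul, h1 lam, smul_comm, eigD_eq _ n]
    have h2 : ∏ m ∈ Finset.univ.erase n, sinh (lam - X.shift m ((h + Pi.single n 1 : Fin N → ℕ) m)) =
        ∏ m ∈ Finset.univ.erase n, sinh (lam - X.shift m (h m)) :=
      Finset.prod_congr rfl fun m hm => by simp [Finset.ne_of_mem_erase hm]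
    rw [h2]
    simp only [Pi.add_apply, Pi.single_eq_same, shift_succ]
    ring_nf

theorem IsSovFamily.succ_lower (hS : X.IsSovFamily κ S) (hη : X.Generic)
    (hξ : X.InhomogeneityCondition) (h : Fin N → ℕ) (n : Fin N) (hn : h n < X.twoS n) :
    S (h + Pi.single n 1) ᵥ* X.monodromy (X.shift n (h n + 1)) 0 1 =
      (κ * X.d (X.shift n (h n + 1))) • S h := by
  have ha := X.a_shift_ne_zero hη hξ hn
  rw [hS.succ, smul_vecMul, shift_succ, (hS.isEigenD hη h).raise_lower hη (eigD_shift h n),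
    smul_smul]
  congr 1; field_simp

/-- Lowering by `B` returns a nonzero multiple of the preceding covector, so nonvanishing propagates
from the reference covector. -/
theorem IsSovFamily.ne_zero (hS : X.IsSovFamily κ S) (hη : X.Generic)
    (hξ : X.InhomogeneityCondition) (hκ : κ ≠ 0) (h : Fin N → ℕ) (hh : ∀ n, h n ≤ X.twoS n) :
    S h ≠ 0 := by
  induction h using pi_induction with
  | h0 => rw [hS.zero, refCov_eq]; simp
  | hs h n ih =>
    have hn : h n < X.twoS n := by have := hh n; simp at this; omega
    have hh' : ∀ m, h m ≤ X.twoS m := fun m => (Nat.le_add_right _ _).trans (hh m)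
    intro h0
    have h1 := hS.succ_lower hη hξ h n hn
    rw [h0, zero_vecMul, eq_comm, smul_eq_zero] at h1
    rcases h1 with h1 | h1
    · exact mul_ne_zero hκ (X.d_shift_ne_zero hη hξ (Nat.succ_ne_zero _) hn) h1
    · exact ih hh' h1

theorem eigD_ne_zero (hη : X.Generic) (hξ : X.InhomogeneityCondition) {h : Fin N → ℕ}
    (hh : ∀ n, h n ≤ X.twoS n) {n : Fin N} {k : ℕ} (hk : k ≤ X.twoS n) (hne : h n ≠ k) :
    X.eigD h (X.shift n k) ≠ 0 := by
  refine Finset.prod_ne_zero_iff.mpr fun m _ => sinh_shift_sub_shift_ne_zero hη hξ hk (hh m) ?_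
  by_contra! hcon
  obtain ⟨rfl, hcon⟩ := hcon
  exact hne hcon.symm

variable (X) in
/-- The index of a basis vector as a function with natural values. -/
def idxNat (h : X.Idx) : Fin N → ℕ := fun n => h n

theorem idxNat_le (h : X.Idx) (n : Fin N) : X.idxNat h n ≤ X.twoS n := Nat.le_of_lt_succ (h n).2

theorem eigD_injective (hη : X.Generic) (hξ : X.InhomogeneityCondition) :
    Function.Injective fun h : X.Idx => X.eigD (X.idxNat h) := by
  intro h h' he
  by_contra hne
  obtain ⟨n, hn⟩ := Function.ne_iff.mp hne
  refine eigD_ne_zero hη hξ (idxNat_le h) (idxNat_le h' n) (n := n)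
    (fun hc => hn (Fin.ext hc)) ?_
  have := congrFun he (X.shift n (X.idxNat h' n))
  simp only at this
  rw [this, eigD_shift]

theorem IsSovFamily.linearIndependent (hS : X.IsSovFamily κ S) (hη : X.Generic)
    (hξ : X.InhomogeneityCondition) (hκ : κ ≠ 0) :
    LinearIndependent ℂ fun h : X.Idx => S (X.idxNat h) :=
  IsEigenD.linearIndependent (fun h => hS.isEigenD hη (X.idxNat h)) (eigD_injective hη hξ)
    fun h => hS.ne_zero hη hξ hκ _ (idxNat_le h)

/-- A simultaneous eigencovector of the `D(λ)` with an eigenvalue not of the form `eigD h`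
vanishes. -/
theorem IsSovFamily.eq_zero_of_isEigenD (hS : X.IsSovFamily κ S) (hη : X.Generic)
    (hξ : X.InhomogeneityCondition) (hκ : κ ≠ 0) {χ : ℂ → ℂ} {ψ : X.Idx → ℂ} (hψ : X.IsEigenD χ ψ)
    (hχ : ∀ h : X.Idx, χ ≠ X.eigD (X.idxNat h)) : ψ = 0 := by
  by_contra h0
  have hli : LinearIndependent ℂ fun o : Option X.Idx => o.elim ψ fun h => S (X.idxNat h) := by
    refine IsEigenD.linearIndependent (χ := fun o => o.elim χ fun h => X.eigD (X.idxNat h))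
      ?_ ?_ ?_
    · rintro (_ | h)
      · exact hψ
      · exact hS.isEigenD hη _
    · rintro (_ | h) (_ | h') he
      · rfl
      · exact absurd he (hχ h')
      · exact absurd he.symm (hχ h)
      · exact congrArg some (eigD_injective hη hξ he)
    · rintro (_ | h)
      · exact h0
      · exact hS.ne_zero hη hξ hκ _ (idxNat_le h)
  have := hli.fintype_card_le_finrank
  rw [Fintype.card_option, Module.finrank_fintype_fun_eq_card] at this
  omega

/-- A `D`-eigenvalue with no zero on the string of site `n` is not among the `eigD h`, which already
exhaust the dimension. This kills covectors pushed past either end of a string. -/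
theorem IsSovFamily.eq_zero_of_shifted (hS : X.IsSovFamily κ S) (hη : X.Generic)
    (hξ : X.InhomogeneityCondition) (hκ : κ ≠ 0) {h : Fin N → ℕ} (hh : ∀ n, h n ≤ X.twoS n)
    {n : Fin N} {f : ℂ → ℂ} (hf : ∀ k ≤ X.twoS n, f (X.shift n k) ≠ 0) {ψ : X.Idx → ℂ}
    (hψ : X.IsEigenD (fun z => f z * ∏ m ∈ Finset.univ.erase n, sinh (z - X.shift m (h m))) ψ) :
    ψ = 0 := by
  refine hS.eq_zero_of_isEigenD hη hξ hκ hψ fun h' he => ?_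
  have h1 := congrFun he (X.shift n (X.idxNat h' n))
  rw [eigD_shift] at h1
  refine mul_ne_zero (hf _ (idxNat_le h' n)) (Finset.prod_ne_zero_iff.mpr fun m hm => ?_) h1
  exact sinh_shift_sub_shift_ne_zero hη hξ (idxNat_le h' n) (hh m)
    (Or.inl (Finset.ne_of_mem_erase hm).symm)

/-- The action of the transfer matrix on the covectors `⟨h|`. -/
theorem IsSovFamily.vecMul_transfer (hS : X.IsSovFamily κ S) (hη : X.Generic)
    (hξ : X.InhomogeneityCondition) (hκ : κ ≠ 0) {h : Fin N → ℕ} (hh : ∀ n, h n ≤ X.twoS n)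
    (n : Fin N) :
    S h ᵥ* X.transfer κ (X.shift n (h n)) = X.d (X.shift n (h n)) • S (h - Pi.single n 1) -
      X.a (X.shift n (h n)) • S (h + Pi.single n 1) := by
  have hE := hS.isEigenD hη h
  rw [funext (eigD_eq h n)] at hE
  have hB : κ⁻¹ • S h ᵥ* X.monodromy (X.shift n (h n)) 0 1 =
      X.d (X.shift n (h n)) • S (h - Pi.single n 1) := by
    rcases Nat.eq_zero_or_pos (h n) with h0 | hpos
    -- At the top of the string, `B` would move the zero to `ξ_n^{(0)} + η`, outside the string.
    · rw [hS.eq_zero_of_shifted hη hξ hκ hh (fun k _ => ?_)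
        (IsEigenD.lower hη (continuous_prod_erase h n) hE), h0, d_shift_zero, zero_smul, smul_zero]
      rw [h0, show X.shift n k - X.shift n 0 - X.η = -(((k + 1 : ℕ) : ℂ) * X.η) by
        simp only [shift]; push_cast; ring, sinh_neg, neg_ne_zero]
      exact hη.sinh_nat_mul_ne_zero (Nat.succ_ne_zero k)
    · have e : h = (h - Pi.single n 1) + Pi.single n 1 := by
        funext j
        rcases eq_or_ne j n with rfl | hj
        · simp; omega
        · simp [hj]
      have e1 : h n = (h - Pi.single n 1 : Fin N → ℕ) n + 1 := by simp; omega
      have hlt : (h - Pi.single n 1 : Fin N → ℕ) n < X.twoS n := by have := hh n; omega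
      have h1 := hS.succ_lower hη hξ (h - Pi.single n 1 : Fin N → ℕ) n hlt
      rw [← e1, ← e] at h1
      rw [h1, smul_smul]
      congr 1; field_simp
  have hC : κ • S h ᵥ* X.monodromy (X.shift n (h n)) 1 0 =
      -(X.a (X.shift n (h n)) • S (h + Pi.single n 1)) := by
    rcases (hh n).lt_or_eq with hlt | heq
    · have ha := X.a_shift_ne_zero hη hξ hlt
      rw [hS.succ, smul_smul, ← neg_smul]
      congr 1; field_simp
    · rw [hS.eq_zero_of_shifted hη hξ hκ hh (fun k hk => ?_)
        (IsEigenD.raise hη (continuous_prod_erase h n) hE), heq, a_shift_last, zero_smul, smul_zero,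
        neg_zero]
      rw [heq, show X.shift n k - X.shift n (X.twoS n) + X.η =
        X.shift n k - X.shift n (X.twoS n + 1) by rw [shift_succ]; ring]
      exact hη.sinh_shift_sub_ne_zero n (by omega)
  rw [transfer, vecMul_add, vecMul_smul, vecMul_smul, hB, hC, sub_eq_add_neg]

theorem IsSovFamily.isUnit (hS : X.IsSovFamily κ S) (hη : X.Generic)
    (hξ : X.InhomogeneityCondition) (hκ : κ ≠ 0) :
    IsUnit (Matrix.of fun h : X.Idx => S (X.idxNat h)) :=
  Matrix.linearIndependent_rows_iff_isUnit.mp (hS.linearIndependent hη hξ hκ)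

theorem IsSovFamily.eq_zero_of_dotProduct (hS : X.IsSovFamily κ S) (hη : X.Generic)
    (hξ : X.InhomogeneityCondition) (hκ : κ ≠ 0) {v : X.Idx → ℂ}
    (hv : ∀ h : X.Idx, S (X.idxNat h) ⬝ᵥ v = 0) : v = 0 := by
  refine Matrix.mulVec_injective_of_isUnit (hS.isUnit hη hξ hκ) ?_
  rw [mulVec_zero]
  exact funext hv

/-- An eigenvector of the transfer matrices has a non-vanishing component along the reference
state. -/
theorem eigenvector_apply_zero_ne_zero (hη : X.Generic) (hξ : X.InhomogeneityCondition)
    (hκ : κ ≠ 0) {t : ℂ → ℂ} {v : X.Idx → ℂ} (hv : v ≠ 0)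
    (H : ∀ lam, X.transfer κ lam *ᵥ v = t lam • v) : v 0 ≠ 0 := by
  obtain ⟨S, hS⟩ := exists_isSovFamily hη κ
  intro h0
  refine hv (hS.eq_zero_of_dotProduct hη hξ hκ fun h => ?_)
  -- The separated recursion expresses each component of `v` through ones of smaller total index, so
  -- a vanishing reference component would kill them all.
  have : ∀ k, ∀ h : Fin N → ℕ, (∀ n, h n ≤ X.twoS n) → ∑ n, h n = k → S h ⬝ᵥ v = 0 := by
    intro k
    induction k using Nat.strong_induction_on with
    | _ k ih =>
      intro h hh hk
      by_cases hz : h = 0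
      · rw [hz, hS.zero, refCov_eq, single_one_dotProduct, h0]
      · obtain ⟨n, hn⟩ := Function.ne_iff.mp hz
        have hn' : h n ≠ 0 := hn
        have hsub : ∀ g : Fin N → ℕ, ∑ m, (g - Pi.single n 1 : Fin N → ℕ) m ≤ ∑ m, g m := fun g =>
          Finset.sum_le_sum fun m _ => Nat.sub_le _ _
        set g := h - Pi.single n 1 with hg
        have e : g + Pi.single n 1 = h := by
          funext j
          rcases eq_or_ne j n with rfl | hj
          · simp [hg]; omega
          · simp [hg, hj]
        have hgk : ∑ m, g m < k := by
          have := hk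
          rw [← e] at this
          simp only [Pi.add_apply, Finset.sum_add_distrib, Finset.sum_pi_single', Finset.mem_univ,
            if_true] at this
          have h2 : ∑ m, (Pi.single n 1 : Fin N → ℕ) m = 1 := by simp
          omega
        have hgle : ∀ m, g m ≤ X.twoS m := fun m => (Nat.sub_le _ _).trans (hh m)
        have hgn : g n < X.twoS n := by
          have := hh n; simp [hg]; omega
        have h1 := hS.vecMul_transfer hη hξ hκ hgle n
        have h2 := congrArg (· ⬝ᵥ v) h1
        simp only [← dotProduct_mulVec, H, dotProduct_smul, sub_dotProduct, smul_dotProduct] at h2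
        rw [ih _ hgk g hgle rfl, ih _ ((hsub g).trans_lt hgk) (g - Pi.single n 1)
          (fun m => (Nat.sub_le _ _).trans (hgle m)) rfl, e, smul_zero, smul_zero, zero_sub,
          eq_comm, neg_eq_zero, smul_eq_zero] at h2
        exact h2.resolve_left (X.a_shift_ne_zero hη hξ hgn)
  exact this _ _ (idxNat_le h) rfl

/-- Solutions of the discrete Baxter equations give eigenvalues of the transfer matrices. -/
theorem mem_spectrumFun_of_isStringSolution (hη : X.Generic) (hξ : X.InhomogeneityCondition)
    (hκ : κ ≠ 0) {t : ℂ → ℂ} (ht : ExpPolyOrder (2 * N) t) (htp : OddParity N t)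
    {q : Fin N → ℕ → ℂ} (hq : ∀ n, X.IsStringSolution t n (q n)) (hq0 : ∀ n, q n 0 ≠ 0) :
    t ∈ X.spectrumFun κ := by
  obtain ⟨S, hS⟩ := exists_isSovFamily hη κ
  have hunit := hS.isUnit hη hξ hκ
  obtain ⟨v, hv⟩ : ∃ v, (Matrix.of fun h : X.Idx => S (X.idxNat h)) *ᵥ v =
      fun h => ∏ n, q n (X.idxNat h n) :=
    Matrix.mulVec_surjective_iff_isUnit.mpr hunit _
  have hv' : ∀ h : Fin N → ℕ, (∀ n, h n ≤ X.twoS n) → S h ⬝ᵥ v = ∏ n, q n (h n) := fun h hh =>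
    congrFun hv fun n => ⟨h n, Nat.lt_succ_of_le (hh n)⟩
  refine ⟨v, ?_, fun lam => ?_⟩
  · rintro rfl
    have := hv' 0 fun _ => Nat.zero_le _
    rw [dotProduct_zero, eq_comm] at this
    exact Finset.prod_ne_zero_iff.mpr (fun n _ => hq0 n) this
  · refine sub_eq_zero.mp (hS.eq_zero_of_dotProduct hη hξ hκ fun h => ?_)
    -- For fixed `h` the eigenvalue equation paired with `⟨h|` has order `2N` and parity opposite to
    -- `N`. Checking it at the `N` points `ξ_n^{(h_n)}` suffices.
    refine ExpPolyOrder.eq_zero_of_odd (ι := Fin N)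
      (f := fun lam => S (X.idxNat h) ⬝ᵥ (X.transfer κ lam *ᵥ v - t lam • v))
      (x := fun n => X.shift n (X.idxNat h n)) ?_ ?_
      (injective_exp_shift hη hξ _ (idxNat_le h)) (fun n => ?_) lam
    · simp only [dotProduct, mulVec, Pi.sub_apply, Pi.smul_apply, smul_eq_mul, Fintype.card_fin]
      refine ExpPolyOrder.sum _ fun k _ => ExpPolyOrder.const_mul _ (ExpPolyOrder.sub ?_ ?_)
      · refine ExpPolyOrder.sum _ fun l _ => ?_
        simpa only [mul_comm] using (X.transfer_order κ k l).const_mul (v l)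
      · simpa only [mul_comm] using ht.const_mul (v k)
    · intro z
      rw [transfer_add_pi, htp, smul_mulVec, mul_smul, ← smul_sub, dotProduct_smul, smul_eq_mul,
        Fintype.card_fin]
    · rw [dotProduct_sub, dotProduct_mulVec, hS.vecMul_transfer hη hξ hκ (idxNat_le h),
        sub_dotProduct, smul_dotProduct, smul_dotProduct, dotProduct_smul, hv' _ (idxNat_le h)]
      set g := X.idxNat h
      have hg : ∀ m, g m ≤ X.twoS m := idxNat_le h
      have split : ∀ g' : Fin N → ℕ, (∀ m, m ≠ n → g' m = g m) →
          ∏ m, q m (g' m) = q n (g' n) * ∏ m ∈ Finset.univ.erase n, q m (g m) := fun g' hg' => by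
        rw [← Finset.mul_prod_erase _ _ (Finset.mem_univ n)]
        congr 1
        exact Finset.prod_congr rfl fun m hm => by rw [hg' m (Finset.ne_of_mem_erase hm)]
      have h1 : S (g - Pi.single n 1) ⬝ᵥ v =
          q n (g n - 1) * ∏ m ∈ Finset.univ.erase n, q m (g m) := by
        rw [hv' (g - Pi.single n 1) fun m => (Nat.sub_le _ _).trans (hg m), split _ fun m hm => by simp [hm]]
        simp
      -- The factor `a` is kept because the component formula is unavailable when `g n = 2s_n`,
      -- where `a` vanishes.
      have h2 : X.a (X.shift n (g n)) • (S (g + Pi.single n 1) ⬝ᵥ v) =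
          X.a (X.shift n (g n)) • (q n (g n + 1) * ∏ m ∈ Finset.univ.erase n, q m (g m)) := by
        rcases (hg n).lt_or_eq with hlt | heq
        · rw [hv' (g + Pi.single n 1) fun m => ?_, split _ fun m hm => by simp [hm]]
          · simp
          · rcases eq_or_ne m n with rfl | hm
            · simpa using hlt
            · simpa [hm] using hg m
        · rw [heq, a_shift_last, zero_smul, zero_smul]
      rw [h1, h2, split g fun _ _ => rfl]
      have := hq n (g n) (hg n)
      simp only [smul_eq_mul]
      linear_combination (-∏ m ∈ Finset.univ.erase n, q m (g m)) * this

end Sov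

end XXZChain

/-! ### Solutions of the Baxter equation from product covectors -/

namespace XXZChain

section PairPropagation

open Complex Matrix

variable {N : ℕ} (X : XXZChain N)

/-- The local covector `ω_n(λ)` with gauge parameter `p`. -/
noncomputable def localPair (n : Fin N) (p lam : ℂ) (k : ℕ) : ℂ :=
  (-1) ^ k * p⁻¹ ^ k * exp (k * (lam - (X.twoS n : ℂ) / 2 * X.η)) *
    ∏ j ∈ Finset.range k, X.ladder n (j + 1) / X.qInt ((j + 1 : ℕ) : ℂ)

variable {X}

theorem Generic.qInt_ne_zero (hη : X.Generic) {k : ℕ} (hk : k ≠ 0) : X.qInt k ≠ 0 := by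
  rw [qInt, mul_comm]
  exact div_ne_zero (hη.sinh_nat_mul_ne_zero hk) hη.sinh_ne_zero

theorem localPair_succ (n : Fin N) (p lam : ℂ) (k : ℕ) :
    X.localPair n p lam (k + 1) = -(X.localPair n p lam k * p⁻¹ *
      exp (lam - (X.twoS n : ℂ) / 2 * X.η) * (X.ladder n (k + 1) / X.qInt ((k + 1 : ℕ) : ℂ))) := by
  have : exp (((k + 1 : ℕ) : ℂ) * (lam - (X.twoS n : ℂ) / 2 * X.η)) =
      exp (k * (lam - (X.twoS n : ℂ) / 2 * X.η)) * exp (lam - (X.twoS n : ℂ) / 2 * X.η) := by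
    rw [← exp_add]; push_cast; ring_nf
  rw [localPair, this, Finset.prod_range_succ, pow_succ, pow_succ, localPair]
  ring

/-- The ratio of consecutive components is chosen so that `S^-`, and likewise `S^+`, multiplies each
component by an explicit `sinh`. -/
theorem localPair_succ_mul_ladder (hη : X.Generic) (n : Fin N) (p lam : ℂ) (k : ℕ) :
    sinh X.η * (X.localPair n p lam (k + 1) * X.ladder n (k + 1)) =
      -(X.localPair n p lam k * p⁻¹ * exp (lam - (X.twoS n : ℂ) / 2 * X.η) *
        sinh (X.η * ((X.twoS n : ℂ) - k))) := by
  have h1 := X.ladder_sq n (k + 1)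
  have h2 := hη.qInt_ne_zero (Nat.succ_ne_zero k)
  have h3 := X.sinh_mul_qInt hη.sinh_ne_zero ((X.twoS n : ℂ) - k)
  rw [show (X.twoS n : ℂ) - ((k + 1 : ℕ) : ℂ) + 1 = (X.twoS n : ℂ) - k by push_cast; ring] at h1
  rw [Nat.succ_eq_add_one] at h2
  have h4 : X.ladder n (k + 1) / X.qInt ((k + 1 : ℕ) : ℂ) * X.ladder n (k + 1) =
      X.qInt ((X.twoS n : ℂ) - k) := by
    rw [div_mul_eq_mul_div, h1, mul_div_cancel_left₀ _ h2]
  rw [localPair_succ, ← h3, ← h4]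
  ring

theorem localPair_mul_ladder (hη : X.Generic) (n : Fin N) {p : ℂ} (hp : p ≠ 0) (lam : ℂ) (k : ℕ) :
    sinh X.η * (X.localPair n p lam k * X.ladder n (k + 1)) =
      -(X.localPair n p lam (k + 1) * p * exp (-(lam - (X.twoS n : ℂ) / 2 * X.η)) *
        sinh (X.η * ((k + 1 : ℕ) : ℂ))) := by
  have h2 := hη.qInt_ne_zero (Nat.succ_ne_zero k)
  have h3 := X.sinh_mul_qInt hη.sinh_ne_zero ((k + 1 : ℕ) : ℂ)
  rw [Nat.succ_eq_add_one] at h2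
  rw [localPair_succ, ← h3, exp_neg]
  have := exp_ne_zero (lam - (X.twoS n : ℂ) / 2 * X.η)
  field_simp

variable (X) in
/-- The local covector as a function on the local index set. -/
noncomputable def localPairVec (n : Fin N) (p lam : ℂ) : X.LocalIdx n → ℂ :=
  fun k => X.localPair n p lam k

theorem localPairVec_vecMul_diagSz (n : Fin N) (p lam : ℂ) (f : ℂ → ℂ) (k : X.LocalIdx n) :
    (X.localPairVec n p lam ᵥ* X.diagSz n f) k =
      X.localPair n p lam k * f ((X.twoS n : ℂ) / 2 - (k : ℕ)) := by
  rw [diagSz, vecMul_diagonal, localPairVec]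

theorem localPairVec_vecMul_sMinus (hη : X.Generic) (n : Fin N) (p lam : ℂ) (k : X.LocalIdx n) :
    sinh X.η * (X.localPairVec n p lam ᵥ* X.sMinus n) k =
      -(X.localPair n p lam k * p⁻¹ * exp (lam - (X.twoS n : ℂ) / 2 * X.η) *
        sinh (X.η * ((X.twoS n : ℂ) - (k : ℕ)))) := by
  rw [vecMul, dotProduct]
  rcases (Nat.le_of_lt_succ k.2).lt_or_eq with hk | hk
  · rw [Finset.sum_eq_single ⟨k + 1, by omega⟩, ← localPair_succ_mul_ladder hη]
    · simp [sMinus, localPairVec]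
    · intro i _ hi
      have : (i : ℕ) ≠ k + 1 := fun h => hi (Fin.ext h)
      simp [sMinus, this]
    · simp
  · rw [Finset.sum_eq_zero]
    · simp [hk]
    · intro i _
      have : (i : ℕ) ≠ k + 1 := by have := i.2; omega
      simp [sMinus, this]

theorem localPairVec_vecMul_sPlus (hη : X.Generic) (n : Fin N) {p : ℂ} (hp : p ≠ 0) (lam : ℂ)
    (k : X.LocalIdx n) :
    sinh X.η * (X.localPairVec n p lam ᵥ* X.sPlus n) k =
      -(X.localPair n p lam k * p * exp (-(lam - (X.twoS n : ℂ) / 2 * X.η)) *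
        sinh (X.η * (k : ℕ))) := by
  rw [vecMul, dotProduct]
  rcases k with ⟨_ | k, hk⟩
  · rw [Finset.sum_eq_zero]
    · simp
    · intro i _
      simp [sPlus]
  · rw [Finset.sum_eq_single ⟨k, by omega⟩, ← localPair_mul_ladder hη n hp]
    · simp [sPlus, localPairVec]
    · intro i _ hi
      have : k + 1 ≠ (i : ℕ) + 1 := fun h => hi (Fin.ext (by simpa using h.symm))
      simp only [sPlus, if_neg this, mul_zero]
    · simp

theorem localPair_add (n : Fin N) (p lam c : ℂ) (k : ℕ) :
    X.localPair n p (lam + c) k = X.localPair n p lam k * exp (k * c) := by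
  have : exp (k * (lam + c - (X.twoS n : ℂ) / 2 * X.η)) =
      exp (k * (lam - (X.twoS n : ℂ) / 2 * X.η)) * exp (k * c) := by
    rw [← exp_add]; ring_nf
  rw [localPair, this, localPair]; ring

/-- In these four identities `σ = s_n η` and `y = k η`; the factor `exp (± y)` is the effect of `λ ↦
λ ± η` on the `k`-th component. -/
theorem pair_identity₁ (L σ y : ℂ) :
    sinh (L + (σ - y)) - exp (L - σ) * sinh (σ + σ - y) = exp (-(σ + σ)) * sinh (L - σ) * exp y := by
  simp only [Complex.sinh, exp_add, exp_sub, exp_neg, neg_sub]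
  field_simp
  ring

theorem pair_identity₂ (L σ y : ℂ) :
    sinh (L - (σ - y)) - exp (-(L - σ)) * sinh y = sinh (L - σ) * exp y := by
  simp only [Complex.sinh, exp_sub, exp_neg, neg_sub]
  field_simp
  ring

theorem pair_identity₃ (L σ y : ℂ) :
    sinh (L - (σ - y)) + exp (σ + σ) * exp (L - σ) * sinh (σ + σ - y) =
      exp (σ + σ) * sinh (L + σ) * exp (-y) := by
  simp only [Complex.sinh, exp_add, exp_sub, exp_neg, neg_sub]
  field_simp
  ring

theorem pair_identity₄ (L σ y : ℂ) :
    exp (-(L - σ)) * sinh y + exp (σ + σ) * sinh (L + (σ - y)) =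
      exp (σ + σ) * sinh (L + σ) * exp (-y) := by
  simp only [Complex.sinh, exp_add, exp_sub, exp_neg, neg_sub]
  field_simp
  ring

/-- Together with `localPairVec_column_one`: the Lax matrix sends the auxiliary column `(1, p)` to a
multiple of `(1, p exp (2 s_n η))` and shifts the local covector by `η`. -/
theorem localPairVec_column_zero (hη : X.Generic) (n : Fin N) {p : ℂ} (hp : p ≠ 0) (lam : ℂ) :
    X.localPairVec n p lam ᵥ* (X.localLax n lam 0 0 + p • X.localLax n lam 0 1) =
      (exp (-(X.twoS n * X.η)) * sinh (lam - (X.twoS n : ℂ) / 2 * X.η)) •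
        X.localPairVec n p (lam + X.η) := by
  funext k
  have hm := localPairVec_vecMul_sMinus hη n p lam k
  rw [mul_comm X.η] at hm
  have hpp : p * p⁻¹ = 1 := mul_inv_cancel₀ hp
  have h := pair_identity₁ lam ((X.twoS n : ℂ) / 2 * X.η) ((k : ℕ) * X.η)
  rw [← add_mul, add_halves, ← sub_mul, ← sub_mul] at h
  simp only [vecMul_add, vecMul_smul, Pi.add_apply, Pi.smul_apply, smul_eq_mul, localLax, of_apply,
    cons_val_zero, cons_val_one, cons_val_fin_one, localPairVec_vecMul_diagSz, mul_comm X.η]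
  rw [localPairVec, localPair_add]
  linear_combination X.localPair n p lam k * h + p * hm - X.localPair n p lam k *
    exp (lam - (X.twoS n : ℂ) / 2 * X.η) * sinh (((X.twoS n : ℂ) - (k : ℕ)) * X.η) * hpp

theorem localPairVec_column_one (hη : X.Generic) (n : Fin N) {p : ℂ} (hp : p ≠ 0) (lam : ℂ) :
    X.localPairVec n p lam ᵥ* (X.localLax n lam 1 0 + p • X.localLax n lam 1 1) =
      (p * sinh (lam - (X.twoS n : ℂ) / 2 * X.η)) • X.localPairVec n p (lam + X.η) := by
  funext k
  have hm := localPairVec_vecMul_sPlus hη n hp lam k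
  rw [mul_comm X.η] at hm
  have h := pair_identity₂ lam ((X.twoS n : ℂ) / 2 * X.η) ((k : ℕ) * X.η)
  rw [← sub_mul] at h
  simp only [vecMul_add, vecMul_smul, Pi.add_apply, Pi.smul_apply, smul_eq_mul, localLax, of_apply,
    cons_val_zero, cons_val_one, cons_val_fin_one, localPairVec_vecMul_diagSz, mul_comm X.η]
  rw [localPairVec, localPair_add]
  linear_combination p * X.localPair n p lam k * h + hm

/-- Together with `localPairVec_row_zero`: with `p' = p exp (2 s_n η)`, the auxiliary row `(-p', 1)`
is sent to a multiple of `(-p, 1)`, with the opposite shift of the local covector. -/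
theorem localPairVec_row_one (hη : X.Generic) (n : Fin N) {p : ℂ} (hp : p ≠ 0) (lam : ℂ) :
    X.localPairVec n p lam ᵥ* (X.localLax n lam 1 1 -
        (p * exp (X.twoS n * X.η)) • X.localLax n lam 0 1) =
      (exp (X.twoS n * X.η) * sinh (lam + (X.twoS n : ℂ) / 2 * X.η)) •
        X.localPairVec n p (lam - X.η) := by
  funext k
  have hm := localPairVec_vecMul_sMinus hη n p lam k
  rw [mul_comm X.η] at hm
  have hpp : p * p⁻¹ = 1 := mul_inv_cancel₀ hp
  have h := pair_identity₃ lam ((X.twoS n : ℂ) / 2 * X.η) ((k : ℕ) * X.η)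
  rw [← add_mul, add_halves, ← sub_mul, ← sub_mul] at h
  simp only [vecMul_sub, vecMul_smul, Pi.sub_apply, Pi.smul_apply, smul_eq_mul, localLax, of_apply,
    cons_val_zero, cons_val_one, cons_val_fin_one, localPairVec_vecMul_diagSz, mul_comm X.η]
  rw [localPairVec, sub_eq_add_neg lam X.η, localPair_add, mul_neg]
  linear_combination X.localPair n p lam k * h - p * exp (X.twoS n * X.η) * hm +
    X.localPair n p lam k * exp (X.twoS n * X.η) * exp (lam - (X.twoS n : ℂ) / 2 * X.η) *
      sinh (((X.twoS n : ℂ) - (k : ℕ)) * X.η) * hpp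

theorem localPairVec_row_zero (hη : X.Generic) (n : Fin N) {p : ℂ} (hp : p ≠ 0) (lam : ℂ) :
    X.localPairVec n p lam ᵥ* (X.localLax n lam 1 0 -
        (p * exp (X.twoS n * X.η)) • X.localLax n lam 0 0) =
      (-p * (exp (X.twoS n * X.η) * sinh (lam + (X.twoS n : ℂ) / 2 * X.η))) •
        X.localPairVec n p (lam - X.η) := by
  funext k
  have hm := localPairVec_vecMul_sPlus hη n hp lam k
  rw [mul_comm X.η] at hm
  have h := pair_identity₄ lam ((X.twoS n : ℂ) / 2 * X.η) ((k : ℕ) * X.η)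
  rw [← add_mul, add_halves, ← sub_mul] at h
  simp only [vecMul_sub, vecMul_smul, Pi.sub_apply, Pi.smul_apply, smul_eq_mul, localLax, of_apply,
    cons_val_zero, cons_val_one, cons_val_fin_one, localPairVec_vecMul_diagSz, mul_comm X.η]
  rw [localPairVec, sub_eq_add_neg lam X.η, localPair_add, mul_neg]
  linear_combination -p * X.localPair n p lam k * h + hm

/-! The gauge parameters along the chain. -/

variable (X) in
/-- Twice the total spin of the first `k` sites. -/
noncomputable def partialSpin (k : ℕ) : ℕ :=
  ∑ i ∈ Finset.range k, if h : i < N then X.twoS ⟨i, h⟩ else 0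

theorem partialSpin_self : X.partialSpin N = X.numRoots := by
  simp [partialSpin, Finset.sum_range, numRoots]

theorem partialSpin_succ {k : ℕ} (hk : k < N) :
    X.partialSpin (k + 1) = X.partialSpin k + X.twoS ⟨k, hk⟩ := by
  rw [partialSpin, Finset.sum_range_succ, dif_pos hk, partialSpin]

variable (X) in
/-- The gauge parameter to the right of site `k`. -/
noncomputable def gauge (p : ℂ) (k : ℕ) : ℂ := p * exp (X.partialSpin k * X.η)

theorem gauge_succ (p : ℂ) {k : ℕ} (hk : k < N) :
    X.gauge p (k + 1) = X.gauge p k * exp (X.twoS ⟨k, hk⟩ * X.η) := by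
  rw [gauge, gauge, partialSpin_succ hk, mul_assoc, ← exp_add]; push_cast; ring_nf

theorem gauge_ne_zero {p : ℂ} (hp : p ≠ 0) (k : ℕ) : X.gauge p k ≠ 0 :=
  mul_ne_zero hp (exp_ne_zero _)

variable (X) in
/-- The local covectors at the first `k` sites, completed by given covectors at the others. -/
noncomputable def pairHead (p lam : ℂ) (k : ℕ) (ψ : ∀ n, X.LocalIdx n → ℂ) (n : Fin N) :
    X.LocalIdx n → ℂ :=
  if (n : ℕ) < k then X.localPairVec n (X.gauge p n) (lam - X.ξ n) else ψ n

theorem pairHead_zero (p lam : ℂ) (ψ : ∀ n, X.LocalIdx n → ℂ) : X.pairHead p lam 0 ψ = ψ := by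
  funext n; simp [pairHead]

theorem pairHead_succ (p lam : ℂ) {k : ℕ} (hk : k < N) (ψ : ∀ n, X.LocalIdx n → ℂ) :
    X.pairHead p lam (k + 1) ψ = X.pairHead p lam k (Function.update ψ ⟨k, hk⟩
      (X.localPairVec ⟨k, hk⟩ (X.gauge p k) (lam - X.ξ ⟨k, hk⟩))) := by
  funext n
  rcases lt_trichotomy (n : ℕ) k with h | h | h
  · simp [pairHead, h, h.trans (Nat.lt_succ_self k)]
  · obtain rfl : n = ⟨k, hk⟩ := Fin.ext h
    simp [pairHead]
  · have hne : n ≠ ⟨k, hk⟩ := fun he => h.ne' (congrArg Fin.val he)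
    simp [pairHead, hne, h.not_gt, (Nat.succ_le_of_lt h).not_gt]

theorem pairHead_update (p lam : ℂ) {k : ℕ} (hk : k < N) (ψ : ∀ n, X.LocalIdx n → ℂ)
    (φ : X.LocalIdx ⟨k, hk⟩ → ℂ) :
    Function.update (X.pairHead p lam k ψ) ⟨k, hk⟩ φ =
      X.pairHead p lam k (Function.update ψ ⟨k, hk⟩ φ) := by
  funext n
  rcases eq_or_ne n ⟨k, hk⟩ with rfl | hne
  · simp [pairHead]
  · simp [pairHead, hne]

theorem pairHead_apply_self (p lam : ℂ) {k : ℕ} (hk : k < N) (ψ : ∀ n, X.LocalIdx n → ℂ) :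
    X.pairHead p lam k ψ ⟨k, hk⟩ = ψ ⟨k, hk⟩ := by
  simp [pairHead]

theorem prodCov_vecMul_atSite_of_eq {φ : ∀ n, X.LocalIdx n → ℂ} {n : Fin N}
    {A : Matrix (X.LocalIdx n) (X.LocalIdx n) ℂ} {c : ℂ} {ψ : X.LocalIdx n → ℂ}
    (h : φ n ᵥ* A = c • ψ) :
    X.prodCov φ ᵥ* X.atSite n A = c • X.prodCov (Function.update φ n ψ) := by
  rw [prodCov_vecMul_atSite, h, prodCov_update_smul]

variable (X) in
/-- Partial products of the function `d`. -/
noncomputable def partialD (k : ℕ) (lam : ℂ) : ℂ := ∏ i ∈ Finset.range k,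
  if h : i < N then sinh (lam - X.ξ ⟨i, h⟩ - (X.twoS ⟨i, h⟩ : ℂ) / 2 * X.η) else 1

variable (X) in
/-- Partial products of the function `a`. -/
noncomputable def partialA (k : ℕ) (lam : ℂ) : ℂ := ∏ i ∈ Finset.range k,
  if h : i < N then sinh (lam - X.ξ ⟨i, h⟩ + (X.twoS ⟨i, h⟩ : ℂ) / 2 * X.η) else 1

theorem partialD_self (lam : ℂ) : X.partialD N lam = X.d lam := by
  simp [partialD, Finset.prod_range, d]

theorem partialA_self (lam : ℂ) : X.partialA N lam = X.a lam := by
  simp only [partialA, Finset.prod_range, Fin.is_lt, dif_pos, Fin.eta, a, shift]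
  exact Finset.prod_congr rfl fun n _ => by ring_nf

/-- The column passes through the first `k` sites before the next one. Arbitrary covectors `ψ` at
the remaining sites are needed because site `k` is still unshifted when the induction hypothesis is
used. -/
theorem pairHead_column (hη : X.Generic) {p : ℂ} (hp : p ≠ 0) (lam : ℂ) {k : ℕ} (hk : k ≤ N)
    (ψ : ∀ n, X.LocalIdx n → ℂ) (i : Fin 2) :
    X.prodCov (X.pairHead p lam k ψ) ᵥ*
        (X.partialMonodromy k lam i 0 + p • X.partialMonodromy k lam i 1) =
      (![1, X.gauge p k] i * (exp (-(X.partialSpin k * X.η)) * X.partialD k lam)) •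
        X.prodCov (X.pairHead p (lam + X.η) k ψ) := by
  induction k generalizing ψ i with
  | zero =>
    rw [pairHead_zero, pairHead_zero, partialMonodromy_zero]
    fin_cases i <;> simp [partialD, partialSpin, gauge, vecMul_smul, one_apply]
  | succ k ih =>
    have hk' : k < N := hk
    set n : Fin N := ⟨k, hk'⟩
    have hc := X.entriesCommute_partialMonodromy hk' lam (lam - X.ξ n)
    have hsite : X.prodCov (X.pairHead p (lam + X.η) k (Function.update ψ n
        (X.localPairVec n (X.gauge p k) (lam - X.ξ n)))) ᵥ*
        (X.lax n (lam - X.ξ n) i 0 + X.gauge p k • X.lax n (lam - X.ξ n) i 1) =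
        (![1, X.gauge p (k + 1)] i * (exp (-(X.twoS n * X.η)) *
          sinh (lam - X.ξ n - (X.twoS n : ℂ) / 2 * X.η))) •
        X.prodCov (X.pairHead p (lam + X.η) (k + 1) ψ) := by
      rw [lax_apply, lax_apply, ← atSite_smul, ← atSite_add, pairHead_succ _ _ hk']
      have e : X.pairHead p (lam + X.η) k (Function.update ψ n
          (X.localPairVec n (X.gauge p k) (lam + X.η - X.ξ n))) =
          Function.update (X.pairHead p (lam + X.η) k (Function.update ψ n
          (X.localPairVec n (X.gauge p k) (lam - X.ξ n)))) n
          (X.localPairVec n (X.gauge p k) (lam - X.ξ n + X.η)) := by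
        rw [pairHead_update, Function.update_idem, sub_add_eq_add_sub]
      rw [e]
      refine prodCov_vecMul_atSite_of_eq ?_
      rw [pairHead_apply_self, Function.update_self]
      fin_cases i
      · exact (localPairVec_column_zero hη n (gauge_ne_zero hp k) _).trans (by simp)
      · refine (localPairVec_column_one hη n (gauge_ne_zero hp k) _).trans ?_
        congr 1
        have h1 : exp (X.twoS n * X.η) * exp (-(X.twoS n * X.η)) = 1 := by
          rw [← exp_add, add_neg_cancel, exp_zero]
        simp only [Fin.mk_one, cons_val_one, cons_val_fin_one, gauge_succ p hk']
        linear_combination -X.gauge p k * sinh (lam - X.ξ n - (X.twoS n : ℂ) / 2 * X.η) * h1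
    have hexp : exp (-(X.partialSpin (k + 1) * X.η)) =
        exp (-(X.partialSpin k * X.η)) * exp (-(X.twoS n * X.η)) := by
      have hs : X.partialSpin (k + 1) = X.partialSpin k + X.twoS n := partialSpin_succ hk'
      rw [← exp_add, hs]; push_cast; ring_nf
    have hD : X.partialD (k + 1) lam =
        X.partialD k lam * sinh (lam - X.ξ n - (X.twoS n : ℂ) / 2 * X.η) := by
      rw [partialD, Finset.prod_range_succ, dif_pos hk', partialD]
    have expand : X.partialMonodromy (k + 1) lam i 0 + p • X.partialMonodromy (k + 1) lam i 1 =
        (X.partialMonodromy k lam 0 0 + p • X.partialMonodromy k lam 0 1) *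
          X.lax n (lam - X.ξ n) i 0 +
        (X.partialMonodromy k lam 1 0 + p • X.partialMonodromy k lam 1 1) *
          X.lax n (lam - X.ξ n) i 1 := by
      rw [partialMonodromy_succ X hk', mul_apply, mul_apply, Fin.sum_univ_two, Fin.sum_univ_two,
        ← (hc 0 0 i 0).eq, ← (hc 0 1 i 0).eq, ← (hc 1 0 i 1).eq, ← (hc 1 1 i 1).eq]
      simp only [smul_add, add_mul, smul_mul_assoc]
      abel
    rw [expand, vecMul_add, ← vecMul_vecMul, ← vecMul_vecMul, pairHead_succ p lam hk',
      ih hk'.le, ih hk'.le]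
    simp only [cons_val_zero, cons_val_one, cons_val_fin_one, one_mul, smul_vecMul]
    calc _ = (exp (-(X.partialSpin k * X.η)) * X.partialD k lam) •
          (X.prodCov (X.pairHead p (lam + X.η) k (Function.update ψ n
            (X.localPairVec n (X.gauge p k) (lam - X.ξ n)))) ᵥ*
          (X.lax n (lam - X.ξ n) i 0 + X.gauge p k • X.lax n (lam - X.ξ n) i 1)) := by
          rw [vecMul_add, vecMul_smul]; module
      _ = _ := by
          rw [hsite, smul_smul, hexp, hD]
          congr 1; ring

/-- The row enters from the left of the monodromy product, so here the last site is treated before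
the induction hypothesis. -/
theorem pairHead_row (hη : X.Generic) {p : ℂ} (hp : p ≠ 0) (lam : ℂ) {k : ℕ} (hk : k ≤ N)
    (ψ : ∀ n, X.LocalIdx n → ℂ) :
    X.prodCov (X.pairHead p lam k ψ) ᵥ*
        (X.partialMonodromy k lam 1 0 - X.gauge p k • X.partialMonodromy k lam 0 0) =
      (-p * (exp (X.partialSpin k * X.η) * X.partialA k lam)) •
        X.prodCov (X.pairHead p (lam - X.η) k ψ) := by
  induction k generalizing ψ with
  | zero =>
    rw [pairHead_zero, pairHead_zero, partialMonodromy_zero]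
    simp [partialA, partialSpin, gauge, vecMul_smul, vecMul_neg]
  | succ k ih =>
    have hk' : k < N := hk
    set n : Fin N := ⟨k, hk'⟩
    set c := exp (X.twoS n * X.η) * sinh (lam - X.ξ n + (X.twoS n : ℂ) / 2 * X.η)
    set φ := X.prodCov (X.pairHead p lam k (Function.update ψ n
      (X.localPairVec n (X.gauge p k) (lam - X.η - X.ξ n)))) with hφ
    have hsite : ∀ (A : Matrix (X.LocalIdx n) (X.LocalIdx n) ℂ) (y : ℂ),
        X.localPairVec n (X.gauge p k) (lam - X.ξ n) ᵥ* A =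
          y • X.localPairVec n (X.gauge p k) (lam - X.ξ n - X.η) →
        X.prodCov (X.pairHead p lam (k + 1) ψ) ᵥ* X.atSite n A = y • φ := fun A y hA => by
      have e : X.pairHead p lam k (Function.update ψ n
          (X.localPairVec n (X.gauge p k) (lam - X.η - X.ξ n))) =
          Function.update (X.pairHead p lam (k + 1) ψ) n
          (X.localPairVec n (X.gauge p k) (lam - X.ξ n - X.η)) := by
        rw [pairHead_succ _ _ hk', pairHead_update, Function.update_idem, sub_right_comm]
      rw [hφ, e]
      refine prodCov_vecMul_atSite_of_eq ?_
      rw [pairHead_succ _ _ hk', pairHead_apply_self, Function.update_self]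
      exact hA
    have h0 := hsite _ _ (localPairVec_row_zero hη n (gauge_ne_zero hp k) (lam - X.ξ n))
    have h1 := hsite _ _ (localPairVec_row_one hη n (gauge_ne_zero hp k) (lam - X.ξ n))
    rw [← gauge_succ p hk', sub_eq_add_neg, ← neg_smul, atSite_add, atSite_smul, ← lax_apply,
      ← lax_apply] at h0 h1
    have hexp : exp (X.partialSpin (k + 1) * X.η) =
        exp (X.partialSpin k * X.η) * exp (X.twoS n * X.η) := by
      have hs : X.partialSpin (k + 1) = X.partialSpin k + X.twoS n := partialSpin_succ hk'
      rw [← exp_add, hs]; push_cast; ring_nf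
    have hA : X.partialA (k + 1) lam =
        X.partialA k lam * sinh (lam - X.ξ n + (X.twoS n : ℂ) / 2 * X.η) := by
      rw [partialA, Finset.prod_range_succ, dif_pos hk', partialA]
    have expand : X.partialMonodromy (k + 1) lam 1 0 -
        X.gauge p (k + 1) • X.partialMonodromy (k + 1) lam 0 0 =
        (X.lax n (lam - X.ξ n) 1 0 + (-X.gauge p (k + 1)) • X.lax n (lam - X.ξ n) 0 0) *
          X.partialMonodromy k lam 0 0 +
        (X.lax n (lam - X.ξ n) 1 1 + (-X.gauge p (k + 1)) • X.lax n (lam - X.ξ n) 0 1) *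
          X.partialMonodromy k lam 1 0 := by
      rw [partialMonodromy_succ X hk', mul_apply, mul_apply, Fin.sum_univ_two, Fin.sum_univ_two]
      simp only [smul_add, add_mul, smul_mul_assoc, neg_smul, neg_mul]
      abel
    have hih := ih hk'.le (Function.update ψ n
      (X.localPairVec n (X.gauge p k) (lam - X.η - X.ξ n)))
    rw [← hφ, ← pairHead_succ _ _ hk'] at hih
    rw [expand, vecMul_add, ← vecMul_vecMul, ← vecMul_vecMul, h0, h1]
    calc _ = c • (φ ᵥ* (X.partialMonodromy k lam 1 0 -
          X.gauge p k • X.partialMonodromy k lam 0 0)) := by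
          rw [vecMul_sub, vecMul_smul, smul_vecMul, smul_vecMul]; module
      _ = _ := by
          rw [hih, smul_smul, hexp, hA]
          congr 1; simp only [c]; ring

/-- The product covector `Ω(λ)` solving the pair propagation equation. -/
theorem vecMul_transfer_prodCov (hη : X.Generic) {κ : ℂ} (hκ : κ ≠ 0) (lam : ℂ)
    (ψ : ∀ n, X.LocalIdx n → ℂ) {p : ℂ} (hp : p = κ⁻¹ * exp (-(X.numRoots * X.η / 2))) :
    X.prodCov (X.pairHead p lam N ψ) ᵥ* X.transfer κ lam =
      (exp (-(X.numRoots * X.η / 2)) * X.d lam) • X.prodCov (X.pairHead p (lam + X.η) N ψ) -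
      (exp (X.numRoots * X.η / 2) * X.a lam) • X.prodCov (X.pairHead p (lam - X.η) N ψ) := by
  have hp0 : p ≠ 0 := by rw [hp]; exact mul_ne_zero (inv_ne_zero hκ) (exp_ne_zero _)
  have h1 := pairHead_column hη hp0 lam le_rfl ψ 0
  have h2 := pairHead_row hη hp0 lam le_rfl ψ
  rw [partialMonodromy_self, partialD_self, partialSpin_self, cons_val_zero, one_mul, vecMul_add,
    vecMul_smul] at h1
  rw [partialMonodromy_self, partialA_self, partialSpin_self, vecMul_sub, vecMul_smul, gauge,
    partialSpin_self] at h2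
  set E := exp (X.numRoots * X.η / 2) with hE
  have hE0 : E ≠ 0 := exp_ne_zero _
  have e1 : exp (-(X.numRoots * X.η / 2)) = E⁻¹ := exp_neg _
  have e2 : exp ((X.numRoots : ℂ) * X.η) = E ^ 2 := by rw [hE, ← exp_nat_mul]; push_cast; ring_nf
  have e3 : exp (-((X.numRoots : ℂ) * X.η)) = (E ^ 2)⁻¹ := by rw [exp_neg, e2]
  rw [e3] at h1
  rw [e2] at h2
  rw [e1] at hp ⊢
  -- The row relation eliminates `C` in favour of `A`, and the column relation eliminates `A` in
  -- favour of `B`. The terms in `B` cancel when `κ² p² exp (𝖭_s η) = 1`, which the choice of `p`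
  -- ensures.
  have h3 := sub_eq_iff_eq_add.mp h2
  have h4 := eq_sub_of_add_eq h1
  rw [transfer, vecMul_add, vecMul_smul, vecMul_smul, h3, h4, smul_add, smul_sub, smul_sub,
    hp]
  simp only [smul_smul]
  rw [show κ * (κ⁻¹ * E⁻¹ * E ^ 2 * ((E ^ 2)⁻¹ * X.d lam)) = E⁻¹ * X.d lam by field_simp,
    show κ * (κ⁻¹ * E⁻¹ * E ^ 2 * (κ⁻¹ * E⁻¹)) = κ⁻¹ by field_simp,
    show κ * (-(κ⁻¹ * E⁻¹) * (E ^ 2 * X.a lam)) = -(E * X.a lam) by field_simp]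
  module

end PairPropagation

end XXZChain

/-! ### Eigenvalues and solutions of the Wronskian identity -/

namespace XXZChain

section Eigenvalues

open Complex Matrix Polynomial

variable {N : ℕ} {X : XXZChain N}

theorem prodCov_pairHead_self (p lam : ℂ) (ψ : ∀ n, X.LocalIdx n → ℂ) (h : X.Idx) :
    X.prodCov (X.pairHead p lam N ψ) h =
      (∏ n, X.localPair n (X.gauge p n) (-X.ξ n) (h n)) * exp lam ^ ∑ n, (h n : ℕ) := by
  rw [← Finset.prod_pow_eq_pow_sum, ← Finset.prod_mul_distrib, prodCov]
  refine Finset.prod_congr rfl fun n _ => ?_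
  rw [pairHead, if_pos n.2, localPairVec, ← neg_add_eq_sub, localPair_add, exp_nat_mul]

theorem localPair_zero (n : Fin N) (p lam : ℂ) : X.localPair n p lam 0 = 1 := by
  simp [localPair]

/-- The component of `Ω(λ)` at `h` is a constant times `exp (λ ∑ h_n)`. Only `h = 0` contributes to
the lowest coefficient, where the constant is 1. -/
theorem isExpPoly_prodCov_pairHead (p : ℂ) (ψ : ∀ n, X.LocalIdx n → ℂ) (v : X.Idx → ℂ) :
    ∃ hi, IsExpPoly X.numRoots (v 0) hi fun lam =>
      exp (-(X.numRoots * lam / 2)) * (X.prodCov (X.pairHead p lam N ψ) ⬝ᵥ v) := by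
  set c : X.Idx → ℂ := fun h => (∏ n, X.localPair n (X.gauge p n) (-X.ξ n) (h n)) * v h
  refine ⟨_, ∑ h : X.Idx, Polynomial.C (c h) * Polynomial.X ^ ∑ n, (h n : ℕ), ?_, ?_, rfl,
    fun lam => ?_⟩
  · refine natDegree_sum_le_of_forall_le _ _ fun h _ => (natDegree_C_mul_X_pow_le _ _).trans ?_
    exact Finset.sum_le_sum fun n _ => Nat.le_of_lt_succ (h n).2
  · simp only [finsetSum_coeff, coeff_C_mul, coeff_X_pow]
    rw [Finset.sum_eq_single 0]
    · simp [c, localPair_zero]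
    · intro h _ hh
      rw [if_neg, mul_zero]
      intro h0
      refine hh (funext fun n => Fin.ext ?_)
      exact (Finset.sum_eq_zero_iff.mp h0.symm) n (Finset.mem_univ n)
    · simp
  · simp only [eval_finsetSum, eval_mul, eval_C, eval_pow, eval_X, dotProduct,
      prodCov_pairHead_self, c]
    congr 1
    exact Finset.sum_congr rfl fun h _ => by ring

/-- The prefactor `exp (-𝖭_s λ / 2)` absorbs the factors `exp (∓ 𝖭_s η / 2)` of the propagation
equation. -/
theorem baxterEq_prodCov_pairHead (hη : X.Generic) {κ : ℂ} (hκ : κ ≠ 0) {t : ℂ → ℂ}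
    {v : X.Idx → ℂ} (H : ∀ lam, X.transfer κ lam *ᵥ v = t lam • v)
    (ψ : ∀ n, X.LocalIdx n → ℂ) {p : ℂ} (hp : p = κ⁻¹ * exp (-(X.numRoots * X.η / 2))) :
    X.BaxterEq t fun lam =>
      exp (-(X.numRoots * lam / 2)) * (X.prodCov (X.pairHead p lam N ψ) ⬝ᵥ v) := by
  intro z
  have h := congrArg (· ⬝ᵥ v) (vecMul_transfer_prodCov hη hκ z ψ hp)
  simp only [← dotProduct_mulVec, H, dotProduct_smul, sub_dotProduct, smul_dotProduct,
    smul_eq_mul] at h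
  have e1 : exp (-(X.numRoots * (z + X.η) / 2)) =
      exp (-(X.numRoots * z / 2)) * exp (-(X.numRoots * X.η / 2)) := by
    rw [← exp_add]; ring_nf
  have e2 : exp (-(X.numRoots * (z - X.η) / 2)) =
      exp (-(X.numRoots * z / 2)) * exp (X.numRoots * X.η / 2) := by
    rw [← exp_add]; ring_nf
  simp only [e1, e2]
  linear_combination exp (-(X.numRoots * z / 2)) * h

theorem exists_roots_of_mem_spectrumFun (hspin : ∀ n, 1 ≤ X.twoS n) (hη : X.Generic)
    (hξ : X.InhomogeneityCondition) {κ : ℂ} (hκ : κ ≠ 0) {t : ℂ → ℂ} (ht : t ∈ X.spectrumFun κ) :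
    ∃ (ε : ℂ) (r : Fin X.numRoots → ℂ), (ε = 1 ∨ ε = -1) ∧ X.Wronskian ε r ∧
      X.IsTFunction ε r t ∧ X.ProportionalVectors r := by
  obtain ⟨hto, htp⟩ := mem_spectrumFun_order ht
  obtain ⟨v, hv, H⟩ := ht
  -- With all `N` sites occupied by local covectors, the completing family is irrelevant and is
  -- taken to be `0`.
  obtain ⟨hi, hQ⟩ := isExpPoly_prodCov_pairHead (κ⁻¹ * exp (-(X.numRoots * X.η / 2))) 0 v
  exact (baxterEq_prodCov_pairHead hη hκ H 0 rfl).exists_roots hspin hη hξ hto.differentiable htp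
    hQ (eigenvector_apply_zero_ne_zero hη hξ hκ hv H)

/-- One of the two vectors is nonzero at each site. Being a string solution, it is then nonzero at
`h = 0`, as the separated construction requires. -/
theorem BaxterEq.mem_spectrumFun (hη : X.Generic) (hξ : X.InhomogeneityCondition) {κ : ℂ}
    (hκ : κ ≠ 0) {t : ℂ → ℂ} {r : Fin X.numRoots → ℂ} (h : X.BaxterEq t (X.Q r))
    (ht : ExpPolyOrder (2 * N) t) (htp : OddParity N t)
    (hne : ∀ n, ¬ (X.vecQ r n = 0 ∧ X.vecQTilde r n = 0)) : t ∈ X.spectrumFun κ := by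
  have key : ∀ n, ∃ q, X.IsStringSolution t n q ∧ q 0 ≠ 0 := by
    intro n
    by_contra! hcon
    have h1 := h.isStringSolution n
    have h2 := h.isStringSolution_add_pi htp n
    exact hne n ⟨funext fun k => h1.eq_zero hη hξ (hcon _ h1) k (Nat.le_of_lt_succ k.2),
      funext fun k => h2.eq_zero hη hξ (hcon _ h2) k (Nat.le_of_lt_succ k.2)⟩
  choose q hq hq0 using key
  exact mem_spectrumFun_of_isStringSolution hη hξ hκ ht htp hq hq0

end Eigenvalues

end XXZChain

theorem proposition5p1 {N : ℕ} (X : XXZChain N) (hspin : ∀ n, 1 ≤ X.twoS n)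
    (hη : X.Generic) (hξ : X.InhomogeneityCondition) (κ : ℂ) (hκ : κ ≠ 0) :
    (∀ r : Fin X.numRoots → ℂ, X.ProportionalVectors r →
      ∃ ε : ℂ, (ε = 1 ∨ ε = -1) ∧ X.Wronskian ε r ∧
        (∃ t : ℂ → ℂ, X.IsTFunction ε r t) ∧
        ∀ t : ℂ → ℂ, X.IsTFunction ε r t → t ∈ X.spectrumFun κ) ∧
    (∀ t ∈ X.spectrumFun κ,
      ∃ (ε : ℂ) (r : Fin X.numRoots → ℂ), (ε = 1 ∨ ε = -1) ∧ X.Wronskian ε r ∧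
        X.IsTFunction ε r t ∧ X.ProportionalVectors r) := by
  refine ⟨fun r hr => ?_, fun t ht =>
    XXZChain.exists_roots_of_mem_spectrumFun hspin hη hξ hκ ht⟩
  obtain ⟨ε, hε, hW⟩ := hr.exists_wronskian hspin hη hξ
  have hε0 : ε ≠ 0 := by rcases hε with rfl | rfl <;> simp
  obtain ⟨t₀, ht₀, htp, hnum⟩ := hr.exists_quotient hspin hη hξ hε0
  refine ⟨ε, hε, hW, ⟨t₀, XXZChain.isTFunction_of_mul_w ht₀.differentiable hnum⟩, fun t ht => ?_⟩
  obtain rfl := ht.eq_of_mul_w hspin hε0 ht₀.differentiable.continuous hnum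
  exact (XXZChain.BaxterEq.of_wronskianOf hspin hε0 (X.Q_order r).differentiable.continuous
    ht₀.differentiable.continuous hW hnum).mem_spectrumFun hη hξ hκ ht₀ htp fun n => (hr n).2
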